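/- **Conventions.** Everything is over $\mathbb C$ and $\mathbb Z/2$-graded ("space" means superspace, and permutations of tensor factors act with Koszul signs; permutations act from the left, and $\sigma$ moves the $i$th factor to place $\sigma(i)$). $\Pi$ is parity reversion. $\mathbb C^{2n|m}$ has even coordinates $p_1,\dots,p_n,q_1,\dots,q_n$, odd coordinates $x_1,\dots,x_m$, the even skew-symmetric form with $\langle p_i,q_i\rangle=1=-\langle q_i,p_i\rangle$, $\langle x_i,x_i\rangle=1$ and zero on all other pairs of coordinates, and the symplectic form $\omega_{can}=\sum_i dp_i\,dq_i+\frac12\sum_i dx_i\,dx_i$. For a space $V$, $DR(V)$ is the quotient of the free algebra on the letters $v$ and $dv$ ($v\in V$, $dv$ of parity opposite to $v$) by supercommutators, with differential $d$; contractions $i_\xi$ and Lie derivatives $L_\xi$ along vector fields (derivations of the completed tensor algebra $\widehat T(V)$) are defined as usual. $N=\sum_{\sigma\in Z_k}\sigma$ is the norm operator $(V^{\otimes k})_{Z_k}\to V^{\otimes k}$. **Graphs.** A ribbon graph is a finite set of half-edges with a partition into vertices of valency $\ge 3$, a partition into two-element sets (edges) and a cyclic order of the half-edges at every vertex. A fully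 ordered graph of type $(k_1,\dots,k_r)$ is a graph with a linear order of its vertices, of the half-edges at each vertex (the $i$th vertex having valency $k_i$) and of the two half-edges of each edge. An orientation of a ribbon graph $\Gamma$ is a class of full orders inducing the given cyclic orders, modulo cyclic permutations at the vertices and those permutations of vertices and flips of edges whose total sign is $1$. $\mathcal G$ is the free vector space on isomorphism classes of oriented ribbon graphs modulo $(\Gamma,-\sigma)=-(\Gamma,\sigma)$, and $\mathrm{Aut}(\Gamma)$ is the group of automorphisms of the oriented ribbon graph $\Gamma$. **Feynman amplitudes.** Let $V$ carry an even skew-symmetric bilinear form and let $\tilde\Gamma$ be a fully ordered graph of type $(k_1,\dots,k_r)$ with $l$ edges. Number its half-edges $1,\dots,2l$ vertex by vertex, and let the oriented edges be $(i_1,j_1),\dots,(i_l,j_l)$. For $x\in V^{\otimes k_1}\otimes\dots\otimes V^{\otimes k_r}=V^{\otimes 2l}$ put $\tilde F_{\tilde\Gamma}(x)=\kappa(\sigma\cdot x)$, where $\sigma$ moves the factors $i_s,j_s$ to the places $2s-1,2s$ and $\kappa(y_1\otimes\dots\otimes y_{2l})=\langle y_1,y_2\rangle\cdots\langle y_{2l-1},y_{2l}\rangle$;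 on all other summands of $T(T(V))$ put $\tilde F_{\tilde\Gamma}=0$. Let $\tilde{\mathfrak g}_{2n|m}=\bigoplus_{k\ge3}(V^{\otimes k})_{Z_k}$ for $V=\mathbb C^{2n|m}$, let $C(\mathfrak g_{2n|m},\mathfrak{osp}_{2n|m})$ be the space of $\mathfrak{osp}_{2n|m}$-coinvariants of the exterior algebra of $\tilde{\mathfrak g}_{2n|m}$, bigraded by exterior degree $i$ and half the order $j$, and let $C(\mathfrak g,\mathfrak{osp})=\varinjlim_{n,m} C(\mathfrak g_{2n|m},\mathfrak{osp}_{2n|m})$; both are completed to products over $(i,j)$. For an oriented ribbon graph $\Gamma$ represented by $\tilde\Gamma$ let $$F_\Gamma(g_1\wedge\dots\wedge g_i)=\tilde F_{\tilde\Gamma}\Big(\sum_{\sigma\in S_i}\mathrm{sgn}(\sigma)\,\sigma\cdot(Ng_1\otimes\dots\otimes Ng_i)\Big),\qquad \langle\langle x,\Gamma\rangle\rangle=\frac{F_\Gamma(x)}{|\mathrm{Aut}(\Gamma)|}.$$ **Algebras.** Let $A=(U,m,\omega)$ be a minimal symplectic $A_\infty$-algebra whose symplectic form is even and of order zero: $U$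 is finite-dimensional, $m=m_2+m_3+\cdots$ is an odd vector field on $\widehat T(\Pi U^*)$ with $m^2=0$ whose component $m_k$ has order $k$, $\omega$ is an even closed nondegenerate 2-form of order zero on $\Pi U^*$, and $L_m\omega=0$. Let $\langle-,-\rangle=\Upsilon(\omega)$ be the corresponding inner product on $\Pi U$, where $\Upsilon(d(dx\cdot y))=x\otimes y-(-1)^{|x||y|}y\otimes x$; let $\langle-,-\rangle^{-1}$ be the form on $\Pi U^*$ with $\langle\langle x,-\rangle,f\rangle^{-1}=f(x)$; and let $h_k\in(\Pi U^*)^{\otimes k}$ be the tensors $h_k(x_1,\dots,x_k)=\langle m_{k-1}(x_1,\dots,x_{k-1}),x_k\rangle$. The partition function of $A$ is $$Z_A(\Gamma)=\frac{\tilde F^A_{\tilde\Gamma}(h_{k_1}\otimes\dots\otimes h_{k_r})}{|\mathrm{Aut}(\Gamma)|},$$ where $\tilde\Gamma$, of type $(k_1,\dots,k_r)$, represents $\Gamma$ and $\tilde F^A$ is the amplitude formed with $\langle-,-\rangle^{-1}$. Let $h$ be the Hamiltonian of $A$, i.e. $dh=i_m\omega$ and $h$ has no constant term, let $\phi:\Pi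 U^*\to\mathbb C^{2n|m}$ be an even linear isomorphism with $\phi^*\omega=\omega_{can}$, and put $h'=\phi^*(h)$. The characteristic class of $A$ is $$c_A=\exp(h')=1+h'+\tfrac12h'\wedge h'+\cdots+\tfrac1{i!}h'\wedge\dots\wedge h'+\cdots.$$ **Theorem 6.11.** $Z_A$ and the pairing $\langle\langle-,-\rangle\rangle$ (on the chains of $\mathbb C^{2n|m}$ and on $C(\mathfrak g,\mathfrak{osp})$) are well-defined linear maps on $\mathcal G$, that is, independent of the fully ordered graphs chosen to represent oriented ribbon graphs and compatible with the relations of $\mathcal G$; and for every choice of $\phi$, $$\langle\langle c_A,-\rangle\rangle=Z_A\quad\text{in }\mathrm{Hom}(\mathcal G,\mathbb C),$$ both with $c_A$ taken in the chains of $\mathbb C^{2n|m}$ and in the stable limit $C(\mathfrak g,\mathfrak{osp})$. Equivalently, $F_\Gamma(c_A)=|\mathrm{Aut}(\Gamma)|\cdot Z_A(\Gamma)$ for every oriented ribbon graph $\Gamma$. -/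

import Mathlib

open scoped TensorProduct DirectSum

noncomputable section

set_option linter.unusedSectionVars false
set_option linter.unusedSimpArgs false

/-- The sign `(-1)^a` of a parity `a`. -/
def sg (a : ZMod 2) : ℂ := if a = 0 then 1 else -1

theorem zmod2_cases (a : ZMod 2) : a = 0 ∨ a = 1 := by revert a; decide

@[simp] theorem sg_zero : sg 0 = 1 := by simp [sg]

@[simp] theorem sg_one : sg 1 = -1 := by simp [sg]

theorem sg_add (a b : ZMod 2) : sg (a + b) = sg a * sg b := by
  have h : (1 : ZMod 2) + 1 = 0 := by decide
  rcases zmod2_cases a with rfl | rfl <;> rcases zmod2_cases b with rfl | rfl <;> simp [h]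

theorem sg_mul_self (a : ZMod 2) : sg a * sg a = 1 := by
  rcases zmod2_cases a with rfl | rfl <;> simp

theorem sg_sum {ι : Type*} (s : Finset ι) (f : ι → ZMod 2) :
    sg (∑ i ∈ s, f i) = ∏ i ∈ s, sg (f i) := by
  classical
  induction s using Finset.induction_on with
  | empty => simp
  | insert a s ha ih => rw [Finset.sum_insert ha, Finset.prod_insert ha, sg_add, ih]

/-- A vector superspace `V = V₀ ⊕ V₁` over `ℂ`. The decomposition is given by the grading involution
`γ (v₀ + v₁) = v₀ - v₁`, whose eigenspaces for `1` and `-1` are the even part and the odd part. -/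
class Superspace (V : Type*) [AddCommGroup V] [Module ℂ V] where
  γ : V →ₗ[ℂ] V
  γ_γ : ∀ v, γ (γ v) = v

namespace Superspace

variable {V : Type*} [AddCommGroup V] [Module ℂ V] [Superspace V]
variable {W : Type*} [AddCommGroup W] [Module ℂ W] [Superspace W]

/-- The homogeneous part of parity `a`. -/
def part (V : Type*) [AddCommGroup V] [Module ℂ V] [Superspace V] (a : ZMod 2) :
    Submodule ℂ V :=
  LinearMap.ker (γ - sg a • LinearMap.id)

theorem mem_part {a : ZMod 2} {v : V} : v ∈ part V a ↔ γ v = sg a • v := by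
  simp [part, sub_eq_zero]

/-- The projection onto the part of parity `a`. -/
def proj (a : ZMod 2) : V →ₗ[ℂ] V := (1 / 2 : ℂ) • (LinearMap.id + sg a • γ)

theorem proj_apply (a : ZMod 2) (v : V) : proj a v = (1 / 2 : ℂ) • (v + sg a • γ v) := rfl

theorem proj_mem (a : ZMod 2) (v : V) : proj a v ∈ part V a := by
  rw [mem_part, proj_apply, map_smul, map_add, map_smul, γ_γ, smul_comm (sg a), smul_add (sg a),
    smul_smul (sg a), sg_mul_self, one_smul, add_comm (γ v)]

theorem proj_of_mem {a b : ZMod 2} {v : V} (h : v ∈ part V a) :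
    proj b v = if b = a then v else 0 := by
  rw [mem_part] at h
  rw [proj_apply, h, smul_smul]
  rcases zmod2_cases a with rfl | rfl <;> rcases zmod2_cases b with rfl | rfl <;>
    simp [← two_smul ℂ v, smul_smul]

theorem sum_proj (v : V) : ∑ a : ZMod 2, proj a v = v := by
  have : (Finset.univ : Finset (ZMod 2)) = {0, 1} := by decide
  rw [this, Finset.sum_pair (by decide)]
  simp only [proj_apply, sg_zero, sg_one, one_smul, neg_smul, ← smul_add]
  rw [show v + γ v + (v + -γ v) = (2 : ℂ) • v by rw [two_smul]; abel, smul_smul]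
  norm_num

/-- Two linear maps on a tensor power that agree on tensors of homogeneous vectors are equal. -/
theorem tensor_ext {n : ℕ} {E : Type*} [AddCommGroup E] [Module ℂ E]
    {f g : (⨂[ℂ]^n V) →ₗ[ℂ] E}
    (h : ∀ (p : Fin n → ZMod 2) (v : Fin n → V), (∀ i, v i ∈ part V (p i)) →
      f (PiTensorProduct.tprod ℂ v) = g (PiTensorProduct.tprod ℂ v)) : f = g := by
  refine PiTensorProduct.ext (MultilinearMap.ext fun v => ?_)
  have hv : v = fun i => ∑ a : ZMod 2, proj a (v i) := funext fun i => (sum_proj (v i)).symm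
  rw [hv, MultilinearMap.map_sum, MultilinearMap.map_sum]
  exact Finset.sum_congr rfl fun p _ => h p _ fun i => proj_mem _ _

/-- The number (mod 2) of pairs of odd letters whose order is reversed. -/
def oddInv {a b : ℕ} (σ : Fin a ≃ Fin b) (p : Fin a → ZMod 2) : ZMod 2 :=
  ∑ i, ∑ j, if i < j ∧ σ j < σ i then p i * p j else 0

/-- Permutation of the tensor factors with the Koszul sign: the `i`th factor is moved to place
`σ i`. -/
def koszul {a b : ℕ} (σ : Fin a ≃ Fin b) : (⨂[ℂ]^a V) →ₗ[ℂ] (⨂[ℂ]^b V) :=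
  ∑ p : Fin a → ZMod 2, sg (oddInv σ p) •
    ((PiTensorProduct.reindex ℂ (fun _ => V) σ).toLinearMap ∘ₗ
      PiTensorProduct.map fun i => proj (p i))

theorem koszul_tprod {a b : ℕ} (σ : Fin a ≃ Fin b) {p : Fin a → ZMod 2} {v : Fin a → V}
    (hv : ∀ i, v i ∈ part V (p i)) :
    koszul σ (PiTensorProduct.tprod ℂ v) =
      sg (oddInv σ p) • PiTensorProduct.tprod ℂ fun i => v (σ.symm i) := by
  classical
  simp only [koszul, LinearMap.sum_apply, LinearMap.smul_apply, LinearMap.comp_apply,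
    PiTensorProduct.map_tprod, LinearEquiv.coe_coe, PiTensorProduct.reindex_tprod]
  rw [Finset.sum_eq_single p]
  · simp [proj_of_mem (hv _)]
  · intro q _ hq
    obtain ⟨i, hi⟩ := Function.ne_iff.mp hq
    rw [(PiTensorProduct.tprod ℂ).map_coord_zero (σ i), smul_zero]
    rw [Equiv.symm_apply_apply, proj_of_mem (hv i), if_neg hi]
  · simp

theorem sum_sym {n : ℕ} (G : Fin n → Fin n → ZMod 2) (h : ∀ i, G i i = 0) :
    ∑ i, ∑ j, G i j = ∑ i, ∑ j, if i < j then G i j + G j i else 0 := by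
  have h1 : ∀ i j, G i j = (if i < j then G i j else 0) + (if j < i then G i j else 0) := by
    intro i j
    rcases lt_trichotomy i j with hij | rfl | hij
    · simp [hij, hij.not_gt]
    · simp [h]
    · simp [hij, hij.not_gt]
  calc ∑ i, ∑ j, G i j = ∑ i, ∑ j, (if i < j then G i j else 0)
        + ∑ i, ∑ j, (if j < i then G i j else 0) := by
        simp only [← Finset.sum_add_distrib, ← h1]
    _ = _ := by
        rw [Finset.sum_comm (f := fun i j => if j < i then G i j else 0)]
        simp only [← Finset.sum_add_distrib]
        refine Finset.sum_congr rfl fun i _ => Finset.sum_congr rfl fun j _ => ?_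
        split_ifs <;> simp

theorem oddInv_trans {a b c : ℕ} (σ : Fin a ≃ Fin b) (τ : Fin b ≃ Fin c) (p : Fin a → ZMod 2) :
    oddInv (σ.trans τ) p = oddInv σ p + oddInv τ (fun i => p (σ.symm i)) := by
  have h1 : oddInv τ (fun i => p (σ.symm i)) =
      ∑ i, ∑ j, if σ i < σ j ∧ τ (σ j) < τ (σ i) then p i * p j else 0 := by
    unfold oddInv
    rw [← Equiv.sum_comp σ]
    refine Finset.sum_congr rfl fun i _ => ?_
    rw [← Equiv.sum_comp σ]
    simp
  rw [h1, sum_sym (fun i j => if σ i < σ j ∧ τ (σ j) < τ (σ i) then p i * p j else 0) (by simp)]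
  simp only [oddInv, ← Finset.sum_add_distrib, Equiv.trans_apply]
  refine Finset.sum_congr rfl fun i _ => Finset.sum_congr rfl fun j _ => ?_
  by_cases hij : i < j
  swap
  · simp [hij]
  have h2 : σ i ≠ σ j := fun h => hij.ne (σ.injective h)
  have h3 : τ (σ i) ≠ τ (σ j) := fun h => h2 (τ.injective h)
  rcases lt_or_gt_of_ne h2 with h2 | h2 <;> rcases lt_or_gt_of_ne h3 with h3 | h3 <;>
    simp [hij, h2, h2.not_gt, h3, h3.not_gt, mul_comm (p j), CharTwo.add_self_eq_zero]

theorem koszul_trans {a b c : ℕ} (σ : Fin a ≃ Fin b) (τ : Fin b ≃ Fin c) :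
    (koszul (σ.trans τ) : (⨂[ℂ]^a V) →ₗ[ℂ] _) = koszul τ ∘ₗ koszul σ := by
  refine tensor_ext fun p v hv => ?_
  rw [LinearMap.comp_apply, koszul_tprod _ hv, koszul_tprod _ hv, map_smul,
    koszul_tprod τ (p := fun i => p (σ.symm i)) fun i => hv _, smul_smul, oddInv_trans, sg_add]
  rfl

theorem map_koszul {a b : ℕ} (σ : Fin a ≃ Fin b) (f : V →ₗ[ℂ] W) (hf : ∀ v, f (γ v) = γ (f v)) :
    (PiTensorProduct.map fun _ => f) ∘ₗ koszul σ = koszul σ ∘ₗ PiTensorProduct.map fun _ => f := by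
  refine tensor_ext fun p v hv => ?_
  have hv' : ∀ i, f (v i) ∈ part W (p i) := fun i => by
    rw [mem_part, ← hf, mem_part.mp (hv i), map_smul]
  simp only [LinearMap.comp_apply, koszul_tprod _ hv, map_smul, PiTensorProduct.map_tprod]
  rw [koszul_tprod _ hv']

theorem koszul_refl (a : ℕ) : (koszul (Equiv.refl (Fin a)) : (⨂[ℂ]^a V) →ₗ[ℂ] _) = LinearMap.id := by
  refine tensor_ext fun p v hv => ?_
  rw [koszul_tprod _ hv]
  have : oddInv (Equiv.refl (Fin a)) p = 0 := by
    refine Finset.sum_eq_zero fun i _ => Finset.sum_eq_zero fun j _ => if_neg ?_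
    rintro ⟨h1, h2⟩
    exact absurd h1 h2.not_gt
  simp [this]

/-- The action of a linear map `f` of parity `ε` on a tensor power by the Leibniz rule,
`x₁ ⊗ ⋯ ⊗ xₙ ↦ ∑ⱼ (-1)^{ε(|x₁|+⋯+|xⱼ₋₁|)} x₁ ⊗ ⋯ ⊗ f xⱼ ⊗ ⋯ ⊗ xₙ`. -/
def leib {n : ℕ} (ε : ZMod 2) (f : V →ₗ[ℂ] V) : (⨂[ℂ]^n V) →ₗ[ℂ] (⨂[ℂ]^n V) :=
  ∑ j, PiTensorProduct.map fun i => if i < j then γ ^ ε.val else if i = j then f else LinearMap.id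

theorem γ_pow_of_mem {a : ZMod 2} {v : V} (ε : ZMod 2) (h : v ∈ part V a) :
    (γ ^ ε.val : V →ₗ[ℂ] V) v = sg (ε * a) • v := by
  rcases zmod2_cases ε with rfl | rfl
  · simp
  · simpa [ZMod.val_one] using mem_part.mp h

theorem leib_tprod {n : ℕ} (ε : ZMod 2) (f : V →ₗ[ℂ] V) {p : Fin n → ZMod 2} {v : Fin n → V}
    (hv : ∀ i, v i ∈ part V (p i)) :
    leib ε f (PiTensorProduct.tprod ℂ v) = ∑ j, sg (ε * ∑ i, if i < j then p i else 0) •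
      PiTensorProduct.tprod ℂ (Function.update v j (f (v j))) := by
  simp only [leib, LinearMap.sum_apply, PiTensorProduct.map_tprod]
  refine Finset.sum_congr rfl fun j _ => ?_
  rw [Finset.mul_sum, sg_sum, ← MultilinearMap.map_smul_univ]
  congr 1
  funext i
  rcases lt_trichotomy i j with h | rfl | h
  · simp [h, h.ne, γ_pow_of_mem ε (hv i)]
  · simp
  · simp [h.ne', h.not_gt]

theorem koszul_leib {a b : ℕ} (σ : Fin a ≃ Fin b) (ε : ZMod 2) (f : V →ₗ[ℂ] V)
    (hf : ∀ v, γ (f v) = sg ε • f (γ v)) :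
    koszul σ ∘ₗ leib ε f = leib ε f ∘ₗ koszul σ := by
  classical
  refine tensor_ext fun p v hv => ?_
  have hu : ∀ j i, Function.update v j (f (v j)) i ∈ part V (Function.update p j (ε + p j) i) := by
    intro j i
    rcases eq_or_ne i j with rfl | h
    · simp [mem_part, hf, mem_part.mp (hv i), sg_add, smul_smul]
    · simp [h, hv i]
  rw [LinearMap.comp_apply, leib_tprod ε f hv, LinearMap.comp_apply, koszul_tprod _ hv, map_smul,
    leib_tprod ε f (p := fun i => p (σ.symm i)) fun i => hv _, map_sum, ← Equiv.sum_comp σ,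
    Finset.smul_sum]
  refine Finset.sum_congr rfl fun j _ => ?_
  rw [map_smul, koszul_tprod _ (hu j), smul_smul, smul_smul, ← sg_add, ← sg_add]
  have h1 : (fun i => Function.update v j (f (v j)) (σ.symm i)) =
      Function.update (fun i => v (σ.symm i)) (σ j) (f (v (σ.symm (σ j)))) := by
    funext i
    rcases eq_or_ne i (σ j) with rfl | h
    · simp
    · rw [Function.update_of_ne h, Function.update_of_ne fun h' => h (by simp [← h'])]
  rw [h1]
  congr 2
  have h2 : ∑ i, (if i < σ j then p (σ.symm i) else 0) = ∑ i, if σ i < σ j then p i else 0 := by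
    rw [← Equiv.sum_comp σ]; simp
  have h3 : oddInv σ (Function.update p j (ε + p j)) =
      oddInv σ p + ε * ∑ i, ((if i < j ∧ σ j < σ i then p i else 0) +
        (if j < i ∧ σ i < σ j then p i else 0)) := by
    have h4 : ∀ x y, (if x < y ∧ σ y < σ x then
        Function.update p j (ε + p j) x * Function.update p j (ε + p j) y else 0) =
        (if x < y ∧ σ y < σ x then p x * p y else 0) +
        ((if y = j then ε * (if x < j ∧ σ j < σ x then p x else 0) else 0) +
        (if x = j then ε * (if j < y ∧ σ y < σ j then p y else 0) else 0)) := by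
      intro x y
      by_cases hxy : x < y ∧ σ y < σ x
      · rcases eq_or_ne x j with rfl | hx
        · have hy : y ≠ x := hxy.1.ne'
          simp [hxy, hy]; ring
        · rcases eq_or_ne y j with rfl | hy
          · simp [hxy, hx]; ring
          · simp [hxy, hx, hy]
      · rcases eq_or_ne x j with rfl | hx
        · rcases eq_or_ne y x with rfl | hy
          · simp
          · simp [hxy, hy]
        · rcases eq_or_ne y j with rfl | hy
          · simp [hxy, hx]
          · simp [hxy, hx, hy]
    unfold oddInv
    simp only [h4, Finset.sum_add_distrib, Finset.sum_ite_eq', Finset.mem_univ, if_true, mul_add,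
      Finset.mul_sum]
    congr 2
    rw [Finset.sum_comm]
    simp
  rw [h2, h3, add_comm (oddInv σ p), ← add_assoc, add_comm _ (oddInv σ p), ← mul_add,
    ← Finset.sum_add_distrib]
  congr 2
  refine Finset.sum_congr rfl fun i _ => ?_
  rcases eq_or_ne i j with rfl | hij
  · simp
  have h5 : σ i ≠ σ j := fun h => hij (σ.injective h)
  rcases lt_or_gt_of_ne hij with h | h <;> rcases lt_or_gt_of_ne h5 with h5 | h5 <;>
    simp [h, h.not_gt, h5, h5.not_gt, CharTwo.add_self_eq_zero]

end Superspace

namespace Superspace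

section TensorAlgebra

variable {V : Type*} [AddCommGroup V] [Module ℂ V] [Superspace V]
variable {W : Type*} [AddCommGroup W] [Module ℂ W] [Superspace W]

/-- The automorphism `x ↦ (-1)^{|x|} x` of the tensor algebra. -/
def tensorγ (W : Type*) [AddCommGroup W] [Module ℂ W] [Superspace W] :
    TensorAlgebra ℂ W →ₐ[ℂ] TensorAlgebra ℂ W :=
  TensorAlgebra.lift ℂ (TensorAlgebra.ι ℂ ∘ₗ γ)

@[simp] theorem tensorγ_ι (w : W) :
    tensorγ W (TensorAlgebra.ι ℂ w) = TensorAlgebra.ι ℂ (γ w) := by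
  simp [tensorγ]

theorem tensorγ_tensorγ (x : TensorAlgebra ℂ W) : tensorγ W (tensorγ W x) = x := by
  have : (tensorγ W).comp (tensorγ W) = AlgHom.id ℂ _ := by
    ext w
    simp [γ_γ]
  exact DFunLike.congr_fun this x

instance : Superspace (TensorAlgebra ℂ W) where
  γ := (tensorγ W).toLinearMap
  γ_γ := tensorγ_tensorγ

theorem γ_ι (w : W) : γ (TensorAlgebra.ι ℂ w) = TensorAlgebra.ι ℂ (γ w) := tensorγ_ι w

theorem γ_mul (x y : TensorAlgebra ℂ W) : γ (x * y) = γ x * γ y := map_mul (tensorγ W) x y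

theorem γ_algebraMap (r : ℂ) :
    γ (algebraMap ℂ (TensorAlgebra ℂ W) r) = algebraMap ℂ (TensorAlgebra ℂ W) r :=
  AlgHom.commutes (tensorγ W) r

/-- `γ^ε`, the identity for `ε = 0` and the grading involution for `ε = 1`. -/
def γpow (ε : ZMod 2) : V →ₗ[ℂ] V := γ ^ ε.val

/-- The algebra map `w ↦ [[γ^ε w, f w], [0, w]]`, whose upper right entry is the derivation
extending `f`. -/
def derMatrix (ε : ZMod 2) (f : W →ₗ[ℂ] TensorAlgebra ℂ W) :
    TensorAlgebra ℂ W →ₐ[ℂ] Matrix (Fin 2) (Fin 2) (TensorAlgebra ℂ W) :=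
  TensorAlgebra.lift ℂ
    { toFun := fun w => !![TensorAlgebra.ι ℂ (γpow ε w), f w; 0, TensorAlgebra.ι ℂ w]
      map_add' := fun v w => by
        ext i j; fin_cases i <;> fin_cases j <;> simp
      map_smul' := fun c w => by
        ext i j; fin_cases i <;> fin_cases j <;> simp }

/-- The superderivation `D` of parity `ε` of the tensor algebra extending `f` on generators:
`D(xy) = D(x) y + (-1)^{ε|x|} x D(y)`. -/
def superDer (ε : ZMod 2) (f : W →ₗ[ℂ] TensorAlgebra ℂ W) :
    TensorAlgebra ℂ W →ₗ[ℂ] TensorAlgebra ℂ W :=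
  Matrix.entryLinearMap ℂ (TensorAlgebra ℂ W) 0 1 ∘ₗ (derMatrix ε f).toLinearMap

theorem derMatrix_ι (ε : ZMod 2) (f : W →ₗ[ℂ] TensorAlgebra ℂ W) (w : W) :
    derMatrix ε f (TensorAlgebra.ι ℂ w) =
      !![TensorAlgebra.ι ℂ (γpow ε w), f w; 0, TensorAlgebra.ι ℂ w] := by
  simp [derMatrix]

theorem superDer_ι (ε : ZMod 2) (f : W →ₗ[ℂ] TensorAlgebra ℂ W) (w : W) :
    superDer ε f (TensorAlgebra.ι ℂ w) = f w := by
  simp [superDer, derMatrix_ι]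

theorem γpow_ι (ε : ZMod 2) (w : W) :
    γpow ε (TensorAlgebra.ι ℂ w) = TensorAlgebra.ι ℂ (γpow ε w) := by
  rcases zmod2_cases ε with rfl | rfl
  · simp [γpow]
  · simp [γpow, ZMod.val_one, γ_ι]

theorem γpow_mul (ε : ZMod 2) (x y : TensorAlgebra ℂ W) :
    γpow ε (x * y) = γpow ε x * γpow ε y := by
  rcases zmod2_cases ε with rfl | rfl
  · simp [γpow]
  · simp [γpow, ZMod.val_one, γ_mul]

theorem γpow_algebraMap (ε : ZMod 2) (r : ℂ) :
    γpow ε (algebraMap ℂ (TensorAlgebra ℂ W) r) = algebraMap ℂ (TensorAlgebra ℂ W) r := by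
  rcases zmod2_cases ε with rfl | rfl
  · simp [γpow]
  · simp [γpow, ZMod.val_one, γ_algebraMap]

theorem derMatrix_entries (ε : ZMod 2) (f : W →ₗ[ℂ] TensorAlgebra ℂ W) (x : TensorAlgebra ℂ W) :
    derMatrix ε f x 0 0 = γpow ε x ∧ derMatrix ε f x 1 0 = 0 ∧ derMatrix ε f x 1 1 = x := by
  induction x using TensorAlgebra.induction with
  | algebraMap r => simp [Matrix.algebraMap_matrix_apply, γpow_algebraMap]
  | ι w => simp [derMatrix_ι, γpow_ι]
  | mul x y hx hy =>
    simp [Matrix.mul_apply, Fin.sum_univ_two, hx, hy, γpow_mul]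
  | add x y hx hy => simp [hx, hy]

theorem superDer_mul (ε : ZMod 2) (f : W →ₗ[ℂ] TensorAlgebra ℂ W) (x y : TensorAlgebra ℂ W) :
    superDer ε f (x * y) = superDer ε f x * y + γpow ε x * superDer ε f y := by
  simp only [superDer, LinearMap.comp_apply, AlgHom.toLinearMap_apply, map_mul,
    Matrix.entryLinearMap_apply, Matrix.mul_apply, Fin.sum_univ_two,
    (derMatrix_entries ε f x).1, (derMatrix_entries ε f y).2.2]
  rw [add_comm]

theorem superDer_algebraMap (ε : ZMod 2) (f : W →ₗ[ℂ] TensorAlgebra ℂ W) (r : ℂ) :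
    superDer ε f (algebraMap ℂ _ r) = 0 := by
  simp [superDer, Matrix.algebraMap_matrix_apply]

theorem γpow_γ (ε : ZMod 2) (v : V) : γpow ε (γ v) = γ (γpow ε v) := by
  rcases zmod2_cases ε with rfl | rfl <;> simp [γpow, ZMod.val_one]

theorem γ_superDer {ε : ZMod 2} {f : W →ₗ[ℂ] TensorAlgebra ℂ W}
    (hf : ∀ w, γ (f w) = sg ε • f (γ w)) (x : TensorAlgebra ℂ W) :
    γ (superDer ε f x) = sg ε • superDer ε f (γ x) := by
  induction x using TensorAlgebra.induction with
  | algebraMap r => simp [superDer_algebraMap, γ_algebraMap]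
  | ι w => rw [superDer_ι, hf, γ_ι, superDer_ι]
  | mul x y hx hy =>
    simp only [superDer_mul, γ_mul, map_add, hx, hy, γpow_γ, smul_add, smul_mul_assoc,
      mul_smul_comm]
  | add x y hx hy => simp [hx, hy]

theorem mul_mem_part {a b : ZMod 2} {x y : TensorAlgebra ℂ W}
    (hx : x ∈ part (TensorAlgebra ℂ W) a) (hy : y ∈ part (TensorAlgebra ℂ W) b) :
    x * y ∈ part (TensorAlgebra ℂ W) (a + b) := by
  rw [mem_part] at *
  rw [γ_mul, hx, hy, sg_add, smul_mul_smul_comm]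

theorem superDer_mem_part {ε a : ZMod 2} {f : W →ₗ[ℂ] TensorAlgebra ℂ W}
    (hf : ∀ w, γ (f w) = sg ε • f (γ w)) {x : TensorAlgebra ℂ W}
    (hx : x ∈ part (TensorAlgebra ℂ W) a) :
    superDer ε f x ∈ part (TensorAlgebra ℂ W) (ε + a) := by
  rw [mem_part] at *
  rw [γ_superDer hf, hx, map_smul, smul_smul, sg_add]

/-- The span of the supercommutators `xy - (-1)^{|x||y|} yx` in the tensor algebra. -/
def commutators (W : Type*) [AddCommGroup W] [Module ℂ W] [Superspace W] :
    Submodule ℂ (TensorAlgebra ℂ W) :=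
  Submodule.span ℂ {z | ∃ (a b : ZMod 2) (x y : TensorAlgebra ℂ W),
    x ∈ part (TensorAlgebra ℂ W) a ∧ y ∈ part (TensorAlgebra ℂ W) b ∧
      z = x * y - sg (a * b) • (y * x)}

/-- The quotient of the tensor algebra by the span of supercommutators. -/
abbrev Abel (W : Type*) [AddCommGroup W] [Module ℂ W] [Superspace W] : Type _ :=
  TensorAlgebra ℂ W ⧸ commutators W

theorem superDer_commutators {ε : ZMod 2} {f : W →ₗ[ℂ] TensorAlgebra ℂ W}
    (hf : ∀ w, γ (f w) = sg ε • f (γ w)) :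
    commutators W ≤ (commutators W).comap (superDer ε f) := by
  refine Submodule.span_le.mpr ?_
  rintro _ ⟨a, b, x, y, hx, hy, rfl⟩
  have h1 : superDer ε f x * y - sg ((ε + a) * b) • (y * superDer ε f x) ∈ commutators W :=
    Submodule.subset_span ⟨_, _, _, _, superDer_mem_part hf hx, hy, rfl⟩
  have h2 : x * superDer ε f y - sg (a * (ε + b)) • (superDer ε f y * x) ∈ commutators W :=
    Submodule.subset_span ⟨_, _, _, _, hx, superDer_mem_part hf hy, rfl⟩
  have h3 : superDer ε f (x * y - sg (a * b) • (y * x)) =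
      (superDer ε f x * y - sg ((ε + a) * b) • (y * superDer ε f x)) +
      sg (ε * a) • (x * superDer ε f y - sg (a * (ε + b)) • (superDer ε f y * x)) := by
    have e1 : γpow ε x = sg (ε * a) • x := γ_pow_of_mem ε hx
    have e2 : γpow ε y = sg (ε * b) • y := γ_pow_of_mem ε hy
    rw [map_sub, map_smul, superDer_mul, superDer_mul, e1, e2]
    simp only [smul_sub, smul_add, smul_smul, smul_mul_assoc, ← sg_add]
    rw [show ε * a + a * (ε + b) = a * b by
        rw [mul_add, mul_comm a ε, ← add_assoc, CharTwo.add_self_eq_zero, zero_add],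
      show (ε + a) * b = a * b + ε * b by ring]
    abel
  exact (h3 ▸ Submodule.add_mem _ h1 (Submodule.smul_mem _ _ h2) :
    superDer ε f (x * y - sg (a * b) • (y * x)) ∈ commutators W)

/-- The map induced by a superderivation modulo supercommutators. -/
def Abel.der (ε : ZMod 2) (f : W →ₗ[ℂ] TensorAlgebra ℂ W)
    (hf : ∀ w, γ (f w) = sg ε • f (γ w)) : Abel W →ₗ[ℂ] Abel W :=
  Submodule.mapQ _ _ (superDer ε f) (superDer_commutators hf)

end TensorAlgebra

end Superspace

namespace Superspace

section Comp

variable {V : Type*} [AddCommGroup V] [Module ℂ V]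

/-- The projection of the tensor algebra onto `V^{⊗k}`. -/
def compT (k : ℕ) : TensorAlgebra ℂ V →ₗ[ℂ] (⨂[ℂ]^k V) :=
  DirectSum.component ℂ ℕ (fun n => ⨂[ℂ]^n V) k ∘ₗ TensorAlgebra.toDirectSum.toLinearMap

theorem compT_tprod {n : ℕ} (v : Fin n → V) :
    compT n (TensorAlgebra.tprod ℂ V n v) = PiTensorProduct.tprod ℂ v := by
  rw [compT, LinearMap.comp_apply, AlgHom.toLinearMap_apply,
    TensorAlgebra.toDirectSum_tensorPower_tprod]
  exact DirectSum.of_eq_same _ _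

theorem compT_tprod_of_ne {n k : ℕ} (h : n ≠ k) (v : Fin n → V) :
    compT k (TensorAlgebra.tprod ℂ V n v) = 0 := by
  rw [compT, LinearMap.comp_apply, AlgHom.toLinearMap_apply,
    TensorAlgebra.toDirectSum_tensorPower_tprod]
  exact DirectSum.of_eq_of_ne _ _ _ h.symm

theorem tprod_mul_tprod {m n : ℕ} (v : Fin m → V) (w : Fin n → V) :
    TensorAlgebra.tprod ℂ V m v * TensorAlgebra.tprod ℂ V n w =
      TensorAlgebra.tprod ℂ V (m + n) (Fin.append v w) := by
  rw [TensorAlgebra.tprod_apply, TensorAlgebra.tprod_apply, TensorAlgebra.tprod_apply,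
    ← List.prod_append, ← List.ofFn_fin_append]
  congr 2
  funext i
  refine Fin.addCases (fun i => ?_) (fun i => ?_) i <;> simp

end Comp

section Letters

variable {V : Type*} [AddCommGroup V] [Module ℂ V]

/-- The letters `v` and `dv` of noncommutative differential forms; `dv` has the parity opposite to
that of `v`. -/
def Letters (V : Type*) : Type _ := V × V

instance : AddCommGroup (Letters V) := inferInstanceAs (AddCommGroup (V × V))

instance : Module ℂ (Letters V) := inferInstanceAs (Module ℂ (V × V))

/-- The letter `v`. -/
def Letters.fn : V →ₗ[ℂ] Letters V := LinearMap.inl ℂ V V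

/-- The letter `dv`. -/
def Letters.df : V →ₗ[ℂ] Letters V := LinearMap.inr ℂ V V

/-- The component in `V`. -/
def Letters.fst : Letters V →ₗ[ℂ] V := LinearMap.fst ℂ V V

/-- The component in `dV`. -/
def Letters.snd : Letters V →ₗ[ℂ] V := LinearMap.snd ℂ V V

@[simp] theorem Letters.fst_fn (v : V) : Letters.fst (Letters.fn v) = v := rfl
@[simp] theorem Letters.snd_fn (v : V) : Letters.snd (Letters.fn v) = 0 := rfl
@[simp] theorem Letters.fst_df (v : V) : Letters.fst (Letters.df v) = 0 := rfl
@[simp] theorem Letters.snd_df (v : V) : Letters.snd (Letters.df v) = v := rfl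

end Letters

section Forms

variable {V : Type*} [AddCommGroup V] [Module ℂ V] [Superspace V]
variable {W : Type*} [AddCommGroup W] [Module ℂ W] [Superspace W]

instance (k : ℕ) : Superspace (⨂[ℂ]^k V) where
  γ := PiTensorProduct.map fun _ => γ
  γ_γ t := by
    rw [← LinearMap.comp_apply, ← PiTensorProduct.map_comp]
    have : (γ : V →ₗ[ℂ] V) ∘ₗ γ = LinearMap.id := LinearMap.ext γ_γ
    simp [this]

theorem γ_map {k : ℕ} (f : V →ₗ[ℂ] W) (hf : ∀ v, f (γ v) = γ (f v)) (t : ⨂[ℂ]^k V) :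
    γ (PiTensorProduct.map (fun _ => f) t) = PiTensorProduct.map (fun _ => f) (γ t) := by
  change (PiTensorProduct.map (fun _ => γ) ∘ₗ PiTensorProduct.map (fun _ => f)) t =
    (PiTensorProduct.map (fun _ => f) ∘ₗ PiTensorProduct.map (fun _ => γ)) t
  rw [← PiTensorProduct.map_comp, ← PiTensorProduct.map_comp,
    show f ∘ₗ γ = γ ∘ₗ f from LinearMap.ext hf]

theorem γ_toTensorAlgebra {n : ℕ} (t : ⨂[ℂ]^n W) :
    γ (TensorPower.toTensorAlgebra t) = TensorPower.toTensorAlgebra (γ t) := by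
  have : (γ : TensorAlgebra ℂ W →ₗ[ℂ] _) ∘ₗ (TensorPower.toTensorAlgebra : (⨂[ℂ]^n W) →ₗ[ℂ] _) =
      TensorPower.toTensorAlgebra ∘ₗ γ := by
    refine PiTensorProduct.ext (MultilinearMap.ext fun v => ?_)
    change tensorγ W _ = TensorPower.toTensorAlgebra
      (PiTensorProduct.map (fun _ => γ) (PiTensorProduct.tprod ℂ v))
    rw [PiTensorProduct.map_tprod]
    simp [TensorAlgebra.tprod_apply, map_list_prod, List.map_ofFn, Function.comp_def]
  exact LinearMap.congr_fun this t

theorem tprod_mem_part {n : ℕ} {p : Fin n → ZMod 2} {v : Fin n → W} (hv : ∀ i, v i ∈ part W (p i)) :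
    TensorAlgebra.tprod ℂ W n v ∈ part (TensorAlgebra ℂ W) (∑ i, p i) := by
  rw [mem_part, ← TensorPower.toTensorAlgebra_tprod, γ_toTensorAlgebra]
  change TensorPower.toTensorAlgebra
    (PiTensorProduct.map (fun _ => γ) (PiTensorProduct.tprod ℂ v)) = _
  rw [PiTensorProduct.map_tprod, show (fun i => γ (v i)) = fun i => sg (p i) • v i from
    funext fun i => mem_part.mp (hv i), MultilinearMap.map_smul_univ, map_smul, sg_sum]

theorem tensorAlgebra_induction {N : Submodule ℂ (TensorAlgebra ℂ W)}
    (h : ∀ (n : ℕ) (p : Fin n → ZMod 2) (v : Fin n → W), (∀ i, v i ∈ part W (p i)) →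
      TensorAlgebra.tprod ℂ W n v ∈ N) (x : TensorAlgebra ℂ W) : x ∈ N := by
  rw [← TensorAlgebra.ofDirectSum_toDirectSum x]
  induction TensorAlgebra.toDirectSum x using DirectSum.induction_on with
  | zero => simp
  | add y z hy hz => rw [map_add]; exact N.add_mem hy hz
  | of n t =>
    have : N.mkQ ∘ₗ (TensorPower.toTensorAlgebra : (⨂[ℂ]^n W) →ₗ[ℂ] _) = 0 := by
      refine tensor_ext fun p v hv => ?_
      simpa using h n p v hv
    have h2 := LinearMap.congr_fun this t
    have h3 : TensorAlgebra.ofDirectSum (DirectSum.of (fun n => ⨂[ℂ]^n W) n t) =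
        TensorPower.toTensorAlgebra t :=
      DirectSum.toSemiring_of _ TensorPower.toTensorAlgebra_gOne
        (fun {_ _} => TensorPower.toTensorAlgebra_gMul) _ _
    rw [h3]
    simpa using h2

/-- Supercommutators are spanned by those of words in homogeneous letters. -/
theorem commutators_le {N : Submodule ℂ (TensorAlgebra ℂ W)}
    (h : ∀ (m n : ℕ) (p : Fin m → ZMod 2) (q : Fin n → ZMod 2) (v : Fin m → W) (w : Fin n → W),
      (∀ i, v i ∈ part W (p i)) → (∀ i, w i ∈ part W (q i)) →
      TensorAlgebra.tprod ℂ W m v * TensorAlgebra.tprod ℂ W n w -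
        sg ((∑ i, p i) * ∑ i, q i) •
          (TensorAlgebra.tprod ℂ W n w * TensorAlgebra.tprod ℂ W m v) ∈ N) :
    commutators W ≤ N := by
  let B : TensorAlgebra ℂ W →ₗ[ℂ] TensorAlgebra ℂ W →ₗ[ℂ] TensorAlgebra ℂ W :=
    LinearMap.mul ℂ _ - ∑ a : ZMod 2, ∑ b : ZMod 2, sg (a * b) •
      ((LinearMap.mul ℂ _).flip.compl₁₂ (proj a) (proj b))
  have hB : ∀ {a b : ZMod 2} {x y : TensorAlgebra ℂ W}, x ∈ part (TensorAlgebra ℂ W) a →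
      y ∈ part (TensorAlgebra ℂ W) b → B x y = x * y - sg (a * b) • (y * x) := by
    intro a b x y hx hy
    simp only [B, LinearMap.sub_apply, LinearMap.mul_apply', LinearMap.sum_apply,
      LinearMap.smul_apply, LinearMap.compl₁₂_apply, LinearMap.flip_apply, proj_of_mem hx,
      proj_of_mem hy]
    congr 1
    rw [Finset.sum_eq_single a, Finset.sum_eq_single b]
    · simp
    · intro c _ hc; simp [hc]
    · simp
    · intro c _ hc; simp [hc]
    · simp
  have key : ∀ x y, B x y ∈ N := by
    intro x
    have hx : x ∈ (⨅ y, N.comap (B.flip y)) := by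
      refine tensorAlgebra_induction (fun m p v hv => ?_) x
      rw [Submodule.mem_iInf]
      intro y
      have hy : y ∈ N.comap (B (TensorAlgebra.tprod ℂ W m v)) := by
        refine tensorAlgebra_induction (fun n q w hw => ?_) y
        rw [Submodule.mem_comap, hB (tprod_mem_part hv) (tprod_mem_part hw)]
        exact h m n p q v w hv hw
      exact hy
    intro y
    exact (Submodule.mem_iInf _).mp hx y
  refine Submodule.span_le.mpr ?_
  rintro _ ⟨a, b, x, y, hx, hy, rfl⟩
  rw [← hB hx hy]
  exact key x y

instance : Superspace (Letters V) where
  γ := Letters.fn ∘ₗ γ ∘ₗ Letters.fst - Letters.df ∘ₗ γ ∘ₗ Letters.snd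
  γ_γ w := by
    have : w = Letters.fn (Letters.fst w) + Letters.df (Letters.snd w) :=
      Prod.ext (add_zero _).symm (zero_add _).symm
    conv_rhs => rw [this]
    simp [γ_γ]

theorem Letters.γ_def (w : Letters V) :
    γ w = Letters.fn (γ (Letters.fst w)) - Letters.df (γ (Letters.snd w)) := rfl

theorem Letters.fst_γ (w : Letters V) : Letters.fst (γ w) = γ (Letters.fst w) := by
  simp [Letters.γ_def]

theorem Letters.snd_γ (w : Letters V) : Letters.snd (γ w) = -γ (Letters.snd w) := by
  simp [Letters.γ_def]

/-- Noncommutative differential forms on `V`: the free algebra on the letters `v` and `dv`. -/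
abbrev Forms (V : Type*) [AddCommGroup V] [Module ℂ V] [Superspace V] : Type _ :=
  TensorAlgebra ℂ (Letters V)

/-- The de Rham complex: forms modulo supercommutators. -/
abbrev DR (V : Type*) [AddCommGroup V] [Module ℂ V] [Superspace V] : Type _ := Abel (Letters V)

/-- The class of a form in the de Rham complex. -/
abbrev DR.mk : Forms V →ₗ[ℂ] DR V := (commutators (Letters V)).mkQ

/-- The 1-form `dv`. -/
def dvar : V →ₗ[ℂ] Forms V := TensorAlgebra.ι ℂ ∘ₗ Letters.df

/-- Tensors in `V^{⊗k}` as 0-forms. -/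
def zeroForm {k : ℕ} : (⨂[ℂ]^k V) →ₗ[ℂ] Forms V :=
  TensorPower.toTensorAlgebra ∘ₗ PiTensorProduct.map fun _ => Letters.fn

theorem γ_dvar (v : V) : γ (dvar v) = -dvar (γ v) := by
  simp [dvar, γ_ι, Letters.γ_def]

theorem γ_zeroForm {k : ℕ} (t : ⨂[ℂ]^k V) : γ (zeroForm t) = zeroForm (γ t) := by
  rw [zeroForm, LinearMap.comp_apply, γ_toTensorAlgebra, LinearMap.comp_apply,
    γ_map Letters.fn fun v => by simp [Letters.γ_def]]

/-- The values of the de Rham differential on letters: `v ↦ dv`, `dv ↦ 0`. -/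
def dGen : Letters V →ₗ[ℂ] Forms V := dvar ∘ₗ Letters.fst

theorem γ_dGen (w : Letters V) : γ (dGen w) = sg 1 • dGen (γ w) := by
  simp [dGen, γ_dvar, Letters.fst_γ]

/-- The differential on forms. -/
def dForms : Forms V →ₗ[ℂ] Forms V := superDer 1 dGen

/-- The differential of the de Rham complex. -/
def DR.d : DR V →ₗ[ℂ] DR V := Abel.der 1 dGen γ_dGen

/-- The component of parity `ε` of a homogeneous vector field `ξ : V → V^{⊗k}`. -/
def homPart {k : ℕ} (ε : ZMod 2) (ξ : V →ₗ[ℂ] (⨂[ℂ]^k V)) : V →ₗ[ℂ] (⨂[ℂ]^k V) :=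
  (1 / 2 : ℂ) • (ξ + sg ε • (γ ∘ₗ ξ ∘ₗ γ))

theorem γ_homPart {k : ℕ} (ε : ZMod 2) (ξ : V →ₗ[ℂ] (⨂[ℂ]^k V)) (v : V) :
    γ (homPart ε ξ v) = sg ε • homPart ε ξ (γ v) := by
  simp only [homPart, LinearMap.smul_apply, LinearMap.add_apply, LinearMap.comp_apply, map_smul,
    map_add, γ_γ]
  rw [smul_comm (sg ε), smul_add (sg ε), smul_smul (sg ε), sg_mul_self, one_smul,
    add_comm (γ (ξ v))]

/-- The values on letters of the contraction with a vector field of parity `ε`: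
`v ↦ 0`, `dv ↦ ξ(v)`. -/
def contrGen {k : ℕ} (ε : ZMod 2) (ξ : V →ₗ[ℂ] (⨂[ℂ]^k V)) : Letters V →ₗ[ℂ] Forms V :=
  zeroForm ∘ₗ homPart ε ξ ∘ₗ Letters.snd

theorem γ_contrGen {k : ℕ} (ε : ZMod 2) (ξ : V →ₗ[ℂ] (⨂[ℂ]^k V)) (w : Letters V) :
    γ (contrGen ε ξ w) = sg (ε + 1) • contrGen ε ξ (γ w) := by
  simp [contrGen, γ_zeroForm, γ_homPart, Letters.snd_γ, sg_add]

/-- The values on letters of the Lie derivative along a vector field of parity `ε`: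
`v ↦ ξ(v)`, `dv ↦ (-1)^ε d(ξ(v))`. -/
def lieGen {k : ℕ} (ε : ZMod 2) (ξ : V →ₗ[ℂ] (⨂[ℂ]^k V)) : Letters V →ₗ[ℂ] Forms V :=
  zeroForm ∘ₗ homPart ε ξ ∘ₗ Letters.fst +
    sg ε • (dForms ∘ₗ zeroForm ∘ₗ homPart ε ξ ∘ₗ Letters.snd)

theorem γ_dForms (x : Forms V) : γ (dForms x) = -dForms (γ x) := by
  rw [dForms, γ_superDer γ_dGen]
  simp

theorem γ_lieGen {k : ℕ} (ε : ZMod 2) (ξ : V →ₗ[ℂ] (⨂[ℂ]^k V)) (w : Letters V) :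
    γ (lieGen ε ξ w) = sg ε • lieGen ε ξ (γ w) := by
  simp [lieGen, γ_zeroForm, γ_homPart, Letters.fst_γ, Letters.snd_γ, γ_dForms]

/-- The Lie derivative on forms along `ξ`, the sum of those along its even and odd components. -/
def lieForms {k : ℕ} (ξ : V →ₗ[ℂ] (⨂[ℂ]^k V)) : Forms V →ₗ[ℂ] Forms V :=
  ∑ ε : ZMod 2, superDer ε (lieGen ε ξ)

/-- The Lie derivative on the de Rham complex. -/
def DR.lie {k : ℕ} (ξ : V →ₗ[ℂ] (⨂[ℂ]^k V)) : DR V →ₗ[ℂ] DR V :=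
  ∑ ε : ZMod 2, Abel.der ε (lieGen ε ξ) (γ_lieGen ε ξ)

/-- The contraction with a vector field on the de Rham complex, the sum of those with its even and
odd components. -/
def DR.contr {k : ℕ} (ξ : V →ₗ[ℂ] (⨂[ℂ]^k V)) : DR V →ₗ[ℂ] DR V :=
  ∑ ε : ZMod 2, Abel.der (ε + 1) (contrGen ε ξ) (γ_contrGen ε ξ)

/-- The space of `n`-forms of order `k`, spanned by the words with `n` letters `dv` and `k`
letters `v`. -/
def DR.formsOfOrder (V : Type*) [AddCommGroup V] [Module ℂ V] [Superspace V] (n k : ℕ) :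
    Submodule ℂ (DR V) :=
  Submodule.span ℂ {x | ∃ l : List (V ⊕ V), l.countP Sum.isRight = n ∧ l.countP Sum.isLeft = k ∧
    x = DR.mk (l.map (Sum.elim (fun v => TensorAlgebra.ι ℂ (Letters.fn v)) dvar)).prod}

/-- The even part of the de Rham complex. -/
def DR.even (V : Type*) [AddCommGroup V] [Module ℂ V] [Superspace V] : Submodule ℂ (DR V) :=
  (part (Forms V) 0).map DR.mk

/-- `x ⊗ y ↦ (-1)^{|x|+1} (x ⊗ y - (-1)^{|x||y|} y ⊗ x)` on the coefficients of the
words `dx dy`. -/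
def upsilonForms : Forms V →ₗ[ℂ] (⨂[ℂ]^2 V) :=
  (LinearMap.id - koszul (finRotate 2).symm) ∘ₗ
    PiTensorProduct.map ![-(γ : V →ₗ[ℂ] V), LinearMap.id] ∘ₗ
      (PiTensorProduct.map fun _ => Letters.snd) ∘ₗ compT 2

theorem upsilonForms_tprod_of_ne {n : ℕ} (h : n ≠ 2) (u : Fin n → Letters V) :
    upsilonForms (TensorAlgebra.tprod ℂ _ n u) = 0 := by
  rw [upsilonForms, LinearMap.comp_apply, LinearMap.comp_apply, LinearMap.comp_apply,
    compT_tprod_of_ne h, map_zero, map_zero, map_zero]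

theorem upsilonForms_tprod {p q : ZMod 2} {u : Fin 2 → Letters V} (hp : u 0 ∈ part (Letters V) p)
    (hq : u 1 ∈ part (Letters V) q) :
    upsilonForms (TensorAlgebra.tprod ℂ _ 2 u) =
      sg p • (PiTensorProduct.tprod ℂ ![Letters.snd (u 0), Letters.snd (u 1)] -
        sg ((p + 1) * (q + 1)) •
          PiTensorProduct.tprod ℂ ![Letters.snd (u 1), Letters.snd (u 0)]) := by
  have hp' : Letters.snd (u 0) ∈ part V (p + 1) := by
    rw [mem_part, ← neg_eq_iff_eq_neg.mpr (Letters.snd_γ (u 0)), mem_part.mp hp]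
    simp [sg_add]
  have hq' : Letters.snd (u 1) ∈ part V (q + 1) := by
    rw [mem_part, ← neg_eq_iff_eq_neg.mpr (Letters.snd_γ (u 1)), mem_part.mp hq]
    simp [sg_add]
  have h1 : (fun i => (![-(γ : V →ₗ[ℂ] V), LinearMap.id] i) (Letters.snd (u i))) =
      Function.update ![Letters.snd (u 0), Letters.snd (u 1)] 0
        (sg p • (![Letters.snd (u 0), Letters.snd (u 1)] 0)) := by
    funext i
    fin_cases i
    · simp [mem_part.mp hp', sg_add]
    · simp
  have h2 : ∀ i, (![Letters.snd (u 0), Letters.snd (u 1)] : Fin 2 → V) i ∈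
      part V ((![p + 1, q + 1] : Fin 2 → ZMod 2) i) := by
    intro i
    fin_cases i
    · exact hp'
    · exact hq'
  have h3 : (fun i => (![Letters.snd (u 0), Letters.snd (u 1)] : Fin 2 → V)
      ((finRotate 2).symm.symm i)) = ![Letters.snd (u 1), Letters.snd (u 0)] := by
    funext i
    fin_cases i <;> rfl
  have h4 : oddInv (finRotate 2).symm ![p + 1, q + 1] = (p + 1) * (q + 1) := by
    simp [oddInv, Fin.sum_univ_two]
  rw [upsilonForms, LinearMap.comp_apply, LinearMap.comp_apply, LinearMap.comp_apply, compT_tprod,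
    PiTensorProduct.map_tprod, PiTensorProduct.map_tprod, h1, MultilinearMap.map_update_smul,
    Function.update_eq_self, map_smul, LinearMap.sub_apply, koszul_tprod _ h2, h3, h4]
  rfl

theorem upsilon_commutators : commutators (Letters V) ≤ LinearMap.ker (upsilonForms (V := V)) := by
  refine commutators_le fun m n p q v w hv hw => ?_
  rw [LinearMap.mem_ker, map_sub, map_smul, tprod_mul_tprod, tprod_mul_tprod]
  by_cases hmn : m + n = 2
  swap
  · rw [upsilonForms_tprod_of_ne hmn, upsilonForms_tprod_of_ne (by omega), smul_zero, sub_zero]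
  obtain ⟨rfl, rfl⟩ | ⟨rfl, rfl⟩ | ⟨rfl, rfl⟩ : (m = 0 ∧ n = 2) ∨ (m = 1 ∧ n = 1) ∨ (m = 2 ∧ n = 0) := by
    omega
  · rw [← tprod_mul_tprod, ← tprod_mul_tprod]
    simp
  · have hv0 : Fin.append v w 0 = v 0 := Fin.append_left v w 0
    have hw1 : Fin.append v w 1 = w 0 := Fin.append_right v w 0
    have hw0 : Fin.append w v 0 = w 0 := Fin.append_left w v 0
    have hv1 : Fin.append w v 1 = v 0 := Fin.append_right w v 0
    rw [upsilonForms_tprod (hv0 ▸ hv 0) (hw1 ▸ hw 0), upsilonForms_tprod (hw0 ▸ hw 0) (hv1 ▸ hv 0),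
      hv0, hw1, hw0, hv1]
    simp only [Finset.univ_unique, Fin.default_eq_zero, Finset.sum_singleton]
    have h2 : (1 : ZMod 2) + 1 = 0 := by decide
    rcases zmod2_cases (p 0) with hp | hp <;> rcases zmod2_cases (q 0) with hq | hq <;>
      simp [hp, hq, h2]
    all_goals module
  · rw [← tprod_mul_tprod, ← tprod_mul_tprod]
    simp

/-- The isomorphism `Υ` from 2-forms of order zero to skew-symmetric tensors in `V ⊗ V`, determined by
`Υ(d(dx · y)) = x ⊗ y - (-1)^{|x||y|} y ⊗ x`. -/
def DR.upsilon : DR V →ₗ[ℂ] (⨂[ℂ]^2 V) :=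
  Submodule.liftQ _ upsilonForms upsilon_commutators

end Forms

end Superspace

namespace Superspace

section Lie

variable {V : Type*} [AddCommGroup V] [Module ℂ V] [Superspace V]
variable {W : Type*} [AddCommGroup W] [Module ℂ W] [Superspace W]

/-- The relations `t = σ · t` for cyclic permutations `σ`. -/
def cycRel (V : Type*) [AddCommGroup V] [Module ℂ V] [Superspace V] (k : ℕ) :
    Submodule ℂ (⨂[ℂ]^k V) :=
  Submodule.span ℂ {x | ∃ σ ∈ Subgroup.zpowers (finRotate k), ∃ t, x = t - koszul σ t}

/-- The cyclic coinvariants `(V^{⊗k})_{Z_k}`. -/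
def Cyc (V : Type*) [AddCommGroup V] [Module ℂ V] [Superspace V] (k : ℕ) : Type _ :=
  (⨂[ℂ]^k V) ⧸ cycRel V k

instance (k : ℕ) : AddCommGroup (Cyc V k) := inferInstanceAs (AddCommGroup (_ ⧸ cycRel V k))

instance (k : ℕ) : Module ℂ (Cyc V k) := inferInstanceAs (Module ℂ (_ ⧸ cycRel V k))

/-- The class of a tensor. -/
def Cyc.mk {k : ℕ} : (⨂[ℂ]^k V) →ₗ[ℂ] Cyc V k := (cycRel V k).mkQ

/-- A map commuting with permutations of tensor factors descends to cyclic coinvariants. -/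
def Cyc.lift₂ {k : ℕ} (F : (⨂[ℂ]^k V) →ₗ[ℂ] (⨂[ℂ]^k W))
    (hF : ∀ σ : Equiv.Perm (Fin k), F ∘ₗ koszul σ = koszul σ ∘ₗ F) : Cyc V k →ₗ[ℂ] Cyc W k :=
  Submodule.mapQ (cycRel V k) (cycRel W k) F (by
    refine Submodule.span_le.mpr ?_
    rintro _ ⟨σ, hσ, t, rfl⟩
    refine Submodule.subset_span ⟨σ, hσ, F t, ?_⟩
    rw [map_sub]
    exact congrArg (F t - ·) (LinearMap.congr_fun (hF σ) t))

@[simp] theorem Cyc.lift₂_mk {k : ℕ} (F : (⨂[ℂ]^k V) →ₗ[ℂ] (⨂[ℂ]^k W))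
    (hF : ∀ σ : Equiv.Perm (Fin k), F ∘ₗ koszul σ = koszul σ ∘ₗ F) (t : ⨂[ℂ]^k V) :
    Cyc.lift₂ F hF (Cyc.mk t) = Cyc.mk (F t) := rfl

theorem Cyc.ind {k : ℕ} {P : Cyc V k → Prop} (h : ∀ t, P (Cyc.mk t)) (c : Cyc V k) : P c := by
  obtain ⟨t, rfl⟩ := Submodule.mkQ_surjective (cycRel V k) c
  exact h t

/-- The map of cyclic coinvariants induced by an even linear map. -/
def Cyc.map {k : ℕ} (f : V →ₗ[ℂ] W) (hf : ∀ v, f (γ v) = γ (f v)) : Cyc V k →ₗ[ℂ] Cyc W k :=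
  Cyc.lift₂ (PiTensorProduct.map fun _ => f) fun σ => map_koszul σ f hf

instance (k : ℕ) : Superspace (Cyc V k) where
  γ := Cyc.map γ fun _ => rfl
  γ_γ c := by
    induction c using Cyc.ind with
    | h t => exact congrArg Cyc.mk (γ_γ t)

theorem Cyc.γ_mk {k : ℕ} (t : ⨂[ℂ]^k V) : γ (Cyc.mk t) = Cyc.mk (γ t) := rfl

open Classical in
/-- The norm operator `N = ∑_{σ ∈ Z_k} σ` on `V^{⊗k}`. -/
def normOp (k : ℕ) : (⨂[ℂ]^k V) →ₗ[ℂ] (⨂[ℂ]^k V) :=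
  ∑ σ ∈ Finset.univ.filter (· ∈ Subgroup.zpowers (finRotate k)), koszul σ

theorem normOp_koszul {k : ℕ} {τ : Equiv.Perm (Fin k)} (hτ : τ ∈ Subgroup.zpowers (finRotate k))
    (t : ⨂[ℂ]^k V) : normOp k (koszul τ t) = normOp k t := by
  classical
  simp only [normOp, LinearMap.sum_apply]
  refine Finset.sum_bij' (fun σ _ => σ * τ) (fun σ _ => σ * τ⁻¹) ?_ ?_ ?_ ?_ ?_
  · intro σ hσ
    simpa using mul_mem (Finset.mem_filter.mp hσ).2 hτ
  · intro σ hσ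
    simpa using mul_mem (Finset.mem_filter.mp hσ).2 (inv_mem hτ)
  · intro σ _; simp
  · intro σ _; simp
  · intro σ _
    exact (LinearMap.congr_fun (koszul_trans τ σ) t).symm

/-- The norm operator on cyclic coinvariants. -/
def Cyc.norm (k : ℕ) : Cyc V k →ₗ[ℂ] (⨂[ℂ]^k V) :=
  Submodule.liftQ (cycRel V k) (normOp k) (by
    refine Submodule.span_le.mpr ?_
    rintro _ ⟨σ, hσ, t, rfl⟩
    rw [SetLike.mem_coe, LinearMap.mem_ker, map_sub, normOp_koszul hσ, sub_self])

theorem Cyc.norm_mk {k : ℕ} (t : ⨂[ℂ]^k V) : Cyc.norm k (Cyc.mk t) = normOp k t := rfl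

theorem normOp_comm {k : ℕ} (F : (⨂[ℂ]^k V) →ₗ[ℂ] (⨂[ℂ]^k W))
    (hF : ∀ σ : Equiv.Perm (Fin k), F ∘ₗ koszul σ = koszul σ ∘ₗ F) (t : ⨂[ℂ]^k V) :
    F (normOp k t) = normOp k (F t) := by
  simp only [normOp, LinearMap.sum_apply, map_sum]
  exact Finset.sum_congr rfl fun σ _ => LinearMap.congr_fun (hF σ) t

/-- The Lie algebra of noncommutative Hamiltonians of order at least three,
`⨁_{k ≥ 3} (V^{⊗k})_{Z_k}`. -/
def Ham (V : Type*) [AddCommGroup V] [Module ℂ V] [Superspace V] : Type _ :=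
  ⨁ k : {k : ℕ // 3 ≤ k}, Cyc V k

instance : AddCommGroup (Ham V) :=
  inferInstanceAs (AddCommGroup (⨁ k : {k : ℕ // 3 ≤ k}, Cyc V k))

instance : Module ℂ (Ham V) := inferInstanceAs (Module ℂ (⨁ k : {k : ℕ // 3 ≤ k}, Cyc V k))

/-- The inclusion of the Hamiltonians of order `k`. -/
def Ham.of (k : {k : ℕ // 3 ≤ k}) : Cyc V k →ₗ[ℂ] Ham V :=
  DirectSum.lof ℂ {k : ℕ // 3 ≤ k} (fun k => Cyc V k) k

/-- Linear maps out of the Hamiltonians. -/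
def Ham.lift {E : Type*} [AddCommGroup E] [Module ℂ E]
    (F : ∀ k : {k : ℕ // 3 ≤ k}, Cyc V k →ₗ[ℂ] E) : Ham V →ₗ[ℂ] E :=
  DirectSum.toModule ℂ {k : ℕ // 3 ≤ k} E F

@[simp] theorem Ham.lift_of {E : Type*} [AddCommGroup E] [Module ℂ E]
    (F : ∀ k : {k : ℕ // 3 ≤ k}, Cyc V k →ₗ[ℂ] E) (k : {k : ℕ // 3 ≤ k}) (c : Cyc V k) :
    Ham.lift F (Ham.of k c) = F k c := DirectSum.toModule_lof _ _ _

theorem Ham.ext {E : Type*} [AddCommGroup E] [Module ℂ E] {f g : Ham V →ₗ[ℂ] E}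
    (h : ∀ (k : {k : ℕ // 3 ≤ k}) (t : ⨂[ℂ]^k V),
      f (Ham.of k (Cyc.mk t)) = g (Ham.of k (Cyc.mk t))) : f = g := by
  refine DirectSum.linearMap_ext ℂ fun k => LinearMap.ext fun c => ?_
  induction c using Cyc.ind with
  | h t => exact h k t

instance : Superspace (Ham V) where
  γ := Ham.lift fun k => Ham.of k ∘ₗ γ
  γ_γ x := by
    have : (Ham.lift fun k => Ham.of k ∘ₗ γ) ∘ₗ (Ham.lift fun k => Ham.of k ∘ₗ γ) =
        (LinearMap.id : Ham V →ₗ[ℂ] Ham V) := Ham.ext fun k t => by simp [γ_γ]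
    exact LinearMap.congr_fun this x

theorem Ham.γ_of (k : {k : ℕ // 3 ≤ k}) (c : Cyc V k) : γ (Ham.of k c) = Ham.of k (γ c) :=
  Ham.lift_of _ k c

/-- The norm operator `N : ⨁ (V^{⊗k})_{Z_k} → T(V)`. -/
def Ham.norm : Ham V →ₗ[ℂ] TensorAlgebra ℂ V :=
  Ham.lift fun k => TensorPower.toTensorAlgebra ∘ₗ Cyc.norm k

theorem Ham.norm_γ (x : Ham V) : Ham.norm (γ x) = γ (Ham.norm x) := by
  have : Ham.norm ∘ₗ γ = γ ∘ₗ (Ham.norm : Ham V →ₗ[ℂ] _) := Ham.ext fun k t => by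
    simp only [LinearMap.comp_apply, Ham.γ_of, Ham.norm, Ham.lift_of, γ_toTensorAlgebra,
      Cyc.γ_mk, Cyc.norm_mk]
    exact congrArg _ (normOp_comm (PiTensorProduct.map fun _ => γ)
      (fun σ => map_koszul σ γ fun _ => rfl) t).symm
  exact LinearMap.congr_fun this x

/-- Elements of parity `ε` of the Lie algebra `osp` of the bilinear form `B`: linear endomorphisms
of finite rank that infinitesimally preserve `B`. -/
structure IsOsp (B : V →ₗ[ℂ] V →ₗ[ℂ] ℂ) (ε : ZMod 2) (A : V →ₗ[ℂ] V) : Prop where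
  parity : ∀ v, γ (A v) = sg ε • A (γ v)
  invariant : ∀ v w, B (A v) w + B (γpow ε v) (A w) = 0
  finite_rank : FiniteDimensional ℂ (LinearMap.range A)

/-- The action of a linear map of parity `ε` on Hamiltonians by the Leibniz rule. -/
def Ham.act (ε : ZMod 2) (A : V →ₗ[ℂ] V) (hA : ∀ v, γ (A v) = sg ε • A (γ v)) :
    Ham V →ₗ[ℂ] Ham V :=
  Ham.lift fun k => Ham.of k ∘ₗ Cyc.lift₂ (leib ε A) fun σ => (koszul_leib σ ε A hA).symm

/-- The relations of the exterior power: `σ · x = sgn(σ) x`. -/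
def antisymRel (V : Type*) [AddCommGroup V] [Module ℂ V] [Superspace V] (i : ℕ) :
    Submodule ℂ (⨂[ℂ]^i V) :=
  Submodule.span ℂ {y | ∃ (σ : Equiv.Perm (Fin i)) (x : ⨂[ℂ]^i V),
    y = koszul σ x - ((Equiv.Perm.sign σ : ℤ) : ℂ) • x}

/-- The image of the action of `osp` on tensor powers. -/
def ospRel (B : V →ₗ[ℂ] V →ₗ[ℂ] ℂ) (i : ℕ) : Submodule ℂ (⨂[ℂ]^i (Ham V)) :=
  Submodule.span ℂ {y | ∃ (ε : ZMod 2) (A : V →ₗ[ℂ] V) (hA : IsOsp B ε A) (x : ⨂[ℂ]^i (Ham V)),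
    y = leib ε (Ham.act ε A hA.parity) x}

/-- The relative Chevalley–Eilenberg `i`-chains: the `osp`-coinvariants of the `i`th exterior power
of the Lie algebra of Hamiltonians. -/
abbrev RelChains (B : V →ₗ[ℂ] V →ₗ[ℂ] ℂ) (i : ℕ) : Type _ :=
  (⨂[ℂ]^i (Ham V)) ⧸ (antisymRel (Ham V) i ⊔ ospRel B i)

/-- The subspace of chains of order `N`. -/
def RelChains.ofOrder (B : V →ₗ[ℂ] V →ₗ[ℂ] ℂ) (i N : ℕ) : Submodule ℂ (RelChains B i) :=
  Submodule.span ℂ {y | ∃ (k : Fin i → {k : ℕ // 3 ≤ k}) (c : ∀ j, Cyc V (k j)),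
    ∑ j, (k j : ℕ) = N ∧
      y = Submodule.mkQ _ (PiTensorProduct.tprod ℂ fun j => Ham.of (k j) (c j))}

/-- The completed relative Chevalley–Eilenberg chains `∏_{i,j} C_{ij}`. -/
abbrev Chains (B : V →ₗ[ℂ] V →ₗ[ℂ] ℂ) : Type _ := ∀ i j : ℕ, RelChains.ofOrder B i (2 * j)

/-- The map `ε ∘ T(N)`, `g₁ ⊗ ⋯ ⊗ gᵢ ↦ ∑_σ sgn(σ) σ · (N g₁ ⊗ ⋯ ⊗ N gᵢ)`. -/
def antisymNorm (i : ℕ) : (⨂[ℂ]^i (Ham V)) →ₗ[ℂ] (⨂[ℂ]^i (TensorAlgebra ℂ V)) :=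
  (∑ σ : Equiv.Perm (Fin i), ((Equiv.Perm.sign σ : ℤ) : ℂ) • koszul σ) ∘ₗ
    PiTensorProduct.map fun _ => Ham.norm

theorem antisymRel_le (i : ℕ) :
    antisymRel (Ham V) i ≤ LinearMap.ker (antisymNorm i) := by
  refine Submodule.span_le.mpr ?_
  rintro _ ⟨τ, x, rfl⟩
  rw [SetLike.mem_coe, LinearMap.mem_ker, map_sub, map_smul, sub_eq_zero]
  simp only [antisymNorm, LinearMap.comp_apply, LinearMap.sum_apply, LinearMap.smul_apply]
  rw [← LinearMap.comp_apply (PiTensorProduct.map _) (koszul τ), map_koszul τ _ Ham.norm_γ,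
    LinearMap.comp_apply, Finset.smul_sum]
  refine Fintype.sum_equiv (Equiv.mulRight τ) _ _ fun σ => ?_
  rw [← LinearMap.comp_apply, ← koszul_trans, smul_smul]
  congr 1
  rw [Equiv.coe_mulRight, Equiv.Perm.sign_mul]
  push_cast
  rw [mul_comm, mul_assoc]
  have : ((Equiv.Perm.sign τ : ℤ) : ℂ) * ((Equiv.Perm.sign τ : ℤ) : ℂ) = 1 := by
    rcases Int.units_eq_one_or (Equiv.Perm.sign τ) with h | h <;> simp [h]
  rw [this, mul_one]

theorem superDer_list_prod (ε : ZMod 2) (f : W →ₗ[ℂ] TensorAlgebra ℂ W) {n : ℕ}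
    (x : Fin n → TensorAlgebra ℂ W) :
    superDer ε f (List.ofFn x).prod = ∑ j, (List.ofFn fun i =>
      if i < j then γpow ε (x i) else if i = j then superDer ε f (x i) else x i).prod := by
  induction n with
  | zero =>
    simpa using superDer_algebraMap ε f 1
  | succ n ih =>
    rw [Fin.sum_univ_succ, List.ofFn_succ, List.prod_cons, superDer_mul, ih, Finset.mul_sum]
    congr 1
    · simp [List.ofFn_succ, Fin.succ_ne_zero]
    · refine Finset.sum_congr rfl fun j _ => ?_
      simp [List.ofFn_succ, Fin.succ_pos]

/-- The action on the tensor algebra by the Leibniz rule. -/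
def tensorAct (ε : ZMod 2) (A : V →ₗ[ℂ] V) : TensorAlgebra ℂ V →ₗ[ℂ] TensorAlgebra ℂ V :=
  superDer ε (TensorAlgebra.ι ℂ ∘ₗ A)

theorem tensorAct_toTensorAlgebra (ε : ZMod 2) (A : V →ₗ[ℂ] V) {k : ℕ} (t : ⨂[ℂ]^k V) :
    tensorAct ε A (TensorPower.toTensorAlgebra t) = TensorPower.toTensorAlgebra (leib ε A t) := by
  have : tensorAct ε A ∘ₗ (TensorPower.toTensorAlgebra : (⨂[ℂ]^k V) →ₗ[ℂ] _) =
      TensorPower.toTensorAlgebra ∘ₗ leib ε A := by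
    refine PiTensorProduct.ext (MultilinearMap.ext fun v => ?_)
    simp only [LinearMap.compMultilinearMap_apply, LinearMap.comp_apply, leib, LinearMap.sum_apply,
      PiTensorProduct.map_tprod, map_sum, TensorPower.toTensorAlgebra_tprod,
      TensorAlgebra.tprod_apply, tensorAct, superDer_list_prod]
    refine Finset.sum_congr rfl fun j _ => ?_
    congr 2
    funext i
    split_ifs
    · exact γpow_ι ε (v i)
    · exact superDer_ι _ _ _
    · rfl
  exact LinearMap.congr_fun this t

theorem γ_tensorAct {ε : ZMod 2} {A : V →ₗ[ℂ] V} (hA : ∀ v, γ (A v) = sg ε • A (γ v))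
    (x : TensorAlgebra ℂ V) : γ (tensorAct ε A x) = sg ε • tensorAct ε A (γ x) :=
  γ_superDer (fun w => by simp [γ_ι, hA]) x

theorem norm_act {ε : ZMod 2} {A : V →ₗ[ℂ] V} (hA : ∀ v, γ (A v) = sg ε • A (γ v)) (x : Ham V) :
    Ham.norm (Ham.act ε A hA x) = tensorAct ε A (Ham.norm x) := by
  have : Ham.norm ∘ₗ Ham.act ε A hA = tensorAct ε A ∘ₗ Ham.norm := Ham.ext fun k t => by
    simp only [LinearMap.comp_apply, Ham.act, Ham.norm, Ham.lift_of, Cyc.lift₂_mk, Cyc.norm_mk,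
      tensorAct_toTensorAlgebra]
    exact congrArg _ (normOp_comm (leib ε A) (fun σ => (koszul_leib σ ε A hA).symm) t).symm
  exact LinearMap.congr_fun this x

theorem map_leib {n : ℕ} {ε : ZMod 2} {f : V →ₗ[ℂ] V} {g : W →ₗ[ℂ] W} {h : V →ₗ[ℂ] W}
    (hγ : ∀ v, h (γ v) = γ (h v)) (hfg : ∀ v, h (f v) = g (h v)) (t : ⨂[ℂ]^n V) :
    PiTensorProduct.map (fun _ => h) (leib ε f t) = leib ε g (PiTensorProduct.map (fun _ => h) t) := by
  have : PiTensorProduct.map (fun _ => h) ∘ₗ leib (n := n) ε f =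
      leib ε g ∘ₗ PiTensorProduct.map (fun _ => h) := by
    refine PiTensorProduct.ext (MultilinearMap.ext fun v => ?_)
    simp only [LinearMap.compMultilinearMap_apply, LinearMap.comp_apply, leib, LinearMap.sum_apply,
      PiTensorProduct.map_tprod, map_sum]
    refine Finset.sum_congr rfl fun j _ => ?_
    congr 1
    funext i
    split_ifs
    · rcases zmod2_cases ε with rfl | rfl <;> simp [ZMod.val_one, hγ]
    · exact hfg _
    · rfl
  exact LinearMap.congr_fun this t

theorem antisymNorm_leib {i : ℕ} {ε : ZMod 2} {A : V →ₗ[ℂ] V}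
    (hA : ∀ v, γ (A v) = sg ε • A (γ v)) (x : ⨂[ℂ]^i (Ham V)) :
    antisymNorm i (leib ε (Ham.act ε A hA) x) = leib ε (tensorAct ε A) (antisymNorm i x) := by
  simp only [antisymNorm, LinearMap.comp_apply, LinearMap.sum_apply, LinearMap.smul_apply, map_sum,
    map_smul, map_leib Ham.norm_γ (norm_act hA)]
  refine Finset.sum_congr rfl fun σ _ => ?_
  congr 1
  exact LinearMap.congr_fun (koszul_leib σ ε _ (γ_tensorAct hA)) _

end Lie

end Superspace

namespace Superspace

section Feynman

variable {V : Type*} [AddCommGroup V] [Module ℂ V] [Superspace V]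

theorem compT_toTensorAlgebra {k : ℕ} (t : ⨂[ℂ]^k V) :
    compT k (TensorPower.toTensorAlgebra t) = t := by
  have : compT k ∘ₗ TensorPower.toTensorAlgebra = (LinearMap.id : (⨂[ℂ]^k V) →ₗ[ℂ] _) := by
    refine PiTensorProduct.ext (MultilinearMap.ext fun v => ?_)
    change compT k (TensorPower.toTensorAlgebra (PiTensorProduct.tprod ℂ v)) = _
    rw [TensorPower.toTensorAlgebra_tprod, compT_tprod]
    rfl
  exact LinearMap.congr_fun this t

theorem compT_toTensorAlgebra_of_ne {n k : ℕ} (h : n ≠ k) (t : ⨂[ℂ]^n V) :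
    compT k (TensorPower.toTensorAlgebra t) = 0 := by
  have : compT k ∘ₗ TensorPower.toTensorAlgebra = (0 : (⨂[ℂ]^n V) →ₗ[ℂ] _) := by
    refine PiTensorProduct.ext (MultilinearMap.ext fun v => ?_)
    change compT k (TensorPower.toTensorAlgebra (PiTensorProduct.tprod ℂ v)) = _
    rw [TensorPower.toTensorAlgebra_tprod, compT_tprod_of_ne h]
    rfl
  exact LinearMap.congr_fun this t

theorem compT_comm (k : ℕ) (D : TensorAlgebra ℂ V →ₗ[ℂ] TensorAlgebra ℂ V)
    (D' : ∀ n, (⨂[ℂ]^n V) →ₗ[ℂ] (⨂[ℂ]^n V))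
    (h : ∀ (n : ℕ) (t : ⨂[ℂ]^n V),
      D (TensorPower.toTensorAlgebra t) = TensorPower.toTensorAlgebra (D' n t))
    (x : TensorAlgebra ℂ V) : compT k (D x) = D' k (compT k x) := by
  have hx : x ∈ LinearMap.eqLocus (compT k ∘ₗ D) (D' k ∘ₗ compT k) := by
    refine tensorAlgebra_induction (fun n p v _ => ?_) x
    rw [LinearMap.mem_eqLocus, LinearMap.comp_apply, LinearMap.comp_apply,
      ← TensorPower.toTensorAlgebra_tprod, h]
    by_cases hn : n = k
    · subst hn
      rw [compT_toTensorAlgebra, compT_toTensorAlgebra]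
    · rw [compT_toTensorAlgebra_of_ne hn, compT_toTensorAlgebra_of_ne hn, map_zero]
  exact hx

/-- The projection of the tensor algebra onto its summand `V^{⊗k}`. -/
def comp (k : ℕ) : TensorAlgebra ℂ V →ₗ[ℂ] TensorAlgebra ℂ V :=
  TensorPower.toTensorAlgebra ∘ₗ compT k

theorem comp_tensorAct (k : ℕ) (ε : ZMod 2) (A : V →ₗ[ℂ] V) (x : TensorAlgebra ℂ V) :
    comp k (tensorAct ε A x) = tensorAct ε A (comp k x) := by
  rw [comp, LinearMap.comp_apply, LinearMap.comp_apply, tensorAct_toTensorAlgebra,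
    compT_comm k (tensorAct ε A) (fun n => leib ε A) fun n t => tensorAct_toTensorAlgebra ε A t]

theorem comp_γ (k : ℕ) (x : TensorAlgebra ℂ V) : comp k (γ x) = γ (comp k x) := by
  rw [comp, LinearMap.comp_apply, LinearMap.comp_apply, γ_toTensorAlgebra,
    compT_comm k γ (fun n => γ) fun n t => γ_toTensorAlgebra t]

theorem comp_γpow (k : ℕ) (ε : ZMod 2) (x : TensorAlgebra ℂ V) :
    comp k (γpow ε x) = γpow ε (comp k x) := by
  rcases zmod2_cases ε with rfl | rfl
  · simp [γpow]
  · simp [γpow, ZMod.val_one, comp_γ]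

/-- The map `x₁ ⊗ ⋯ ⊗ x₂ₙ ↦ B(x₁, x₂) B(x₃, x₄) ⋯ B(x₂ₙ₋₁, x₂ₙ)`. -/
def kappa (B : V →ₗ[ℂ] V →ₗ[ℂ] ℂ) (n : ℕ) : (⨂[ℂ]^(n * 2) V) →ₗ[ℂ] ℂ :=
  PiTensorProduct.lift
    { toFun := fun v => ∏ i : Fin n, B (v (finProdFinEquiv (i, 0))) (v (finProdFinEquiv (i, 1)))
      map_update_add' := by
        intro _ v l x y
        obtain ⟨⟨i, b⟩, rfl⟩ := finProdFinEquiv.surjective l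
        refine (Finset.prod_add_prod_eq (Finset.mem_univ i) ?_ ?_ ?_).symm
        · fin_cases b <;> simp [Function.update_apply]
        · intro j _ hj
          simp [Function.update_apply, hj]
        · intro j _ hj
          simp [Function.update_apply, hj]
      map_update_smul' := by
        intro _ v l c x
        obtain ⟨⟨i, b⟩, rfl⟩ := finProdFinEquiv.surjective l
        rw [← Finset.mul_prod_erase _ _ (Finset.mem_univ i),
          ← Finset.mul_prod_erase _ _ (Finset.mem_univ i), smul_eq_mul, ← mul_assoc]
        congr 1
        · fin_cases b <;> simp [Function.update_apply]
        · refine Finset.prod_congr rfl fun j hj => ?_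
          have hj := Finset.ne_of_mem_erase hj
          simp [Function.update_apply, hj] }

theorem kappa_tprod (B : V →ₗ[ℂ] V →ₗ[ℂ] ℂ) (n : ℕ) (v : Fin (n * 2) → V) :
    kappa B n (PiTensorProduct.tprod ℂ v) =
      ∏ i : Fin n, B (v (finProdFinEquiv (i, 0))) (v (finProdFinEquiv (i, 1))) :=
  PiTensorProduct.lift.tprod _

theorem kappa_leib {B : V →ₗ[ℂ] V →ₗ[ℂ] ℂ} {ε : ZMod 2} {A : V →ₗ[ℂ] V} (hA : IsOsp B ε A)
    (n : ℕ) (t : ⨂[ℂ]^(n * 2) V) : kappa B n (leib ε A t) = 0 := by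
  have : kappa B n ∘ₗ leib ε A = 0 := by
    refine PiTensorProduct.ext (MultilinearMap.ext fun v => ?_)
    simp only [LinearMap.compMultilinearMap_apply, LinearMap.comp_apply, leib, LinearMap.sum_apply,
      PiTensorProduct.map_tprod, map_sum, kappa_tprod, LinearMap.zero_apply]
    rw [← Equiv.sum_comp finProdFinEquiv, Fintype.sum_prod_type]
    refine Finset.sum_eq_zero fun i _ => ?_
    rw [Fin.sum_univ_two]
    have lt_iff : ∀ (j i : Fin n) (b c : Fin 2),
        (finProdFinEquiv (j, b) < finProdFinEquiv (i, c)) ↔ (j < i ∨ j = i ∧ b < c) := by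
      intro j i b c
      rw [Fin.lt_def, Fin.lt_def, Fin.lt_def, Fin.ext_iff]
      simp only [finProdFinEquiv_apply_val]
      omega
    have hne : ∀ j, j ≠ i → ∀ b : Fin 2, (finProdFinEquiv (j, b) < finProdFinEquiv (i, (0 : Fin 2)) ↔
        finProdFinEquiv (j, b) < finProdFinEquiv (i, (1 : Fin 2))) := by
      intro j hj b
      simp [lt_iff, hj]
    refine (Finset.prod_add_prod_eq (f := fun j => if j = i then 0 else
        B ((if finProdFinEquiv (j, (0 : Fin 2)) < finProdFinEquiv (i, (0 : Fin 2)) then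
            (γ ^ ε.val : V →ₗ[ℂ] V) else LinearMap.id) (v (finProdFinEquiv (j, 0))))
          ((if finProdFinEquiv (j, (1 : Fin 2)) < finProdFinEquiv (i, (0 : Fin 2)) then
            (γ ^ ε.val : V →ₗ[ℂ] V) else LinearMap.id) (v (finProdFinEquiv (j, 1)))))
      (Finset.mem_univ i) ?_ ?_ ?_).trans ?_
    · have h01 : finProdFinEquiv (i, (0 : Fin 2)) < finProdFinEquiv (i, (1 : Fin 2)) := by
        simp [lt_iff]
      simp only [h01, h01.not_gt, h01.ne', h01.ne, lt_irrefl, if_true, if_false]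
      exact hA.invariant _ _
    · intro j _ hj
      simp [hj]
    · intro j _ hj
      simp [hj, hne j hj]
    · exact Finset.prod_eq_zero (Finset.mem_univ i) (if_pos rfl)
  exact LinearMap.congr_fun this t

/-- A fully ordered graph of type `(val 0, …, val (r - 1))` with `n` oriented edges, up to
isomorphism: the half-edges are the pairs (vertex `j`, position `a` in the linear order at `j`)
and `chord` is the oriented chord diagram whose `i`th edge goes from the half-edge `chord (i, 0)`
to the half-edge `chord (i, 1)`. -/
structure OrderedGraph where
  r : ℕ
  val : Fin r → ℕ
  n : ℕ
  chord : Fin n × Fin 2 ≃ (j : Fin r) × Fin (val j)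

/-- The permutation `σ_c`, which moves the factors at the two ends of the `i`th edge to the places
`2i` and `2i + 1`. -/
def OrderedGraph.perm (G : OrderedGraph) : Fin (∑ j, G.val j) ≃ Fin (G.n * 2) :=
  finSigmaFinEquiv.symm.trans (G.chord.symm.trans finProdFinEquiv)

/-- The concatenation `V^{⊗k₁} ⊗ ⋯ ⊗ V^{⊗kᵣ} → V^{⊗(k₁+⋯+kᵣ)}`, extended by zero to the other
summands of the tensor algebra of `T(V)`. -/
def concat {r : ℕ} (k : Fin r → ℕ) :
    (⨂[ℂ]^r (TensorAlgebra ℂ V)) →ₗ[ℂ] (⨂[ℂ]^(∑ j, k j) V) :=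
  compT (∑ j, k j) ∘ₗ PiTensorProduct.lift
    (MultilinearMap.compLinearMap (MultilinearMap.mkPiAlgebraFin ℂ r (TensorAlgebra ℂ V))
      fun j => comp (k j))

theorem concat_tprod {r : ℕ} (k : Fin r → ℕ) (x : Fin r → TensorAlgebra ℂ V) :
    concat k (PiTensorProduct.tprod ℂ x) =
      compT (∑ j, k j) (List.ofFn fun j => comp (k j) (x j)).prod := by
  simp [concat]

theorem concat_leib {r : ℕ} (k : Fin r → ℕ) (ε : ZMod 2) (A : V →ₗ[ℂ] V)
    (x : ⨂[ℂ]^r (TensorAlgebra ℂ V)) :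
    concat k (leib ε (tensorAct ε A) x) = leib ε A (concat k x) := by
  have : concat k ∘ₗ leib ε (tensorAct ε A) = leib ε A ∘ₗ concat k := by
    refine PiTensorProduct.ext (MultilinearMap.ext fun y => ?_)
    simp only [LinearMap.compMultilinearMap_apply, LinearMap.comp_apply]
    rw [concat_tprod, ← compT_comm _ (tensorAct ε A) (fun n => leib ε A)
      fun n t => tensorAct_toTensorAlgebra ε A t]
    simp only [leib, LinearMap.sum_apply, PiTensorProduct.map_tprod, map_sum, concat_tprod,
      tensorAct, superDer_list_prod]
    refine Finset.sum_congr rfl fun j _ => ?_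
    congr 3
    funext i
    split_ifs
    · exact comp_γpow _ _ _
    · exact comp_tensorAct _ _ _ _
    · rfl
  exact LinearMap.congr_fun this x

/-- The Feynman amplitude of a fully ordered graph of type `(k₁, …, kᵣ)`: the tensor `x` in
`V^{⊗k₁} ⊗ ⋯ ⊗ V^{⊗kᵣ}` goes to `κ(σ_c · x)` and the other summands to zero. -/
def OrderedGraph.amplitude (B : V →ₗ[ℂ] V →ₗ[ℂ] ℂ) (G : OrderedGraph) :
    (⨂[ℂ]^G.r (TensorAlgebra ℂ V)) →ₗ[ℂ] ℂ :=
  kappa B G.n ∘ₗ koszul G.perm ∘ₗ concat G.val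

theorem OrderedGraph.amplitude_leib {B : V →ₗ[ℂ] V →ₗ[ℂ] ℂ} (G : OrderedGraph) {ε : ZMod 2}
    {A : V →ₗ[ℂ] V} (hA : IsOsp B ε A) (x : ⨂[ℂ]^G.r (TensorAlgebra ℂ V)) :
    G.amplitude B (leib ε (tensorAct ε A) x) = 0 := by
  rw [amplitude, LinearMap.comp_apply, LinearMap.comp_apply, concat_leib,
    ← LinearMap.comp_apply (koszul _), koszul_leib _ _ _ hA.parity, LinearMap.comp_apply,
    kappa_leib hA]

/-- The Feynman amplitude of a fully ordered graph on relative Chevalley–Eilenberg chains, the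
composition of the amplitude on tensors with `ε ∘ T(N)`. -/
def OrderedGraph.feynmanAt (B : V →ₗ[ℂ] V →ₗ[ℂ] ℂ) (G : OrderedGraph) :
    RelChains B G.r →ₗ[ℂ] ℂ :=
  Submodule.liftQ _ (G.amplitude B ∘ₗ antisymNorm G.r) (by
    rw [sup_le_iff]
    refine ⟨fun y hy => ?_, Submodule.span_le.mpr ?_⟩
    · rw [LinearMap.mem_ker, LinearMap.comp_apply, LinearMap.mem_ker.mp (antisymRel_le _ hy),
        map_zero]
    · rintro _ ⟨ε, A, hA, x, rfl⟩
      rw [SetLike.mem_coe, LinearMap.mem_ker, LinearMap.comp_apply, antisymNorm_leib,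
        G.amplitude_leib hA])

/-- The Feynman amplitude on completed chains. It only sees the component in the `r`th exterior
power and of order `2n`, where `r` and `n` are the numbers of vertices and edges. -/
def OrderedGraph.feynman (B : V →ₗ[ℂ] V →ₗ[ℂ] ℂ) (G : OrderedGraph) : Chains B →ₗ[ℂ] ℂ where
  toFun x := G.feynmanAt B (x G.r G.n)
  map_add' x y := by simp
  map_smul' c x := by simp

end Feynman

end Superspace

/-- A ribbon graph. The half-edges form a finite subset of `ℕ`; the vertices are the cycles of
`rot`, which sends a half-edge to the next one in the cyclic order at its vertex; the edges are the
two-element orbits of `inv`. The last two conditions say that every vertex has valency at least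
three. -/
structure RibbonGraph where
  H : Finset ℕ
  rot : Equiv.Perm H
  inv : Equiv.Perm H
  inv_inv : ∀ h, inv (inv h) = h
  inv_ne : ∀ h, inv h ≠ h
  rot_ne : ∀ h, rot h ≠ h
  rot_rot_ne : ∀ h, rot (rot h) ≠ h

namespace RibbonGraph

/-- The set of vertices of a ribbon graph, the cycles of `rot`. -/
abbrev Vertex (Γ : RibbonGraph) : Type := Quotient (Equiv.Perm.SameCycle.setoid Γ.rot)

/-- The vertex to which a half-edge is incident. -/
def vertexOf (Γ : RibbonGraph) (h : Γ.H) : Γ.Vertex := Quotient.mk _ h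

/-- The structures of a fully ordered graph on a ribbon graph `Γ` that induce its cyclic orders: the
`j`th vertex is `vertex j`, with the linearly ordered half-edges
`half ⟨j, 0⟩, …, half ⟨j, val j - 1⟩`, and the oriented edges are the pairs
`(half (chord (i, 0)), half (chord (i, 1)))`. (The numbering of the edges by `i` is auxiliary.) -/
structure FullOrder (Γ : RibbonGraph) extends Superspace.OrderedGraph where
  half : (j : Fin r) × Fin (val j) ≃ Γ.H
  vertex : Fin r ≃ Γ.Vertex
  vertexOf_half : ∀ x, Γ.vertexOf (half x) = vertex x.1
  rot_half : ∀ j a, Γ.rot (half ⟨j, a⟩) = half ⟨j, finRotate (val j) a⟩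
  inv_half : ∀ i, Γ.inv (half (chord (i, 0))) = half (chord (i, 1))

/-- The sign of a bijection of finite ordinals. -/
def finSign {a b : ℕ} (τ : Fin a ≃ Fin b) : ℤˣ :=
  Equiv.Perm.sign (τ.trans (finCongr (Fin.equiv_iff_eq.mp ⟨τ⟩).symm))

/-- The set of the initial half-edges of the oriented edges. -/
def FullOrder.tails {Γ : RibbonGraph} (ρ : FullOrder Γ) : Finset Γ.H :=
  Finset.univ.image fun i => ρ.half (ρ.chord (i, 0))

/-- The sign relating two full orders of a ribbon graph: the sign of the permutation of the vertices
times `-1` for every edge whose orientation is reversed. -/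
def FullOrder.relSign {Γ : RibbonGraph} (ρ ρ' : FullOrder Γ) : ℤˣ :=
  finSign (ρ.vertex.trans ρ'.vertex.symm) * (-1) ^ (ρ.tails \ ρ'.tails).card

/-- An orientation of a ribbon graph: a class of full orders modulo permutations of the vertices and
flips of edges of total sign one and cyclic permutations of the half-edges at the vertices. -/
@[ext] structure Orientation (Γ : RibbonGraph) where
  carrier : Set (FullOrder Γ)
  nonempty : carrier.Nonempty
  mem_iff : ∀ ρ ∈ carrier, ∀ ρ', ρ' ∈ carrier ↔ ρ.relSign ρ' = 1

/-- An isomorphism of ribbon graphs. -/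
structure Iso (Γ Γ' : RibbonGraph) where
  toEquiv : Γ.H ≃ Γ'.H
  map_rot : ∀ h, toEquiv (Γ.rot h) = Γ'.rot (toEquiv h)
  map_inv : ∀ h, toEquiv (Γ.inv h) = Γ'.inv (toEquiv h)

/-- The bijection of vertices induced by an isomorphism. -/
def Iso.vertexEquiv {Γ Γ' : RibbonGraph} (f : Iso Γ Γ') : Γ.Vertex ≃ Γ'.Vertex :=
  Quotient.congr f.toEquiv fun a b => by
    have h : Γ'.rot = f.toEquiv.permCongrHom Γ.rot := by
      ext x
      simp [f.map_rot]
    change Γ.rot.SameCycle a b ↔ Γ'.rot.SameCycle (f.toEquiv a) (f.toEquiv b)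
    simp only [Equiv.Perm.SameCycle, h, ← map_zpow]
    simp

/-- The full order induced by an isomorphism of ribbon graphs. -/
def FullOrder.map {Γ Γ' : RibbonGraph} (f : Iso Γ Γ') (ρ : FullOrder Γ) : FullOrder Γ' where
  toOrderedGraph := ρ.toOrderedGraph
  half := ρ.half.trans f.toEquiv
  vertex := ρ.vertex.trans f.vertexEquiv
  vertexOf_half x := by
    rw [Equiv.trans_apply, Equiv.trans_apply, ← ρ.vertexOf_half]
    rfl
  rot_half j a := by
    rw [Equiv.trans_apply, ← f.map_rot, ρ.rot_half, Equiv.trans_apply]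
  inv_half i := by
    rw [Equiv.trans_apply, ← f.map_inv, ρ.inv_half, Equiv.trans_apply]

end RibbonGraph

/-- An oriented ribbon graph. -/
structure OrientedRibbonGraph where
  graph : RibbonGraph
  orientation : graph.Orientation

namespace OrientedRibbonGraph

open RibbonGraph

/-- Isomorphisms of oriented ribbon graphs. -/
def Iso (Γ Γ' : OrientedRibbonGraph) : Type :=
  {f : RibbonGraph.Iso Γ.graph Γ'.graph //
    ∀ ρ ∈ Γ.orientation.carrier, ρ.map f ∈ Γ'.orientation.carrier}

/-- The automorphisms of an oriented ribbon graph. -/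
def Aut (Γ : OrientedRibbonGraph) : Type := Iso Γ Γ

/-- The relations of the graph complex: isomorphic graphs are equal, and reversing the orientation
changes the sign. -/
def rel : Submodule ℂ (OrientedRibbonGraph →₀ ℂ) :=
  Submodule.span ℂ
    ({x | ∃ Γ Γ' : OrientedRibbonGraph, Nonempty (Iso Γ Γ') ∧
        x = Finsupp.single Γ 1 - Finsupp.single Γ' 1} ∪
      {x | ∃ (Γ : RibbonGraph) (o o' : Γ.Orientation), o ≠ o' ∧
        x = Finsupp.single ⟨Γ, o⟩ 1 + Finsupp.single ⟨Γ, o'⟩ 1})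

end OrientedRibbonGraph

/-- The underlying space of the graph complex. -/
abbrev GraphComplex : Type := (OrientedRibbonGraph →₀ ℂ) ⧸ OrientedRibbonGraph.rel

/-- The class of an oriented ribbon graph in the graph complex. -/
def OrientedRibbonGraph.cls (Γ : OrientedRibbonGraph) : GraphComplex :=
  OrientedRibbonGraph.rel.mkQ (Finsupp.single Γ 1)

namespace Superspace

/-- The pairing of chains with graphs: `⟪x, Γ⟫ = F_Γ(x) / |Aut Γ|`, where `F_Γ` is the Feynman
amplitude of any fully ordered graph representing `Γ`. -/
def IsPairing {V : Type*} [AddCommGroup V] [Module ℂ V] [Superspace V] (B : V →ₗ[ℂ] V →ₗ[ℂ] ℂ)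
    (P : Chains B →ₗ[ℂ] GraphComplex →ₗ[ℂ] ℂ) : Prop :=
  ∀ (x : Chains B) (Γ : OrientedRibbonGraph), ∀ ρ ∈ Γ.orientation.carrier,
    P x Γ.cls = ρ.feynman B x / Nat.card Γ.Aut

end Superspace

namespace Superspace

section Functoriality

variable {V : Type*} [AddCommGroup V] [Module ℂ V] [Superspace V]
variable {W : Type*} [AddCommGroup W] [Module ℂ W] [Superspace W]

/-- The map of forms induced by a linear map. -/
def formsMap (f : V →ₗ[ℂ] W) : Forms V →ₐ[ℂ] Forms W :=
  TensorAlgebra.lift ℂ (TensorAlgebra.ι ℂ ∘ₗ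
    (Letters.fn ∘ₗ f ∘ₗ Letters.fst + Letters.df ∘ₗ f ∘ₗ Letters.snd))

theorem formsMap_γ {f : V →ₗ[ℂ] W} (hf : ∀ v, f (γ v) = γ (f v)) (x : Forms V) :
    formsMap f (γ x) = γ (formsMap f x) := by
  have : (formsMap f).comp (tensorγ (Letters V)) = (tensorγ (Letters W)).comp (formsMap f) := by
    ext w
    simp [formsMap, Letters.γ_def, hf, sub_eq_add_neg]
  exact DFunLike.congr_fun this x

/-- The map `f^*` of de Rham complexes induced by an even linear map `f : V → W`. -/
def DR.map (f : V →ₗ[ℂ] W) (hf : ∀ v, f (γ v) = γ (f v)) : DR V →ₗ[ℂ] DR W :=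
  Submodule.mapQ _ _ (formsMap f).toLinearMap (by
    refine Submodule.span_le.mpr ?_
    rintro _ ⟨a, b, x, y, hx, hy, rfl⟩
    refine Submodule.subset_span ⟨a, b, formsMap f x, formsMap f y, ?_, ?_, ?_⟩
    · rw [mem_part, ← formsMap_γ hf, mem_part.mp hx, map_smul]
    · rw [mem_part, ← formsMap_γ hf, mem_part.mp hy, map_smul]
    · simp)

end Functoriality

section AInf

theorem update_pair_zero {E : Type*} (a b c : E) : Function.update ![a, b] 0 c = ![c, b] := by
  funext i
  fin_cases i <;> rfl

theorem update_pair_one {E : Type*} (a b c : E) : Function.update ![a, b] 1 c = ![a, c] := by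
  funext i
  fin_cases i <;> rfl

variable (U : Type*) [AddCommGroup U] [Module ℂ U] [Superspace U]

/-- The parity reversion `ΠU*` of the dual of `U`: a functional vanishing on the odd part of `U` is
odd, and a functional vanishing on the even part is even. -/
abbrev PiDual : Type _ := Module.Dual ℂ U

instance : Superspace (PiDual U) where
  γ := -Module.Dual.transpose (R := ℂ) (γ : U →ₗ[ℂ] U)
  γ_γ f := by
    ext u
    simp [Module.Dual.transpose_apply, γ_γ]

variable [FiniteDimensional ℂ U]

/-- A minimal symplectic `A_∞`-structure on `U` whose symplectic form is even and of order zero. The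
vector field `m = m₂ + m₃ + ⋯` on the completed tensor algebra of `ΠU*` is given by its
components `m k : ΠU* → (ΠU*)^{⊗k}`. -/
structure MinimalSymplecticAInf where
  m : ∀ k, PiDual U →ₗ[ℂ] (⨂[ℂ]^k (PiDual U))
  odd : ∀ k v, γ (m k v) = -m k (γ v)
  vanishing : m 0 = 0
  minimal : m 1 = 0
  square_zero : ∀ n v,
    ∑ p ∈ Finset.HasAntidiagonal.antidiagonal (n + 1), lieForms (m p.1) (zeroForm (m p.2 v)) = 0
  ω : DR (PiDual U)
  order_zero : ω ∈ DR.formsOfOrder (PiDual U) 2 0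
  even : ω ∈ DR.even (PiDual U)
  closed : DR.d ω = 0
  nondegenerate : ∀ k, ∀ α ∈ DR.formsOfOrder (PiDual U) 1 k,
    ∃! ξ : PiDual U →ₗ[ℂ] (⨂[ℂ]^k (PiDual U)), DR.contr ξ ω = α
  symplectic : ∀ k, DR.lie (m k) ω = 0

variable {U}

namespace MinimalSymplecticAInf

/-- A 0-form `h` is a Hamiltonian of the structure: it has no constant term and `dh = i_m ω`. It is
given by its components `h k` in the cyclic coinvariants of `(ΠU*)^{⊗k}`. -/
structure IsHamiltonian (A : MinimalSymplecticAInf U) (h : ∀ k, Cyc (PiDual U) k) : Prop where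
  zero : h 0 = 0
  eq : ∀ k, ∃ t : ⨂[ℂ]^(k + 1) (PiDual U), Cyc.mk t = h (k + 1) ∧
    DR.d (DR.mk (zeroForm t)) = DR.contr (A.m k) A.ω

/-- The inner product `⟨-,-⟩ = Υ(ω)` on `ΠU`. -/
def inner (A : MinimalSymplecticAInf U) : U →ₗ[ℂ] U →ₗ[ℂ] ℂ :=
  (LinearMap.mk₂ ℂ (fun x y => PiTensorProduct.tprod ℂ ![x, y])
    (fun x x' y => by
      simpa only [update_pair_zero] using
        MultilinearMap.map_update_add (PiTensorProduct.tprod ℂ) ![x, y] 0 x x')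
    (fun c x y => by
      simpa only [update_pair_zero] using
        MultilinearMap.map_update_smul (PiTensorProduct.tprod ℂ) ![x, y] 0 c x)
    (fun x y y' => by
      simpa only [update_pair_one] using
        MultilinearMap.map_update_add (PiTensorProduct.tprod ℂ) ![x, y] 1 y y')
    (fun c x y => by
      simpa only [update_pair_one] using
        MultilinearMap.map_update_smul (PiTensorProduct.tprod ℂ) ![x, y] 1 c y)).compr₂
    (PiTensorProduct.dualDistrib (DR.upsilon A.ω))

open Classical in
/-- The inner product on `ΠU*` obtained from that on `ΠU` by the identification
`x ↦ ⟨x, -⟩` of `ΠU` with `ΠU*`, i.e. `⟨⟨x, -⟩, f⟩⁻¹ = f(x)`. -/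
def inverseInner (A : MinimalSymplecticAInf U) : PiDual U →ₗ[ℂ] PiDual U →ₗ[ℂ] ℂ :=
  if h : Function.Bijective A.inner then
    Module.Dual.eval ℂ U ∘ₗ (LinearEquiv.ofBijective A.inner h).symm.toLinearMap
  else 0

/-- The multilinear operations `m_k : (ΠU)^{⊗k} → ΠU`. -/
def op (A : MinimalSymplecticAInf U) (k : ℕ) : (⨂[ℂ]^k U) →ₗ[ℂ] U :=
  (Module.evalEquiv ℂ U).symm.toLinearMap ∘ₗ (PiTensorProduct.dualDistrib ∘ₗ A.m k).flip

/-- The tensors `h_k ∈ (ΠU*)^{⊗k}`, i.e. the functionals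
`h_k(x₁, …, x_k) = ⟨m_{k-1}(x₁, …, x_{k-1}), x_k⟩`. -/
def tensor (A : MinimalSymplecticAInf U) : ∀ k, ⨂[ℂ]^k (PiDual U)
  | 0 => 0
  | k + 1 => PiTensorProduct.dualDistribEquiv.symm (PiTensorProduct.lift
      (((A.inner ∘ₗ A.op k).compMultilinearMap (PiTensorProduct.tprod ℂ)).uncurryRight :
        MultilinearMap ℂ (fun _ : Fin (k + 1) => U) ℂ))

end MinimalSymplecticAInf

end AInf

end Superspace

namespace Superspace

section Canonical

/-- The superspace with even coordinates `p_i`, `q_i` indexed by `P` and odd coordinates `x_i`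
indexed by `X`. For `P = Fin n` and `X = Fin m` this is `ℂ^{2n|m}`; for `P = X = ℕ` it is the direct
limit of these spaces. -/
def Can (P X : Type) : Type := P ⊕ P ⊕ X →₀ ℂ

namespace Can

variable {P X : Type}

instance : AddCommGroup (Can P X) := inferInstanceAs (AddCommGroup (P ⊕ P ⊕ X →₀ ℂ))

instance : Module ℂ (Can P X) := inferInstanceAs (Module ℂ (P ⊕ P ⊕ X →₀ ℂ))

/-- The coordinates. -/
def coord (i : P ⊕ P ⊕ X) : Can P X := Finsupp.single i 1

/-- The coordinate `p_i`. -/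
def p (i : P) : Can P X := coord (.inl i)

/-- The coordinate `q_i`. -/
def q (i : P) : Can P X := coord (.inr (.inl i))

/-- The coordinate `x_i`. -/
def x (i : X) : Can P X := coord (.inr (.inr i))

/-- The linear map with given values on the coordinates. -/
def lin {E : Type*} [AddCommGroup E] [Module ℂ E] (f : P ⊕ P ⊕ X → E) : Can P X →ₗ[ℂ] E :=
  Finsupp.linearCombination ℂ f

@[simp] theorem lin_coord {E : Type*} [AddCommGroup E] [Module ℂ E] (f : P ⊕ P ⊕ X → E)
    (i : P ⊕ P ⊕ X) : lin f (coord i) = f i := by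
  change Finsupp.linearCombination ℂ f (Finsupp.single i 1) = _
  rw [Finsupp.linearCombination_single, one_smul]

theorem ext {E : Type*} [AddCommGroup E] [Module ℂ E] {f g : Can P X →ₗ[ℂ] E}
    (h : ∀ i, f (coord i) = g (coord i)) : f = g :=
  Finsupp.lhom_ext' fun i => LinearMap.ext_ring (h i)

/-- The sign of the parity of a coordinate. -/
def sign : P ⊕ P ⊕ X → ℂ
  | .inl _ => 1
  | .inr (.inl _) => 1
  | .inr (.inr _) => -1

instance : Superspace (Can P X) where
  γ := lin fun i => sign i • coord i
  γ_γ v := by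
    have : (lin fun i => sign i • coord i) ∘ₗ (lin fun i => sign i • coord i) =
        (LinearMap.id : Can P X →ₗ[ℂ] Can P X) := by
      refine ext fun i => ?_
      rcases i with i | i | i <;> simp [sign]
    exact LinearMap.congr_fun this v

theorem γ_coord (i : P ⊕ P ⊕ X) : γ (coord i) = sign i • coord i := lin_coord _ i

open Classical in
/-- The values of the canonical form on coordinates. -/
def formCoord : P ⊕ P ⊕ X → P ⊕ P ⊕ X → ℂ
  | .inl i, .inr (.inl j) => if i = j then 1 else 0
  | .inr (.inl i), .inl j => if i = j then -1 else 0
  | .inr (.inr i), .inr (.inr j) => if i = j then 1 else 0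
  | _, _ => 0

/-- The canonical skew-symmetric even bilinear form: `⟨p_i, q_i⟩ = 1 = -⟨q_i, p_i⟩`,
`⟨x_i, x_i⟩ = 1`, and all other pairs of coordinates give zero. -/
def form : Can P X →ₗ[ℂ] Can P X →ₗ[ℂ] ℂ := lin fun i => lin fun j => formCoord i j

/-- The canonical symplectic form `∑ dp_i dq_i + ½ ∑ dx_i dx_i` on `ℂ^{2n|m}`. -/
def ω (n m : ℕ) : DR (Can (Fin n) (Fin m)) :=
  DR.mk (∑ i, dvar (p i) * dvar (q i) + (1 / 2 : ℂ) • ∑ i, dvar (x i) * dvar (x i))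

/-- The inclusion of `ℂ^{2n|m}` in the direct limit. -/
def incl (n m : ℕ) : Can (Fin n) (Fin m) →ₗ[ℂ] Can ℕ ℕ :=
  lin fun i => coord (i.map Fin.val (Sum.map Fin.val Fin.val))

theorem incl_γ (n m : ℕ) (v : Can (Fin n) (Fin m)) : incl n m (γ v) = γ (incl n m v) := by
  have : incl n m ∘ₗ γ = γ ∘ₗ incl n m := by
    refine ext fun i => ?_
    rcases i with i | i | i <;> simp [γ_coord, incl, sign]
  exact LinearMap.congr_fun this v

end Can

end Canonical

section Exponential

variable {V : Type*} [AddCommGroup V] [Module ℂ V] [Superspace V]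

/-- The component of order `k` of a Hamiltonian, as an element of the Lie algebra of Hamiltonians of
order at least three. -/
def Ham.component (h : ∀ k, Cyc V k) (k : ℕ) : Ham V :=
  if hk : 3 ≤ k then Ham.of ⟨k, hk⟩ (h k) else 0

theorem expChain_mem (B : V →ₗ[ℂ] V →ₗ[ℂ] ℂ) (h : ∀ k, Cyc V k) (i N : ℕ) :
    ((i.factorial : ℂ)⁻¹ • ∑ k ∈ Finset.finAntidiagonal i N,
      Submodule.mkQ (antisymRel (Ham V) i ⊔ ospRel B i)
        (PiTensorProduct.tprod ℂ fun s => Ham.component h (k s))) ∈ RelChains.ofOrder B i N := by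
  refine Submodule.smul_mem _ _ (Submodule.sum_mem _ fun k hk => ?_)
  by_cases h3 : ∀ s, 3 ≤ k s
  · refine Submodule.subset_span ⟨fun s => ⟨k s, h3 s⟩, fun s => h (k s),
      Finset.mem_finAntidiagonal.mp hk, ?_⟩
    congr 2
    funext s
    exact dif_pos (h3 s)
  · push Not at h3
    obtain ⟨s, hs⟩ := h3
    rw [(PiTensorProduct.tprod ℂ).map_coord_zero s (dif_neg hs.not_ge), map_zero]
    exact zero_mem _

/-- The chain `exp(h) = 1 + h + ½ h ∧ h + ⋯` of a Hamiltonian `h = h₃ + h₄ + ⋯`. Its component in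
bidegree `(i, j)` is the sum of the `(1 / i!) h_{k₁} ∧ ⋯ ∧ h_{kᵢ}` with `k₁ + ⋯ + kᵢ = 2j`. -/
def expChain (B : V →ₗ[ℂ] V →ₗ[ℂ] ℂ) (h : ∀ k, Cyc V k) : Chains B :=
  fun i j => ⟨_, expChain_mem B h i (2 * j)⟩

end Exponential

namespace MinimalSymplecticAInf

variable {U : Type*} [AddCommGroup U] [Module ℂ U] [Superspace U] [FiniteDimensional ℂ U]

/-- A linear symplectomorphism from `ΠU*` to `ℂ^{2n|m}` with its canonical symplectic form. -/
structure Darboux (A : MinimalSymplecticAInf U) (n m : ℕ) where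
  φ : PiDual U ≃ₗ[ℂ] Can (Fin n) (Fin m)
  even : ∀ v, φ.toLinearMap (γ v) = γ (φ.toLinearMap v)
  symplectic : DR.map φ.toLinearMap even A.ω = Can.ω n m

variable {A : MinimalSymplecticAInf U} {n m : ℕ}

/-- The image `h' = φ^*(h)` of the Hamiltonian in the Hamiltonians on `ℂ^{2n|m}`. -/
def Darboux.hamiltonian (D : Darboux A n m) (h : ∀ k, Cyc (PiDual U) k) (k : ℕ) :
    Cyc (Can (Fin n) (Fin m)) k :=
  Cyc.map D.φ.toLinearMap D.even (h k)

/-- The chain `c_A = exp(h')` in the relative Chevalley–Eilenberg complex of `ℂ^{2n|m}`. -/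
def Darboux.charClass (D : Darboux A n m) (h : ∀ k, Cyc (PiDual U) k) :
    Chains (Can.form (P := Fin n) (X := Fin m)) :=
  expChain Can.form (D.hamiltonian h)

/-- The characteristic class `c_A = exp(h')` in the stable limit of the relative
Chevalley–Eilenberg complexes. -/
def Darboux.stableCharClass (D : Darboux A n m) (h : ∀ k, Cyc (PiDual U) k) :
    Chains (Can.form (P := ℕ) (X := ℕ)) :=
  expChain Can.form fun k => Cyc.map (Can.incl n m) (Can.incl_γ n m) (D.hamiltonian h k)

/-- The partition function `Z_A` on graphs: the linear map whose value on `Γ` is obtained by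
attaching the tensors `h_k` to the vertices of valency `k` of any fully ordered graph representing
`Γ`, contracting with the inverse inner product along the edges, and dividing by `|Aut Γ|`. -/
def IsPartitionFunction (A : MinimalSymplecticAInf U) (Z : GraphComplex →ₗ[ℂ] ℂ) : Prop :=
  ∀ (Γ : OrientedRibbonGraph), ∀ ρ ∈ Γ.orientation.carrier,
    Z Γ.cls = kappa A.inverseInner ρ.n (koszul ρ.perm (concat ρ.val
      (PiTensorProduct.tprod ℂ fun j => TensorPower.toTensorAlgebra (A.tensor (ρ.val j))))) /
        Nat.card Γ.Aut

end MinimalSymplecticAInf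

end Superspace

end

/-! Three facts carry the theorem.

The amplitude of a chain depends on the chosen full order only through a sign. Two full orders of
one ribbon graph differ by a permutation of the vertices, rotations at the vertices, a renumbering
of the edges and flips of edges. Antisymmetrization turns the vertex permutation into its signature,
and the norm operator absorbs the rotations. In `kappa_koszul`, a pair of letters of unequal parity
contributes zero to a superskew form, so each surviving pair is even as a block: renumbering edges
is free, and each flip costs -1. The Koszul signs of all these block permutations come from
`oddInv_block`. The outcome is `RibbonGraph.FullOrder.feynman_eq`, whose factor `relSign` is
multiplicative (`relSign_mul`). Hence amplitudes respect isomorphisms and change sign with the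
orientation, while the number of automorphisms is the same for all orientations. This gives
`existsUnique_isPairing`.

The norm of the Hamiltonian is the family of structure tensors: `N h_k = A.tensor k` for positive
`k` (`Presentation.normOp_hamiltonian`). A 1-form modulo supercommutators can be written with its
differential in last place, and `oneFormCoeff` reads off the coefficients. Applied to `dh` it gives
`N h` up to the sign `initγ`; applied to `i_m ω`, with `ω` a sum of terms `c da db`, it gives the
tensors obtained from the inner product `Υ(ω)` and the operations, up to the same sign.

The exponential removes the antisymmetrization. The structure tensors are odd, so the Koszul sign of
permuting them cancels the signature in the antisymmetrizer. Each of the `r!` permutations then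
contributes the same contraction, for exactly one distribution of the orders among the factors, and
the coefficient `1/r!` cancels the repetition (`OrderedGraph.feynman_expChain`). Darboux coordinates
identify the inverse inner product with the canonical form (`inverseInner_eq`), and the inclusion in
the stable limit is an isometry, so the result is the contraction that defines the partition
function. The partition function is therefore well defined because the pairing is. -/

open scoped TensorProduct DirectSum

noncomputable section

set_option linter.unusedSectionVars false

namespace Superspace

/-! ### Koszul signs of permutations of blocks. -/

section BlockPermutations

/-- Strict monotonicity for the lexicographic order on pairs `(block, position)`. -/
structure LexMono {r N : ℕ} {k : Fin r → ℕ} (e : ((j : Fin r) × Fin (k j)) ≃ Fin N) : Prop where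
  fst_lt : ∀ {j i} (a b), j < i → e ⟨j, a⟩ < e ⟨i, b⟩
  snd_lt : ∀ {j a b}, a < b → e ⟨j, a⟩ < e ⟨j, b⟩

theorem LexMono.snd_lt_iff {r N : ℕ} {k : Fin r → ℕ} {e : ((j : Fin r) × Fin (k j)) ≃ Fin N}
    (he : LexMono e) {j : Fin r} {a b : Fin (k j)} : e ⟨j, a⟩ < e ⟨j, b⟩ ↔ a < b := by
  refine ⟨fun h => ?_, he.snd_lt⟩
  by_contra hab
  rcases (not_lt.mp hab).lt_or_eq with hab | rfl
  · exact (he.snd_lt hab).not_gt h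
  · exact lt_irrefl _ h

theorem LexMono.fst_lt_iff {r N : ℕ} {k : Fin r → ℕ} {e : ((j : Fin r) × Fin (k j)) ≃ Fin N}
    (he : LexMono e) {j i : Fin r} (hij : j ≠ i) {a : Fin (k j)} {b : Fin (k i)} :
    e ⟨j, a⟩ < e ⟨i, b⟩ ↔ j < i := by
  refine ⟨fun h => ?_, he.fst_lt a b⟩
  by_contra hji
  exact (he.fst_lt b a (lt_of_le_of_ne (not_lt.mp hji) hij.symm)).not_gt h

theorem lexMono_finSigmaFinEquiv {r : ℕ} (k : Fin r → ℕ) :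
    LexMono (finSigmaFinEquiv (n := k)) where
  snd_lt {j a b} h := by
    rw [Fin.lt_def, finSigmaFinEquiv_apply, finSigmaFinEquiv_apply]
    simpa using h
  fst_lt {j i} a b h := by
    rw [Fin.lt_def, finSigmaFinEquiv_apply, finSigmaFinEquiv_apply]
    obtain ⟨j, hj⟩ := j
    obtain ⟨i, hi⟩ := i
    have h : j < i := h
    obtain ⟨d, rfl⟩ := Nat.exists_eq_add_of_lt h
    -- The offset of block `i = j + d + 1` exceeds that of block `j` by at least the whole length of
    -- block `j`, and `a` is smaller than that length.
    have h1 : ∑ x : Fin (j + d + 1), k (Fin.castLE hi.le x) =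
        (∑ x : Fin j, k (Fin.castLE hj.le x)) + k ⟨j, hj⟩ +
          ∑ x : Fin d, k ⟨j + 1 + x, by omega⟩ := by
      have h2 := Fin.sum_univ_add (a := j + 1) (b := d)
        (fun x => k (Fin.castLE (show j + 1 + d ≤ r by omega) x))
      rw [Fin.sum_univ_castSucc] at h2
      refine Eq.trans ?_ h2
      exact Fintype.sum_equiv (finCongr (by omega)) _ _ fun x => rfl
    have ha : (a : ℕ) < k ⟨j, hj⟩ := a.2
    change ∑ x : Fin j, k (Fin.castLE hj.le x) + (a : ℕ) <
      ∑ x : Fin (j + d + 1), k (Fin.castLE hi.le x) + (b : ℕ)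
    omega

/-- The number of inversions of odd letters of a permutation of blocks that also permutes the
letters within the blocks. -/
theorem oddInv_block {r N N' : ℕ} {r' : ℕ} {k : Fin r → ℕ} {k' : Fin r' → ℕ}
    {e : ((j : Fin r) × Fin (k j)) ≃ Fin N} {e' : ((j : Fin r') × Fin (k' j)) ≃ Fin N'}
    (he : LexMono e) (he' : LexMono e') (τ : Fin r ≃ Fin r')
    (c : ∀ j, Fin (k j) ≃ Fin (k' (τ j))) (S : Fin N ≃ Fin N')
    (hS : ∀ j a, S (e ⟨j, a⟩) = e' ⟨τ j, c j a⟩) (p : Fin N → ZMod 2) :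
    oddInv S p = oddInv τ (fun j => ∑ a, p (e ⟨j, a⟩)) +
      ∑ j, oddInv (c j) (fun a => p (e ⟨j, a⟩)) := by
  -- For letters of distinct blocks both orders are decided by the blocks alone, so all pairs are
  -- inverted or none, and the sum factors into block parities. Inside a single block the order of
  -- images is decided by `c j`.
  have hblock : ∀ j i, (∑ a, ∑ b, if e ⟨j, a⟩ < e ⟨i, b⟩ ∧ S (e ⟨i, b⟩) < S (e ⟨j, a⟩) then
      p (e ⟨j, a⟩) * p (e ⟨i, b⟩) else 0) =
      (if j < i ∧ τ i < τ j then (∑ a, p (e ⟨j, a⟩)) * ∑ b, p (e ⟨i, b⟩) else 0) +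
        if j = i then oddInv (c j) (fun a => p (e ⟨j, a⟩)) else 0 := by
    intro j i
    rcases eq_or_ne j i with rfl | hji
    · simp only [hS, he.snd_lt_iff, he'.snd_lt_iff, lt_irrefl, false_and, if_false, if_true, zero_add]
      rfl
    · have hτ : τ i ≠ τ j := fun h => hji (τ.injective h).symm
      simp only [hS, he.fst_lt_iff hji, he'.fst_lt_iff hτ, hji, if_false, add_zero]
      split_ifs
      · rw [Finset.sum_mul_sum]
      · simp
  unfold oddInv
  rw [← Equiv.sum_comp e, Fintype.sum_sigma]
  simp only [← Equiv.sum_comp e (fun j => if _ < j ∧ S j < S _ then p _ * p j else 0),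
    Fintype.sum_sigma]
  rw [← Finset.sum_add_distrib]
  refine Finset.sum_congr rfl fun j _ => ?_
  rw [Finset.sum_comm]
  simp only [hblock, Finset.sum_add_distrib, Finset.sum_ite_eq, Finset.mem_univ, if_true]
  rfl

end BlockPermutations

/-! ### Concatenation of words. -/

section Multilinear

variable {V : Type*} [AddCommGroup V] [Module ℂ V] [Superspace V]
variable {W : Type*} [AddCommGroup W] [Module ℂ W] [Superspace W]

theorem span_homogeneous_words :
    Submodule.span ℂ {x : TensorAlgebra ℂ V | ∃ (n : ℕ) (p : Fin n → ZMod 2) (v : Fin n → V),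
      (∀ i, v i ∈ part V (p i)) ∧ x = TensorAlgebra.tprod ℂ V n v} = ⊤ := by
  refine eq_top_iff.mpr fun x _ => tensorAlgebra_induction (fun n p v hv => ?_) x
  exact Submodule.subset_span ⟨n, p, v, hv, rfl⟩

/-- Linear maps on tensors of elements of the tensor algebra agree if they do so on tensors of words
in homogeneous letters. -/
theorem tensor_words_ext {r : ℕ} {E : Type*} [AddCommGroup E] [Module ℂ E]
    {f g : (⨂[ℂ]^r (TensorAlgebra ℂ V)) →ₗ[ℂ] E}
    (h : ∀ (n : Fin r → ℕ) (p : ∀ j, Fin (n j) → ZMod 2) (v : ∀ j, Fin (n j) → V),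
      (∀ j i, v j i ∈ part V (p j i)) →
      f (PiTensorProduct.tprod ℂ fun j => TensorAlgebra.tprod ℂ V (n j) (v j)) =
        g (PiTensorProduct.tprod ℂ fun j => TensorAlgebra.tprod ℂ V (n j) (v j))) : f = g := by
  refine PiTensorProduct.ext_of_span_eq_top
    (g := fun _ (x : {x : TensorAlgebra ℂ V | ∃ (n : ℕ) (p : Fin n → ZMod 2) (v : Fin n → V),
      (∀ i, v i ∈ part V (p i)) ∧ x = TensorAlgebra.tprod ℂ V n v}) => x.1)
    (fun _ => by rw [Subtype.range_coe]; exact span_homogeneous_words) fun y => ?_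
  choose n p v hv hy using fun j => (y j).2
  simp only [hy]
  exact h n p v hv

theorem tprod_congr {m n : ℕ} (h : m = n) (v : Fin m → V) (w : Fin n → V)
    (hvw : ∀ i, v i = w (Fin.cast h i)) :
    TensorAlgebra.tprod ℂ V m v = TensorAlgebra.tprod ℂ V n w := by
  subst h
  exact congrArg _ (funext hvw)

/-- The offset of a block is the total length of the preceding blocks, so it does not see the last
one. -/
theorem finSigmaFinEquiv_castSucc {r : ℕ} (k : Fin (r + 1) → ℕ) (j : Fin r)
    (b : Fin (k j.castSucc)) : (finSigmaFinEquiv (n := k) ⟨j.castSucc, b⟩ : ℕ) =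
      finSigmaFinEquiv (n := fun j => k (Fin.castSucc j)) ⟨j, b⟩ := by
  rw [finSigmaFinEquiv_apply, finSigmaFinEquiv_apply]
  rfl

theorem prod_ofFn_tprod {r : ℕ} (k : Fin r → ℕ) (w : ∀ j, Fin (k j) → V) :
    (List.ofFn fun j => TensorAlgebra.tprod ℂ V (k j) (w j)).prod =
      TensorAlgebra.tprod ℂ V (∑ j, k j)
        (fun i => w (finSigmaFinEquiv.symm i).1 (finSigmaFinEquiv.symm i).2) := by
  induction r with
  | zero =>
    rw [List.ofFn_zero, List.prod_nil, TensorAlgebra.tprod_apply]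
    have h0 : ∑ j, k j = 0 := by simp
    rw [List.ofFn_congr h0, List.ofFn_zero, List.prod_nil]
  | succ r ih =>
    -- The last word is split off, not the first, because this leaves the offsets of all other
    -- blocks unchanged.
    rw [List.ofFn_succ', List.concat_eq_append, List.prod_append, ih, List.prod_singleton,
      tprod_mul_tprod]
    refine tprod_congr (Fin.sum_univ_castSucc k).symm _ _ fun i => ?_
    generalize hx : finSigmaFinEquiv.symm (Fin.cast (Fin.sum_univ_castSucc k).symm i) = x
    rw [Equiv.symm_apply_eq] at hx
    obtain ⟨j, b⟩ := x
    induction j using Fin.lastCases with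
    | last =>
      have : i = Fin.natAdd _ b := by
        have := congrArg Fin.val hx
        rw [finSigmaFinEquiv_apply] at this
        exact Fin.ext this
      subst this
      rw [Fin.append_right]
    | cast j =>
      have : i = Fin.castAdd _ (finSigmaFinEquiv ⟨j, b⟩) := by
        have := congrArg Fin.val hx
        rw [finSigmaFinEquiv_castSucc] at this
        exact Fin.ext this
      subst this
      rw [Fin.append_left, Equiv.symm_apply_apply]

theorem concat_tprod_words {r : ℕ} (k : Fin r → ℕ) (w : ∀ j, Fin (k j) → V) :
    concat k (PiTensorProduct.tprod ℂ fun j => TensorAlgebra.tprod ℂ V (k j) (w j)) =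
      PiTensorProduct.tprod ℂ
        (fun i => w (finSigmaFinEquiv.symm i).1 (finSigmaFinEquiv.symm i).2) := by
  rw [concat_tprod]
  have : ∀ j, comp (k j) (TensorAlgebra.tprod ℂ V (k j) (w j)) =
      TensorAlgebra.tprod ℂ V (k j) (w j) := fun j => by
    rw [comp, LinearMap.comp_apply, compT_tprod, TensorPower.toTensorAlgebra_tprod]
  simp only [this]
  rw [prod_ofFn_tprod, compT_tprod]

theorem concat_tprod_of_comp_eq_zero {r : ℕ} {k : Fin r → ℕ} {y : Fin r → TensorAlgebra ℂ V}
    {j : Fin r} (h : comp (k j) (y j) = 0) : concat k (PiTensorProduct.tprod ℂ y) = 0 := by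
  rw [concat_tprod, List.prod_eq_zero, map_zero]
  exact List.mem_ofFn.mpr ⟨j, h⟩

end Multilinear

end Superspace

namespace Superspace

/-! ### Superskew forms and contraction along edges. -/

section Contraction

variable {V : Type*} [AddCommGroup V] [Module ℂ V] [Superspace V]

/-- An even bilinear form that is skew-symmetric in the super sense. -/
def IsSuperskew (B : V →ₗ[ℂ] V →ₗ[ℂ] ℂ) : Prop := ∀ v w, B w v = -B (γ v) w

namespace IsSuperskew

variable {B : V →ₗ[ℂ] V →ₗ[ℂ] ℂ} (hB : IsSuperskew B)
include hB

/-- Evenness need not be assumed: for vectors of different parity, exchanging the arguments twice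
produces one factor 1 and one factor -1, so the value equals its own negative. -/
theorem eq_zero {a b : ZMod 2} {v w : V} (hv : v ∈ part V a) (hw : w ∈ part V b) (hab : a ≠ b) :
    B v w = 0 := by
  have h1 := hB w v
  have h2 := hB v w
  rw [mem_part.mp hw, map_smul, LinearMap.smul_apply, smul_eq_mul] at h1
  rw [mem_part.mp hv, map_smul, LinearMap.smul_apply, smul_eq_mul] at h2
  rcases zmod2_cases a with rfl | rfl <;> rcases zmod2_cases b with rfl | rfl
  · exact absurd rfl hab
  · simp only [sg_zero, sg_one] at h1 h2
    linear_combination (h1 + h2) / 2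
  · simp only [sg_zero, sg_one] at h1 h2
    linear_combination (h1 - h2) / 2
  · exact absurd rfl hab

theorem flip {a : ZMod 2} {v w : V} (hv : v ∈ part V a) : B w v = -sg a * B v w := by
  rw [hB v w, mem_part.mp hv, map_smul, LinearMap.smul_apply, smul_eq_mul, neg_mul]

end IsSuperskew

/-- Regards the arguments of `kappa` as `n` blocks of length two, so that `oddInv_block` applies to
permutations and flips of edges. -/
theorem lexMono_finProdFinEquiv (n : ℕ) :
    LexMono ((Equiv.sigmaEquivProd (Fin n) (Fin 2)).trans finProdFinEquiv) where
  fst_lt {j i} a b h := by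
    rw [Fin.lt_def] at h ⊢
    simp only [Equiv.trans_apply, Equiv.sigmaEquivProd_apply, finProdFinEquiv_apply_val]
    omega
  snd_lt {j a b} h := by
    rw [Fin.lt_def] at h ⊢
    simp only [Equiv.trans_apply, Equiv.sigmaEquivProd_apply, finProdFinEquiv_apply_val]
    omega

theorem oddInv_one {n : ℕ} (p : Fin n → ZMod 2) : oddInv (1 : Equiv.Perm (Fin n)) p = 0 := by
  refine Finset.sum_eq_zero fun i _ => Finset.sum_eq_zero fun j _ => if_neg ?_
  rintro ⟨h1, h2⟩
  exact absurd h1 h2.not_gt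

theorem oddInv_zero {a b : ℕ} (σ : Fin a ≃ Fin b) : oddInv σ (fun _ => 0) = 0 := by
  simp [oddInv]

/-- Permuting the pairs of arguments of `κ` and flipping some of them changes the value by the
number of flips. -/
theorem kappa_koszul {B : V →ₗ[ℂ] V →ₗ[ℂ] ℂ} (hB : IsSuperskew B) {n : ℕ}
    (π : Equiv.Perm (Fin n)) (d : Fin n → Equiv.Perm (Fin 2)) (E : Fin (n * 2) ≃ Fin (n * 2))
    (hE : ∀ i b, E (finProdFinEquiv (i, b)) = finProdFinEquiv (π i, d i b)) (t : ⨂[ℂ]^(n * 2) V) :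
    kappa B n (koszul E t) = (∏ i, ((Equiv.Perm.sign (d i) : ℤ) : ℂ)) * kappa B n t := by
  have : kappa B n ∘ₗ koszul E = (∏ i, ((Equiv.Perm.sign (d i) : ℤ) : ℂ)) • kappa B n := by
    refine tensor_ext fun p v hv => ?_
    have hsymm : ∀ i b, E.symm (finProdFinEquiv (π i, b)) = finProdFinEquiv (i, (d i).symm b) :=
      fun i b => by rw [Equiv.symm_apply_eq, hE, Equiv.apply_symm_apply]
    rw [LinearMap.comp_apply, koszul_tprod _ hv, map_smul, kappa_tprod, LinearMap.smul_apply,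
      kappa_tprod, smul_eq_mul, smul_eq_mul, ← Equiv.prod_comp π]
    simp only [hsymm]
    have hd : ∀ i, d i = 1 ∨ d i = Equiv.swap 0 1 := fun i => by
      generalize d i = x
      revert x
      decide
    -- If both letters of every pair have the same parity, each pair is an even block, and permuting
    -- pairs costs no sign. A flip of two letters of parity `a` has Koszul sign `sg a`, while
    -- exchanging the arguments of `B` gives `-sg a`; the product is -1, the sign of the
    -- transposition.
    by_cases hp : ∀ i, p (finProdFinEquiv (i, 0)) = p (finProdFinEquiv (i, 1))
    · rw [oddInv_block (lexMono_finProdFinEquiv n) (lexMono_finProdFinEquiv n) π d E hE]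
      simp only [Equiv.trans_apply, Equiv.sigmaEquivProd_apply, Fin.sum_univ_two, hp,
        CharTwo.add_self_eq_zero]
      rw [oddInv_zero, zero_add, sg_sum, ← Finset.prod_mul_distrib, ← Finset.prod_mul_distrib]
      refine Finset.prod_congr rfl fun i _ => ?_
      rcases hd i with h | h <;> rw [h]
      · simp [oddInv_one]
        rfl
      · rw [hB.flip (hv (finProdFinEquiv (i, (Equiv.swap (0 : Fin 2) 1).symm 1)))]
        have h1 : oddInv (Equiv.swap (0 : Fin 2) 1) (fun a => p (finProdFinEquiv (i, a))) =
            p (finProdFinEquiv (i, 1)) := by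
          have : ∀ x : ZMod 2, x * x = x := by decide
          simp [oddInv, Fin.sum_univ_two, hp, this]
        rw [h1]
        simp [hp, ← mul_assoc, sg_mul_self]
    -- A pair of letters of different parities makes both sides vanish.
    · push Not at hp
      obtain ⟨i, hi⟩ := hp
      rw [Finset.prod_eq_zero (Finset.mem_univ i), Finset.prod_eq_zero (f := fun i =>
        B (v (finProdFinEquiv (i, 0))) (v (finProdFinEquiv (i, 1)))) (Finset.mem_univ i),
        mul_zero, mul_zero]
      · exact hB.eq_zero (hv _) (hv _) hi
      · rcases hd i with h | h <;> rw [h]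
        · exact hB.eq_zero (hv _) (hv _) hi
        · exact hB.eq_zero (hv _) (hv _) (by simpa using hi.symm)
  exact LinearMap.congr_fun this t

end Contraction

/-! ### Permuting vertices and rotating the half-edges at a vertex. -/

section Concatenation

variable {V : Type*} [AddCommGroup V] [Module ℂ V] [Superspace V]
variable {W : Type*} [AddCommGroup W] [Module ℂ W] [Superspace W]

/-- The map that relabels the letters of words of length `a` by `c` and kills all other words. -/
def relabel {a b : ℕ} (c : Fin a ≃ Fin b) : TensorAlgebra ℂ V →ₗ[ℂ] TensorAlgebra ℂ V :=
  TensorPower.toTensorAlgebra ∘ₗ koszul c ∘ₗ compT a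

theorem relabel_tprod {a b : ℕ} (c : Fin a ≃ Fin b) {p : Fin a → ZMod 2} {v : Fin a → V}
    (hv : ∀ i, v i ∈ part V (p i)) : relabel c (TensorAlgebra.tprod ℂ V a v) =
      sg (oddInv c p) • TensorAlgebra.tprod ℂ V b fun i => v (c.symm i) := by
  rw [relabel, LinearMap.comp_apply, LinearMap.comp_apply, compT_tprod, koszul_tprod _ hv,
    map_smul, TensorPower.toTensorAlgebra_tprod]

theorem relabel_tprod_of_ne {n a b : ℕ} (c : Fin a ≃ Fin b) (h : n ≠ a) (v : Fin n → V) :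
    relabel c (TensorAlgebra.tprod ℂ V n v) = 0 := by
  rw [relabel, LinearMap.comp_apply, LinearMap.comp_apply, compT_tprod_of_ne h, map_zero, map_zero]

theorem comp_tprod {a : ℕ} (v : Fin a → V) :
    comp a (TensorAlgebra.tprod ℂ V a v) = TensorAlgebra.tprod ℂ V a v := by
  rw [comp, LinearMap.comp_apply, compT_tprod, TensorPower.toTensorAlgebra_tprod]

theorem comp_tprod_of_ne {n a : ℕ} (h : n ≠ a) (v : Fin n → V) :
    comp a (TensorAlgebra.tprod ℂ V n v) = 0 := by
  rw [comp, LinearMap.comp_apply, compT_tprod_of_ne h, map_zero]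

/-- Permuting and relabelling the blocks corresponds to permuting the letters of the
concatenation. -/
theorem concat_koszul {r r' : ℕ} (k : Fin r → ℕ) (k' : Fin r' → ℕ) (τ : Fin r ≃ Fin r')
    (c : ∀ j, Fin (k j) ≃ Fin (k' (τ j))) (S : Fin (∑ j, k j) ≃ Fin (∑ j, k' j))
    (hS : ∀ j a, S (finSigmaFinEquiv ⟨j, a⟩) = finSigmaFinEquiv ⟨τ j, c j a⟩)
    (x : ⨂[ℂ]^r (TensorAlgebra ℂ V)) :
    concat k' (koszul τ (PiTensorProduct.map (fun j => relabel (c j)) x)) =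
      koszul S (concat k x) := by
  have : concat k' ∘ₗ koszul τ ∘ₗ PiTensorProduct.map (fun j => relabel (V := V) (c j)) =
      koszul S ∘ₗ concat k := by
    refine tensor_words_ext fun n p v hv => ?_
    simp only [LinearMap.comp_apply, PiTensorProduct.map_tprod]
    by_cases hn : ∀ j, n j = k j
    swap
    · push Not at hn
      obtain ⟨j, hj⟩ := hn
      rw [(PiTensorProduct.tprod ℂ).map_coord_zero j (relabel_tprod_of_ne (c j) hj _),
        concat_tprod_of_comp_eq_zero (comp_tprod_of_ne hj _), map_zero, map_zero, map_zero]
    obtain rfl : n = k := funext hn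
    have hsymm : ∀ j a, S.symm (finSigmaFinEquiv ⟨τ j, a⟩) =
        finSigmaFinEquiv ⟨j, (c j).symm a⟩ := fun j a => by
      rw [Equiv.symm_apply_eq, hS, Equiv.apply_symm_apply]
    -- By `oddInv_block` the sign on the right is the sign of permuting whole words, by their total
    -- parities, times the signs of the relabellings inside the words. These are precisely the signs
    -- collected on the left.
    rw [concat_tprod_words, koszul_tprod S (p := fun i =>
        p (finSigmaFinEquiv.symm i).1 (finSigmaFinEquiv.symm i).2) (fun i => hv _ _),
      oddInv_block (lexMono_finSigmaFinEquiv n) (lexMono_finSigmaFinEquiv k') τ c S hS]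
    simp only [relabel_tprod _ (hv _)]
    rw [MultilinearMap.map_smul_univ, map_smul, map_smul, ← sg_sum,
      koszul_tprod τ (p := fun j => ∑ a, p j a), map_smul, smul_smul, ← sg_add,
      add_comm (oddInv τ _)]
    swap
    · intro j
      have := tprod_mem_part (W := V) (p := fun i => p j ((c j).symm i))
        (v := fun i => v j ((c j).symm i)) fun i => hv _ _
      rwa [Equiv.sum_comp (c j).symm] at this
    refine congrArg₂ (· • ·) ?_ ?_
    · have hp : ∀ j a, p (finSigmaFinEquiv.symm (finSigmaFinEquiv ⟨j, a⟩)).1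
          (finSigmaFinEquiv.symm (finSigmaFinEquiv ⟨j, a⟩)).2 = p j a := fun j a => by
        rw [Equiv.symm_apply_apply]
      simp only [hp]
    -- The word arriving at place `j'` comes with length `k' (τ (τ.symm j'))`. Writing `j' = τ j`
    -- turns it into a word of length `k' j'`, with letters read off from the permuted
    -- concatenation.
    have hy : ∀ j', (fun j => TensorAlgebra.tprod ℂ V (k' (τ j)) fun i => v j ((c j).symm i))
        (τ.symm j') = TensorAlgebra.tprod ℂ V (k' j') fun b =>
          v (finSigmaFinEquiv.symm (S.symm (finSigmaFinEquiv ⟨j', b⟩))).1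
            (finSigmaFinEquiv.symm (S.symm (finSigmaFinEquiv ⟨j', b⟩))).2 := by
      intro j'
      obtain ⟨j, rfl⟩ := τ.surjective j'
      rw [Equiv.symm_apply_apply]
      refine congrArg _ (funext fun i => ?_)
      rw [hsymm, Equiv.symm_apply_apply]
    have hy' := congrArg (fun z => concat k' (PiTensorProduct.tprod ℂ z)) (funext hy)
    refine hy'.trans ((concat_tprod_words k' _).trans ?_)
    congr 1
    funext i
    rw [Sigma.eta, Equiv.apply_symm_apply]
  exact LinearMap.congr_fun this x

/-- Since `concat` kills factors of the wrong length, projecting each factor to its prescribed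
length before the permutation loses nothing. This is what lets `relabel`, which includes such a
projection, be inserted or removed. -/
theorem concat_koszul_comp {r r' : ℕ} (k : Fin r → ℕ) (k' : Fin r' → ℕ) (τ : Fin r ≃ Fin r')
    (hk : ∀ j, k' (τ j) = k j) (x : ⨂[ℂ]^r (TensorAlgebra ℂ V)) :
    concat k' (koszul τ (PiTensorProduct.map (fun j => comp (k j)) x)) =
      concat k' (koszul τ x) := by
  have : concat k' ∘ₗ koszul τ ∘ₗ PiTensorProduct.map (fun j => comp (V := V) (k j)) =
      concat k' ∘ₗ koszul τ := by
    refine tensor_words_ext fun n p v hv => ?_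
    have h1 : ∀ j, TensorAlgebra.tprod ℂ V (n j) (v j) ∈ part (TensorAlgebra ℂ V) (∑ a, p j a) :=
      fun j => tprod_mem_part (hv j)
    have h2 : ∀ j, comp (k j) (TensorAlgebra.tprod ℂ V (n j) (v j)) ∈
        part (TensorAlgebra ℂ V) (∑ a, p j a) := fun j => by
      rw [mem_part, ← comp_γ, mem_part.mp (h1 j), map_smul]
    simp only [LinearMap.comp_apply, PiTensorProduct.map_tprod]
    rw [koszul_tprod τ h1, koszul_tprod τ h2, map_smul, map_smul, concat_tprod, concat_tprod]
    congr 4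
    funext j'
    obtain ⟨j, rfl⟩ := τ.surjective j'
    rw [Equiv.symm_apply_apply, hk]
    by_cases hj : n j = k j
    · generalize k j = a at hj
      subst hj
      rw [comp_tprod, comp_tprod]
    · rw [comp_tprod_of_ne hj, map_zero]
  exact LinearMap.congr_fun this x

/-- Left multiplication by `τ` permutes the summands of the norm operator. -/
theorem koszul_normOp {k : ℕ} {τ : Equiv.Perm (Fin k)} (hτ : τ ∈ Subgroup.zpowers (finRotate k))
    (t : ⨂[ℂ]^k V) : koszul τ (normOp k t) = normOp k t := by
  classical
  simp only [normOp, LinearMap.sum_apply, map_sum]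
  refine Finset.sum_bij' (fun σ _ => τ * σ) (fun σ _ => τ⁻¹ * σ) ?_ ?_ ?_ ?_ ?_
  · intro σ hσ
    simpa using mul_mem hτ (Finset.mem_filter.mp hσ).2
  · intro σ hσ
    simpa using mul_mem (inv_mem hτ) (Finset.mem_filter.mp hσ).2
  · intro σ _; simp
  · intro σ _; simp
  · intro σ _
    exact (LinearMap.congr_fun (koszul_trans σ τ) t).symm

theorem finRotate_pow_zero {k : ℕ} (a : Fin (k + 1)) :
    ((finRotate (k + 1)) ^ (a : ℕ)) 0 = a := by
  obtain ⟨a, ha⟩ := a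
  induction a with
  | zero => rfl
  | succ a ih =>
    rw [pow_succ', Equiv.Perm.mul_apply, ih (by omega)]
    exact finRotate_of_lt (by omega)

/-- A permutation commuting with the standard cycle is a power of it. -/
theorem mem_zpowers_finRotate {k : ℕ} (c : Equiv.Perm (Fin k))
    (hc : ∀ a, c (finRotate k a) = finRotate k (c a)) : c ∈ Subgroup.zpowers (finRotate k) := by
  rcases k with _ | k
  · rw [Subsingleton.elim c 1]
    exact one_mem _
  have hcomm : Commute c (finRotate (k + 1)) := Equiv.ext hc
  -- The exponent is `c 0`: every `a` is the rotation by `a` of 0, and `c` commutes with rotations,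
  -- so `c` is determined by its value at 0.
  refine ⟨((c 0 : Fin (k + 1)) : ℕ), Equiv.ext fun a => ?_⟩
  conv_rhs => rw [← finRotate_pow_zero a, ← Equiv.Perm.mul_apply, (hcomm.pow_right _).eq,
    Equiv.Perm.mul_apply, ← finRotate_pow_zero (c 0), ← Equiv.Perm.mul_apply, ← pow_add,
    add_comm (a : ℕ), pow_add, Equiv.Perm.mul_apply, finRotate_pow_zero a]
  exact DFunLike.congr_fun (zpow_natCast _ _) a

/-- The powers of the standard cycle act freely. -/
theorem eq_one_of_mem_zpowers_finRotate {k : ℕ} {σ : Equiv.Perm (Fin (k + 1))}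
    (hσ : σ ∈ Subgroup.zpowers (finRotate (k + 1))) (h : σ (Fin.last k) = Fin.last k) : σ = 1 := by
  obtain ⟨z, rfl⟩ := hσ
  have hcomm : Commute (finRotate (k + 1) ^ z) (finRotate (k + 1)) := Commute.zpow_left rfl z
  -- Rotation sends the last place to 0, so a power fixing the last place also fixes 0, and hence
  -- everything.
  have h0 : (finRotate (k + 1) ^ z) 0 = 0 := by
    rw [← finRotate_last, ← Equiv.Perm.mul_apply, hcomm.eq, Equiv.Perm.mul_apply, h]
  refine Equiv.ext fun a => ?_
  rw [← finRotate_pow_zero a, ← Equiv.Perm.mul_apply, (hcomm.pow_right _).eq, Equiv.Perm.mul_apply,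
    h0, Equiv.Perm.one_apply]

/-- A bijection that intertwines the standard rotations is itself a power of the rotation, and norms
are invariant under those. This is why only the cyclic order at a vertex matters. -/
theorem relabel_norm {a b : ℕ} (c : Fin a ≃ Fin b)
    (hc : ∀ i, c (finRotate a i) = finRotate b (c i)) (x : Ham V) :
    relabel c (Ham.norm x) = comp a (Ham.norm x) := by
  obtain rfl : a = b := Fin.equiv_iff_eq.mp ⟨c⟩
  have : relabel c ∘ₗ Ham.norm = comp a ∘ₗ (Ham.norm : Ham V →ₗ[ℂ] _) := Ham.ext fun k t => by
    simp only [LinearMap.comp_apply, Ham.norm, Ham.lift_of, Cyc.norm_mk, relabel, comp]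
    by_cases hk : k.1 = a
    · obtain ⟨k, hk3⟩ := k
      subst hk
      rw [compT_toTensorAlgebra, koszul_normOp (mem_zpowers_finRotate c hc)]
    · rw [compT_toTensorAlgebra_of_ne hk, map_zero]
  exact LinearMap.congr_fun this x

end Concatenation

end Superspace

namespace Superspace

/-! ### Comparison of the amplitudes of two fully ordered graphs. -/

section Feynman

variable {V : Type*} [AddCommGroup V] [Module ℂ V] [Superspace V]

/-- Left multiplication by `τ` reindexes the antisymmetrizer and multiplies every coefficient by the
sign of `τ`. -/
theorem koszul_antisymNorm {i : ℕ} (τ : Equiv.Perm (Fin i)) (x : ⨂[ℂ]^i (Ham V)) :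
    koszul τ (antisymNorm i x) = ((Equiv.Perm.sign τ : ℤ) : ℂ) • antisymNorm i x := by
  simp only [antisymNorm, LinearMap.comp_apply, LinearMap.sum_apply, LinearMap.smul_apply, map_sum,
    map_smul, Finset.smul_sum]
  refine Fintype.sum_equiv (Equiv.mulLeft τ) _ _ fun σ => ?_
  rw [← LinearMap.comp_apply (koszul τ), ← koszul_trans, smul_smul]
  congr 1
  rw [Equiv.coe_mulLeft, Equiv.Perm.sign_mul]
  push_cast
  rw [← mul_assoc]
  have : ((Equiv.Perm.sign τ : ℤ) : ℂ) * ((Equiv.Perm.sign τ : ℤ) : ℂ) = 1 := by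
    rcases Int.units_eq_one_or (Equiv.Perm.sign τ) with h | h <;> simp [h]
  rw [this, one_mul]

/-- Permutations commute with applying the norm to each factor, so the norm can be applied last. The
output is thus built from norms in every factor, as needed to use `relabel_norm` factor by factor.
-/
theorem antisymNorm_mem_range {i : ℕ} (x : ⨂[ℂ]^i (Ham V)) :
    ∃ y, antisymNorm i x = PiTensorProduct.map (fun _ => Ham.norm) y := by
  refine ⟨∑ σ : Equiv.Perm (Fin i), ((Equiv.Perm.sign σ : ℤ) : ℂ) • koszul σ x, ?_⟩
  simp only [antisymNorm, LinearMap.comp_apply, LinearMap.sum_apply, LinearMap.smul_apply, map_sum,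
    map_smul]
  refine Finset.sum_congr rfl fun σ _ => ?_
  congr 1
  exact (LinearMap.congr_fun (map_koszul σ _ Ham.norm_γ) x).symm

/-- The Feynman amplitudes of two fully ordered graphs that differ by a permutation `τ` of the
vertices, cyclic permutations `c` at the vertices, a permutation `π` of the edges and flips `d` of
edges. -/
theorem OrderedGraph.feynman_eq {B : V →ₗ[ℂ] V →ₗ[ℂ] ℂ} (hB : IsSuperskew B) (G G' : OrderedGraph)
    (s : ((j : Fin G.r) × Fin (G.val j)) ≃ ((j : Fin G'.r) × Fin (G'.val j))) (τ : Fin G.r ≃ Fin G'.r)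
    (c : ∀ j, Fin (G.val j) ≃ Fin (G'.val (τ j))) (hs : ∀ j a, s ⟨j, a⟩ = ⟨τ j, c j a⟩)
    (hc : ∀ j a, c j (finRotate _ a) = finRotate _ (c j a))
    (π : Fin G.n ≃ Fin G'.n) (d : Fin G.n → Equiv.Perm (Fin 2))
    (hd : ∀ i b, s (G.chord (i, b)) = G'.chord (π i, d i b)) (x : Chains B) :
    G'.feynman B x = ((RibbonGraph.finSign τ : ℤ) : ℂ) * (∏ i, ((Equiv.Perm.sign (d i) : ℤ) : ℂ)) *
      G.feynman B x := by
  obtain ⟨r, k, n, chord⟩ := G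
  obtain ⟨r', k', n', chord'⟩ := G'
  dsimp only at *
  obtain rfl : r = r' := Fin.equiv_iff_eq.mp ⟨τ⟩
  obtain rfl : n = n' := Fin.equiv_iff_eq.mp ⟨π⟩
  have hsign : RibbonGraph.finSign τ = Equiv.Perm.sign τ := rfl
  obtain ⟨X, hX⟩ := Submodule.mkQ_surjective _ (x r n : RelChains B r)
  have hval : ∀ (k : Fin r → ℕ) (chord : Fin n × Fin 2 ≃ (j : Fin r) × Fin (k j)),
      OrderedGraph.feynman B ⟨r, k, n, chord⟩ x =
        kappa B n (koszul (OrderedGraph.perm ⟨r, k, n, chord⟩) (concat k (antisymNorm r X))) :=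
    fun k chord => by
      change OrderedGraph.feynmanAt B ⟨r, k, n, chord⟩ (x r n) = _
      rw [← hX]
      rfl
  rw [hval, hval, hsign]
  have hk : ∀ j, k' (τ j) = k j := fun j => (Fin.equiv_iff_eq.mp ⟨c j⟩).symm
  -- `S` is the permutation of all letters, numbered vertex by vertex, induced by the identification
  -- `s` of half-edges.
  let S : Fin (∑ j, k j) ≃ Fin (∑ j, k' j) := finSigmaFinEquiv.symm.trans (s.trans finSigmaFinEquiv)
  have hS : ∀ j a, S (finSigmaFinEquiv ⟨j, a⟩) = finSigmaFinEquiv ⟨τ j, c j a⟩ := fun j a => by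
    simp [S, hs]
  -- Permuting the letters by `S` has the same effect as permuting the vertices by `τ` alone,
  -- because the rotations `c` are absorbed by the norms.
  have hcat : concat k' (koszul τ (antisymNorm r X)) = koszul S (concat k (antisymNorm r X)) := by
    obtain ⟨Y, hY⟩ := antisymNorm_mem_range X
    rw [hY, ← concat_koszul k k' τ c S hS, ← concat_koszul_comp k k' τ hk, ← LinearMap.comp_apply
      (PiTensorProduct.map fun j => comp (k j)), ← LinearMap.comp_apply
      (PiTensorProduct.map fun j => relabel (c j)), ← PiTensorProduct.map_comp,
      ← PiTensorProduct.map_comp]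
    congr 4
    funext j
    exact LinearMap.ext fun y => (relabel_norm (c j) (hc j) y).symm
  -- `E` is the same identification of half-edges, numbered edge by edge; there it only permutes
  -- pairs and flips some of them.
  let E : Fin (n * 2) ≃ Fin (n * 2) := (OrderedGraph.perm ⟨r, k, n, chord⟩).symm.trans
    (S.trans (OrderedGraph.perm ⟨r, k', n, chord'⟩))
  have hE : ∀ i b, E (finProdFinEquiv (i, b)) = finProdFinEquiv (π i, d i b) := fun i b => by
    simp [E, S, OrderedGraph.perm, hd]
  have h1 := kappa_koszul hB π d E hE
    (koszul (OrderedGraph.perm ⟨r, k, n, chord⟩) (concat k (antisymNorm r X)))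
  rw [← LinearMap.comp_apply (koszul E), ← koszul_trans] at h1
  have h2 : (OrderedGraph.perm ⟨r, k, n, chord⟩).trans E =
      S.trans (OrderedGraph.perm ⟨r, k', n, chord'⟩) := by
    ext
    simp [E]
  rw [h2, koszul_trans, LinearMap.comp_apply, ← hcat, koszul_antisymNorm, map_smul, map_smul,
    map_smul, smul_eq_mul] at h1
  rw [mul_assoc, ← h1, ← mul_assoc]
  have : ((Equiv.Perm.sign τ : ℤ) : ℂ) * ((Equiv.Perm.sign τ : ℤ) : ℂ) = 1 := by
    rcases Int.units_eq_one_or (Equiv.Perm.sign τ) with h | h <;> simp [h]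
  rw [this, one_mul]

end Feynman

end Superspace

/-! ### Full orders of a ribbon graph and the sign relating them. -/

namespace RibbonGraph

theorem finSign_trans {a b c : ℕ} (σ : Fin a ≃ Fin b) (τ : Fin b ≃ Fin c) :
    finSign (σ.trans τ) = finSign σ * finSign τ := by
  obtain rfl := Fin.equiv_iff_eq.mp ⟨σ⟩
  obtain rfl := Fin.equiv_iff_eq.mp ⟨τ⟩
  exact (Equiv.Perm.sign_trans σ τ).trans (mul_comm _ _)

theorem finSign_refl (a : ℕ) : finSign (Equiv.refl (Fin a)) = 1 := Equiv.Perm.sign_refl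

/-- An equivalence of sigma types over an equivalence of the bases is given by equivalences of the
fibres. -/
theorem exists_fibre_equiv {α β : Type*} {k : α → Type*} {k' : β → Type*}
    (s : ((j : α) × k j) ≃ ((j : β) × k' j)) (τ : α ≃ β) (h : ∀ x, (s x).1 = τ x.1) :
    ∃ c : ∀ j, k j ≃ k' (τ j), ∀ j a, s ⟨j, a⟩ = ⟨τ j, c j a⟩ := by
  have h1 : ∀ j a, ∃ b : k' (τ j), s ⟨j, a⟩ = ⟨τ j, b⟩ := fun j a => by
    have := h ⟨j, a⟩
    generalize s ⟨j, a⟩ = y at this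
    obtain ⟨i, b⟩ := y
    dsimp only at this
    subst this
    exact ⟨b, rfl⟩
  choose f hf using h1
  have hbij : ∀ j, Function.Bijective (f j) := by
    refine fun j => ⟨fun a a' haa' => ?_, fun b => ?_⟩
    · have : s ⟨j, a⟩ = s ⟨j, a'⟩ := by rw [hf, hf, haa']
      simpa using s.injective this
    · obtain ⟨⟨i, a⟩, hi⟩ := s.surjective ⟨τ j, b⟩
      have hij : τ i = τ j := by
        rw [← h ⟨i, a⟩, hi]
      obtain rfl := τ.injective hij
      refine ⟨a, ?_⟩
      rw [hf] at hi
      simpa using hi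
  exact ⟨fun j => Equiv.ofBijective _ (hbij j), hf⟩

variable {Γ : RibbonGraph}

namespace FullOrder

/-- The half-edges as ends of the edges. -/
def ends (ρ : FullOrder Γ) : Fin ρ.n × Fin 2 ≃ Γ.H := ρ.chord.trans ρ.half

theorem inv_ends (ρ : FullOrder Γ) (i : Fin ρ.n) (b : Fin 2) :
    Γ.inv (ρ.ends (i, b)) = ρ.ends (i, Equiv.swap 0 1 b) := by
  have h0 : Γ.inv (ρ.ends (i, 0)) = ρ.ends (i, 1) := ρ.inv_half i
  have h1 : Γ.inv (ρ.ends (i, 1)) = ρ.ends (i, 0) := by rw [← h0, Γ.inv_inv]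
  fin_cases b
  · simpa using h0
  · simpa using h1

theorem ends_mem_tails (ρ : FullOrder Γ) (x : Fin ρ.n × Fin 2) : ρ.ends x ∈ ρ.tails ↔ x.2 = 0 := by
  rw [tails, Finset.mem_image]
  constructor
  · rintro ⟨i, _, hi⟩
    have : (i, (0 : Fin 2)) = x := ρ.ends.injective hi
    rw [← this]
  · intro hx
    exact ⟨x.1, Finset.mem_univ _, by rw [← hx]; rfl⟩

theorem inv_mem_tails (ρ : FullOrder Γ) (h : Γ.H) : Γ.inv h ∈ ρ.tails ↔ h ∉ ρ.tails := by
  obtain ⟨⟨i, b⟩, rfl⟩ := ρ.ends.surjective h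
  rw [inv_ends, ends_mem_tails, ends_mem_tails]
  fin_cases b <;> simp

/-- The edges of two full orders correspond up to flips. -/
theorem exists_edge_equiv (ρ ρ' : FullOrder Γ) :
    ∃ (π : Fin ρ.n ≃ Fin ρ'.n) (d : Fin ρ.n → Equiv.Perm (Fin 2)),
      (∀ i b, ρ.ends (i, b) = ρ'.ends (π i, d i b)) ∧
        ∏ i, Equiv.Perm.sign (d i) = (-1) ^ (ρ.tails \ ρ'.tails).card := by
  let e := ρ.ends.trans ρ'.ends.symm
  -- Exchanging the two ends of an edge is `Γ.inv` in both full orders, so `e` commutes with it and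
  -- is determined by the images of the initial ends.
  have hflip : ∀ i b, e (i, Equiv.swap 0 1 b) = ((e (i, b)).1, Equiv.swap 0 1 (e (i, b)).2) := by
    intro i b
    change ρ'.ends.symm _ = _
    rw [Equiv.symm_apply_eq, ← inv_ends, ← inv_ends, Prod.mk.eta]
    simp [e]
  let d : Fin ρ.n → Equiv.Perm (Fin 2) := fun i => if (e (i, 0)).2 = 0 then 1 else Equiv.swap 0 1
  have he : ∀ i b, e (i, b) = ((e (i, 0)).1, d i b) := by
    intro i b
    have h1 := hflip i 0
    rw [Equiv.swap_apply_left] at h1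
    have h2 : (e (i, 0)).2 = 0 ∨ (e (i, 0)).2 = 1 := by omega
    fin_cases b
    · rcases h2 with h2 | h2 <;> ext <;> simp [d, h2]
    · change e (i, 1) = _
      rw [h1]
      rcases h2 with h2 | h2 <;> simp [d, h2]
  have hbij : Function.Bijective fun i => (e (i, 0)).1 := by
    refine ⟨fun i j hij => ?_, fun i' => ?_⟩
    · dsimp only at hij
      have : e (i, (d i).symm 0) = e (j, (d j).symm 0) := by
        rw [he i, he j, hij, Equiv.apply_symm_apply, Equiv.apply_symm_apply]
      exact congrArg Prod.fst (e.injective this)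
    · obtain ⟨⟨i, b⟩, hi⟩ := e.surjective (i', 0)
      refine ⟨i, ?_⟩
      rw [he] at hi
      exact congrArg Prod.fst hi
  refine ⟨Equiv.ofBijective _ hbij, d, fun i b => ?_, ?_⟩
  · rw [Equiv.ofBijective_apply, ← he]
    simp [e]
  · have h1 : ∀ i, Equiv.Perm.sign (d i) = if (e (i, 0)).2 ≠ 0 then -1 else 1 := by
      intro i
      by_cases h : (e (i, 0)).2 = 0 <;> simp [d, h]
    -- The tails of `ρ` that are not tails of `ρ'` are the initial ends of the flipped edges, one
    -- for each.
    have h2 : ρ.tails \ ρ'.tails =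
        (Finset.univ.filter fun i => (e (i, 0)).2 ≠ 0).image fun i => ρ.ends (i, 0) := by
      ext h
      obtain ⟨⟨i, b⟩, rfl⟩ := ρ.ends.surjective h
      have h3 : ρ.ends (i, b) = ρ'.ends (e (i, b)) := by simp [e]
      rw [Finset.mem_sdiff, ends_mem_tails, h3, ends_mem_tails]
      simp only [Finset.mem_image, Finset.mem_filter, Finset.mem_univ, true_and, ← h3,
        EmbeddingLike.apply_eq_iff_eq, Prod.mk.injEq]
      constructor
      · rintro ⟨rfl, h⟩
        exact ⟨i, h, rfl, rfl⟩
      · rintro ⟨j, h, rfl, rfl⟩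
        exact ⟨rfl, h⟩
    rw [Finset.prod_congr rfl fun i _ => h1 i, h2, Finset.card_image_of_injective _ fun i j h => by
      simpa using h, Finset.prod_ite, Finset.prod_const, Finset.prod_const_one, mul_one]

/-- Amplitudes of different full orders of a ribbon graph agree up to the sign relating the full
orders. -/
theorem feynman_eq {V : Type*} [AddCommGroup V] [Module ℂ V] [Superspace V]
    {B : V →ₗ[ℂ] V →ₗ[ℂ] ℂ} (hB : Superspace.IsSuperskew B) (ρ ρ' : FullOrder Γ)
    (x : Superspace.Chains B) :
    ρ'.feynman B x = ((ρ.relSign ρ' : ℤ) : ℂ) * ρ.feynman B x := by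
  let s := ρ.half.trans ρ'.half.symm
  let τ := ρ.vertex.trans ρ'.vertex.symm
  have hs : ∀ y, ρ'.half (s y) = ρ.half y := fun y => by simp [s]
  have hτ : ∀ y, (s y).1 = τ y.1 := fun y => by
    change _ = ρ'.vertex.symm _
    rw [Equiv.eq_symm_apply, ← ρ'.vertexOf_half, hs, ρ.vertexOf_half]
  obtain ⟨c, hc⟩ := exists_fibre_equiv s τ hτ
  obtain ⟨π, d, hd, hsign⟩ := ρ.exists_edge_equiv ρ'
  -- Both full orders induce the cyclic orders of `Γ.rot`, so the comparison of positions at a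
  -- vertex commutes with rotation.
  have hrot : ∀ j a, c j (finRotate _ a) = finRotate _ (c j a) := by
    intro j a
    have h1 : ρ'.half (s ⟨j, finRotate _ a⟩) = ρ'.half ⟨τ j, finRotate _ (c j a)⟩ := by
      rw [hs, ← ρ.rot_half, ← hs, hc, ρ'.rot_half]
    rw [hc] at h1
    simpa using ρ'.half.injective h1
  have hchord : ∀ i b, s (ρ.chord (i, b)) = ρ'.chord (π i, d i b) := fun i b => by
    apply ρ'.half.injective
    rw [hs]
    exact hd i b
  rw [Superspace.OrderedGraph.feynman_eq hB ρ.toOrderedGraph ρ'.toOrderedGraph s τ c hc hrot π d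
    hchord x, relSign, ← hsign]
  push_cast
  rfl

theorem relSign_self (ρ : FullOrder Γ) : ρ.relSign ρ = 1 := by
  rw [relSign, Equiv.self_trans_symm, finSign_refl, Finset.sdiff_self, Finset.card_empty, pow_zero,
    one_mul]

/-- The two half-edges of an edge together contribute 1 exactly when the two full orders orient that
edge differently, and disagreement is additive modulo 2. -/
theorem card_sdiff_tails (ρ₁ ρ₂ ρ₃ : FullOrder Γ) :
    ((ρ₁.tails \ ρ₃.tails).card : ZMod 2) =
      (ρ₁.tails \ ρ₂.tails).card + (ρ₂.tails \ ρ₃.tails).card := by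
  have hcard : ∀ ρ ρ' : FullOrder Γ, ((ρ.tails \ ρ'.tails).card : ZMod 2) =
      ∑ h, if h ∈ ρ.tails ∧ h ∉ ρ'.tails then 1 else 0 := fun ρ ρ' => by
    rw [Finset.sum_boole]
    congr 2
    ext h
    simp
  rw [hcard, hcard, hcard, ← sub_eq_zero, ← Finset.sum_add_distrib, ← Finset.sum_sub_distrib]
  -- The contributions of a half-edge and its partner cancel modulo 2, since passing to the partner
  -- complements all three memberships.
  refine Finset.sum_involution (fun h _ => Γ.inv h) ?_ (fun h _ _ => Γ.inv_ne h)
    (fun _ _ => Finset.mem_univ _) (fun h _ => Γ.inv_inv h)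
  intro h _
  simp only [inv_mem_tails]
  by_cases h1 : h ∈ ρ₁.tails <;> by_cases h2 : h ∈ ρ₂.tails <;> by_cases h3 : h ∈ ρ₃.tails <;>
    simp [h1, h2, h3] <;> decide

/-- The cocycle property: vertex permutations compose and the parities of flips add. It makes the
sign by which an isomorphism acts independent of the full order used to measure it. -/
theorem relSign_mul (ρ₁ ρ₂ ρ₃ : FullOrder Γ) :
    ρ₁.relSign ρ₂ * ρ₂.relSign ρ₃ = ρ₁.relSign ρ₃ := by
  have h1 : ρ₁.vertex.trans ρ₃.vertex.symm =
      (ρ₁.vertex.trans ρ₂.vertex.symm).trans (ρ₂.vertex.trans ρ₃.vertex.symm) := by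
    ext
    simp
  have h2 : ((-1 : ℤˣ)) ^ (ρ₁.tails \ ρ₃.tails).card =
      (-1) ^ (ρ₁.tails \ ρ₂.tails).card * (-1) ^ (ρ₂.tails \ ρ₃.tails).card := by
    rw [← pow_add]
    have := card_sdiff_tails ρ₁ ρ₂ ρ₃
    rw [← Nat.cast_add, ZMod.natCast_eq_natCast_iff] at this
    exact pow_eq_pow_of_modEq this (by decide)
  rw [relSign, relSign, relSign, h1, finSign_trans, h2]
  exact mul_mul_mul_comm _ _ _ _

end FullOrder

/-! ### Isomorphisms and their action on full orders. -/

variable {Γ' Γ'' : RibbonGraph}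

namespace Iso

/-- The identity isomorphism. -/
def refl (Γ : RibbonGraph) : Iso Γ Γ := ⟨Equiv.refl _, fun _ => rfl, fun _ => rfl⟩

/-- The inverse isomorphism. -/
def symm (f : Iso Γ Γ') : Iso Γ' Γ where
  toEquiv := f.toEquiv.symm
  map_rot h := by rw [Equiv.symm_apply_eq, f.map_rot, Equiv.apply_symm_apply]
  map_inv h := by rw [Equiv.symm_apply_eq, f.map_inv, Equiv.apply_symm_apply]

/-- The composition of isomorphisms. -/
def trans (f : Iso Γ Γ') (g : Iso Γ' Γ'') : Iso Γ Γ'' where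
  toEquiv := f.toEquiv.trans g.toEquiv
  map_rot h := by simp [f.map_rot, g.map_rot]
  map_inv h := by simp [f.map_inv, g.map_inv]

theorem toEquiv_injective : Function.Injective (toEquiv : Iso Γ Γ' → _) := by
  rintro ⟨f, _, _⟩ ⟨g, _, _⟩ h
  obtain rfl : f = g := h
  rfl

/-- Ensures that `Nat.card` of an automorphism group is a genuine count and not the default value 0
of infinite types. -/
instance : Finite (Iso Γ Γ') := Finite.of_injective _ toEquiv_injective

end Iso

namespace FullOrder

theorem map_refl (ρ : FullOrder Γ) : ρ.map (Iso.refl Γ) = ρ := by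
  have h : (Iso.refl Γ).vertexEquiv = Equiv.refl _ := by
    ext v
    induction v using Quotient.ind
    rfl
  have h' : (Iso.refl Γ).toEquiv = Equiv.refl _ := rfl
  simp [map, h, h']

theorem map_map (ρ : FullOrder Γ) (f : Iso Γ Γ') (g : Iso Γ' Γ'') :
    (ρ.map f).map g = ρ.map (f.trans g) := by
  have h : f.vertexEquiv.trans g.vertexEquiv = (f.trans g).vertexEquiv := by
    ext v
    induction v using Quotient.ind
    rfl
  have h' : (f.trans g).toEquiv = f.toEquiv.trans g.toEquiv := rfl
  simp [map, ← h, h', Equiv.trans_assoc]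

theorem tails_map (ρ : FullOrder Γ) (f : Iso Γ Γ') :
    (ρ.map f).tails = ρ.tails.image f.toEquiv := by
  rw [tails, tails, Finset.image_image]
  rfl

theorem relSign_map (ρ ρ' : FullOrder Γ) (f : Iso Γ Γ') :
    (ρ.map f).relSign (ρ'.map f) = ρ.relSign ρ' := by
  have h : (ρ.map f).vertex.trans (ρ'.map f).vertex.symm = ρ.vertex.trans ρ'.vertex.symm := by
    change (ρ.vertex.trans f.vertexEquiv).trans (ρ'.vertex.trans f.vertexEquiv).symm = _
    ext
    simp
  rw [relSign, relSign, h, tails_map, tails_map, ← Finset.image_sdiff _ _ f.toEquiv.injective,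
    Finset.card_image_of_injective _ f.toEquiv.injective]
  rfl

end FullOrder

/-- If the sign were 1, then `ρ'` would lie in both orientations, and an orientation is determined
by any of its members. -/
theorem Orientation.relSign_of_ne {o o' : Γ.Orientation} (h : o ≠ o') {ρ ρ' : FullOrder Γ}
    (hρ : ρ ∈ o.carrier) (hρ' : ρ' ∈ o'.carrier) : ρ.relSign ρ' = -1 := by
  refine (Int.units_eq_one_or _).resolve_left fun h1 => h ?_
  have h2 := (o.mem_iff ρ hρ ρ').mpr h1
  ext σ
  rw [o.mem_iff ρ' h2, o'.mem_iff ρ' hρ']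

end RibbonGraph

/-! ### Counting automorphisms; generators of the graph complex. -/

namespace OrientedRibbonGraph

open RibbonGraph

/-- A choice of a full order representing an oriented ribbon graph. -/
def order (Γ : OrientedRibbonGraph) : FullOrder Γ.graph := Γ.orientation.nonempty.some

theorem order_mem (Γ : OrientedRibbonGraph) : Γ.order ∈ Γ.orientation.carrier :=
  Γ.orientation.nonempty.some_mem

/-- The sign by which `f` acts on full orders does not depend on the full order: in passing from
`ρ'` to `ρ`, then to `ρ.map f`, then to `ρ'.map f`, the first and third signs are equal and cancel.
In particular `ρ` need not belong to the orientation. -/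
theorem preserves_iff (Γ : OrientedRibbonGraph) (f : RibbonGraph.Iso Γ.graph Γ.graph)
    (ρ : FullOrder Γ.graph) :
    (∀ ρ ∈ Γ.orientation.carrier, ρ.map f ∈ Γ.orientation.carrier) ↔ ρ.relSign (ρ.map f) = 1 := by
  have key : ∀ ρ' : FullOrder Γ.graph, ρ'.relSign (ρ'.map f) = ρ.relSign (ρ.map f) := by
    intro ρ'
    rw [← FullOrder.relSign_mul ρ' ρ, ← FullOrder.relSign_mul ρ (ρ.map f) (ρ'.map f),
      FullOrder.relSign_map, mul_left_comm, FullOrder.relSign_mul, FullOrder.relSign_self, mul_one]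
  constructor
  · intro h
    rw [← key Γ.order]
    exact (Γ.orientation.mem_iff _ Γ.order_mem _).mp (h _ Γ.order_mem)
  · intro h ρ' hρ'
    rw [Γ.orientation.mem_iff _ hρ', key, h]

theorem card_aut_eq (Γ : OrientedRibbonGraph) (ρ : FullOrder Γ.graph) :
    Nat.card Γ.Aut = Nat.card {f : RibbonGraph.Iso Γ.graph Γ.graph // ρ.relSign (ρ.map f) = 1} :=
  Nat.card_congr (Equiv.subtypeEquivRight fun f => Γ.preserves_iff f ρ)

theorem card_aut_ne_zero (Γ : OrientedRibbonGraph) : Nat.card Γ.Aut ≠ 0 := by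
  rw [Γ.card_aut_eq Γ.order]
  have : Nonempty {f : RibbonGraph.Iso Γ.graph Γ.graph // Γ.order.relSign (Γ.order.map f) = 1} :=
    ⟨RibbonGraph.Iso.refl _, by rw [FullOrder.map_refl, FullOrder.relSign_self]⟩
  exact Nat.card_pos.ne'

theorem card_aut_congr {Γ Γ' : OrientedRibbonGraph} (f : Iso Γ Γ') :
    Nat.card Γ.Aut = Nat.card Γ'.Aut := by
  rw [Γ.card_aut_eq Γ.order, Γ'.card_aut_eq (Γ.order.map f.1)]
  refine Nat.card_congr (Equiv.subtypeEquiv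
    -- Conjugation by `f`. With the sign on `Γ'` measured on the transported full order, it
    -- preserves the sign condition.
    ⟨fun g => (f.1.symm.trans g).trans f.1, fun g => (f.1.trans g).trans f.1.symm, fun g => ?_,
      fun g => ?_⟩ fun g => ?_)
  · exact RibbonGraph.Iso.toEquiv_injective
      (Equiv.ext fun h => by simp [RibbonGraph.Iso.trans, RibbonGraph.Iso.symm])
  · exact RibbonGraph.Iso.toEquiv_injective
      (Equiv.ext fun h => by simp [RibbonGraph.Iso.trans, RibbonGraph.Iso.symm])
  · have : f.1.trans ((f.1.symm.trans g).trans f.1) = g.trans f.1 :=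
      RibbonGraph.Iso.toEquiv_injective
        (Equiv.ext fun h => by simp [RibbonGraph.Iso.trans, RibbonGraph.Iso.symm])
    rw [Equiv.coe_fn_mk, FullOrder.map_map, this, ← FullOrder.map_map, FullOrder.relSign_map]

/-- One full order computes both counts, because `card_aut_eq` accepts full orders outside the
orientation. -/
theorem card_aut_orientation (Γ : RibbonGraph) (o o' : Γ.Orientation) :
    Nat.card (Aut ⟨Γ, o⟩) = Nat.card (Aut ⟨Γ, o'⟩) := by
  rw [card_aut_eq ⟨Γ, o⟩ (order ⟨Γ, o⟩), card_aut_eq ⟨Γ, o'⟩ (order ⟨Γ, o⟩)]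

theorem span_cls : Submodule.span ℂ (Set.range cls) = ⊤ := by
  rw [eq_top_iff]
  rintro x -
  obtain ⟨y, rfl⟩ := Submodule.mkQ_surjective _ x
  induction y using Finsupp.induction_linear with
  | zero => simp
  | add y z hy hz =>
    rw [map_add]
    exact Submodule.add_mem _ hy hz
  | single Γ c =>
    have : (Finsupp.single Γ c : OrientedRibbonGraph →₀ ℂ) = c • Finsupp.single Γ 1 := by simp
    rw [this, map_smul]
    exact Submodule.smul_mem _ _ (Submodule.subset_span ⟨Γ, rfl⟩)

end OrientedRibbonGraph

theorem GraphComplex.hom_ext {E : Type*} [AddCommGroup E] [Module ℂ E]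
    {f g : GraphComplex →ₗ[ℂ] E} (h : ∀ Γ : OrientedRibbonGraph, f Γ.cls = g Γ.cls) : f = g :=
  LinearMap.ext_on_range OrientedRibbonGraph.span_cls h

/-! ### The pairing of chains with the graph complex. -/

namespace Superspace

open OrientedRibbonGraph

variable {V : Type*} [AddCommGroup V] [Module ℂ V] [Superspace V]

/-- The normalized amplitude `F_Γ / |Aut Γ|`. -/
def normalizedAmplitude (B : V →ₗ[ℂ] V →ₗ[ℂ] ℂ) (Γ : OrientedRibbonGraph) : Chains B →ₗ[ℂ] ℂ :=
  (Nat.card Γ.Aut : ℂ)⁻¹ • Γ.order.feynman B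

/-- Isomorphic oriented graphs have full orders related by sign 1 after transport, and distinct
orientations have full orders related by sign -1. In both cases the numbers of automorphisms agree,
so the normalization preserves the relation. -/
theorem rel_le_ker {B : V →ₗ[ℂ] V →ₗ[ℂ] ℂ} (hB : IsSuperskew B) :
    rel ≤ LinearMap.ker (Finsupp.linearCombination ℂ (normalizedAmplitude B)) := by
  refine Submodule.span_le.mpr ?_
  rintro _ (⟨Γ, Γ', ⟨f⟩, rfl⟩ | ⟨Γ, o, o', h, rfl⟩)
  · rw [SetLike.mem_coe, LinearMap.mem_ker, map_sub, Finsupp.linearCombination_single,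
      Finsupp.linearCombination_single, one_smul, one_smul, sub_eq_zero]
    ext x
    have h1 := RibbonGraph.FullOrder.feynman_eq hB (Γ.order.map f.1) Γ'.order x
    rw [(Γ'.orientation.mem_iff _ (f.2 _ Γ.order_mem) _).mp Γ'.order_mem] at h1
    rw [normalizedAmplitude, normalizedAmplitude, LinearMap.smul_apply, LinearMap.smul_apply,
      card_aut_congr f, h1]
    -- Transport along an isomorphism keeps the underlying ordered graph, and hence the amplitude.
    simp [RibbonGraph.FullOrder.map]
  · rw [SetLike.mem_coe, LinearMap.mem_ker, map_add, Finsupp.linearCombination_single,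
      Finsupp.linearCombination_single, one_smul, one_smul]
    ext x
    have h1 := RibbonGraph.FullOrder.feynman_eq hB (order ⟨Γ, o⟩) (order ⟨Γ, o'⟩) x
    rw [RibbonGraph.Orientation.relSign_of_ne h (order_mem ⟨Γ, o⟩) (order_mem ⟨Γ, o'⟩)] at h1
    rw [LinearMap.add_apply, normalizedAmplitude, normalizedAmplitude, LinearMap.smul_apply,
      LinearMap.smul_apply, card_aut_orientation Γ o o', h1]
    simp

/-- The pairing of chains with the graph complex is well defined. -/
theorem existsUnique_isPairing {B : V →ₗ[ℂ] V →ₗ[ℂ] ℂ} (hB : IsSuperskew B) :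
    ∃! P, IsPairing B P := by
  refine ⟨(Submodule.liftQ _ _ (rel_le_ker hB)).flip, fun x Γ ρ hρ => ?_, fun P hP => ?_⟩
  · have h1 := RibbonGraph.FullOrder.feynman_eq hB ρ Γ.order x
    rw [(Γ.orientation.mem_iff _ hρ _).mp Γ.order_mem] at h1
    rw [LinearMap.flip_apply, cls, Submodule.mkQ_apply, Submodule.liftQ_apply,
      Finsupp.linearCombination_single, one_smul, normalizedAmplitude, LinearMap.smul_apply, h1,
      div_eq_inv_mul]
    simp
  · refine LinearMap.ext fun x => GraphComplex.hom_ext fun Γ => ?_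
    rw [hP x Γ Γ.order Γ.order_mem, LinearMap.flip_apply, cls, Submodule.mkQ_apply,
      Submodule.liftQ_apply, Finsupp.linearCombination_single, one_smul, normalizedAmplitude,
      LinearMap.smul_apply, div_eq_inv_mul, smul_eq_mul]

end Superspace

namespace Superspace

/-! ### Cyclically invariant functions of words vanish on supercommutators. -/

section CyclicInvariants

variable {W : Type*} [AddCommGroup W] [Module ℂ W] [Superspace W]

/-- The permutation exchanging a block of length `m` and a following block of length `n`. -/
def blockSwap (m n : ℕ) : Equiv.Perm (Fin (m + n)) := finAddFlip.trans (finCongr (add_comm n m))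

theorem blockSwap_castAdd {m n : ℕ} (i : Fin m) :
    ((blockSwap m n (Fin.castAdd n i) : Fin (m + n)) : ℕ) = n + i := by
  simp [blockSwap, add_comm]

theorem blockSwap_natAdd {m n : ℕ} (i : Fin n) :
    ((blockSwap m n (Fin.natAdd m i) : Fin (m + n)) : ℕ) = i := by
  simp [blockSwap]

theorem finRotate_val {N : ℕ} (i : Fin N) :
    ((finRotate N i : Fin N) : ℕ) = if (i : ℕ) + 1 = N then 0 else (i : ℕ) + 1 := by
  rcases N with _ | N
  · exact i.elim0
  · rw [coe_finRotate]
    simp [Fin.ext_iff]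

theorem blockSwap_val {m n : ℕ} (i : Fin (m + n)) :
    ((blockSwap m n i : Fin (m + n)) : ℕ) = if (i : ℕ) < m then n + i else i - m := by
  induction i using Fin.addCases with
  | left i => rw [blockSwap_castAdd]; simp
  | right i => rw [blockSwap_natAdd]; simp

/-- Exchanging the two parts of a word is a rotation, detected here by its commuting with the
standard cycle. -/
theorem blockSwap_mem (m n : ℕ) : blockSwap m n ∈ Subgroup.zpowers (finRotate (m + n)) := by
  refine mem_zpowers_finRotate _ fun a => Fin.ext ?_
  have := a.2
  simp only [finRotate_val, blockSwap_val]
  split_ifs <;> omega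

/-- The inverted pairs are exactly those with one letter in each block, so the Koszul sign of the
exchange is the sign in the supercommutator. -/
theorem oddInv_blockSwap {m n : ℕ} (p : Fin m → ZMod 2) (q : Fin n → ZMod 2) :
    oddInv (blockSwap m n) (Fin.append p q) = (∑ i, p i) * ∑ i, q i := by
  rw [oddInv, Fin.sum_univ_add]
  simp only [Fin.sum_univ_add, Fin.append_left, Fin.append_right, Fin.lt_def, blockSwap_castAdd,
    blockSwap_natAdd, Fin.val_castAdd, Fin.val_natAdd]
  have h1 : ∀ i j : Fin m, ¬((i : ℕ) < j ∧ n + (j : ℕ) < n + i) := fun i j => by omega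
  have h2 : ∀ (i : Fin m) (j : Fin n), (i : ℕ) < m + j ∧ (j : ℕ) < n + i := fun i j => by omega
  have h3 : ∀ (i : Fin n) (j : Fin m), ¬(m + (i : ℕ) < j ∧ n + (j : ℕ) < i) := fun i j => by omega
  have h4 : ∀ i j : Fin n, ¬(m + (i : ℕ) < m + j ∧ (j : ℕ) < i) := fun i j => by omega
  simp only [h1, h2, h3, h4, and_self, if_true, if_false, Finset.sum_const_zero, zero_add, add_zero]
  rw [Finset.sum_mul_sum]

/-- A function of tensors that is invariant under cyclic permutations vanishes on
supercommutators. -/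
theorem commutators_le_ker {N : ℕ} {E : Type*} [AddCommGroup E] [Module ℂ E]
    (F : (⨂[ℂ]^N W) →ₗ[ℂ] E)
    (hF : ∀ σ ∈ Subgroup.zpowers (finRotate N), ∀ t, F (koszul σ t) = F t) :
    commutators W ≤ LinearMap.ker (F ∘ₗ compT N) := by
  refine commutators_le fun m n p q v w hv hw => ?_
  rw [LinearMap.mem_ker, LinearMap.comp_apply, map_sub, map_smul, tprod_mul_tprod, tprod_mul_tprod]
  by_cases hmn : m + n = N
  swap
  · rw [compT_tprod_of_ne hmn, compT_tprod_of_ne (by omega), smul_zero, sub_zero, map_zero]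
  subst hmn
  have h1 : TensorAlgebra.tprod ℂ W (n + m) (Fin.append w v) =
      TensorAlgebra.tprod ℂ W (m + n) fun i => Fin.append v w ((blockSwap m n).symm i) := by
    refine tprod_congr (add_comm n m) _ _ fun i => ?_
    have h2 : Fin.cast (add_comm n m) i = blockSwap m n (finAddFlip i) := by
      ext
      induction i using Fin.addCases with
      | left i => simp [blockSwap]
      | right i => simp [blockSwap]
    rw [h2, Equiv.symm_apply_apply]
    induction i using Fin.addCases with
    | left i => simp
    | right i => simp
  have hvw : ∀ i, Fin.append v w i ∈ part W (Fin.append p q i) := fun i => by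
    induction i using Fin.addCases with
    | left i => simpa using hv i
    | right i => simpa using hw i
  have h3 := hF _ (blockSwap_mem m n) (PiTensorProduct.tprod ℂ (Fin.append v w))
  rw [koszul_tprod _ hvw, oddInv_blockSwap] at h3
  rw [h1, compT_tprod, compT_tprod, map_sub, h3, sub_self]

end CyclicInvariants

/-! ### Appending a vector to a tensor. -/

section Snoc

variable {V : Type*} [AddCommGroup V] [Module ℂ V]
variable {W : Type*} [AddCommGroup W] [Module ℂ W]

/-- The tensor product `t ⊗ v` of a tensor and a vector. -/
def snoc (k : ℕ) : (⨂[ℂ]^k V) →ₗ[ℂ] V →ₗ[ℂ] (⨂[ℂ]^(k + 1) V) :=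
  ((LinearMap.mul ℂ (TensorAlgebra ℂ V)).compl₁₂ TensorPower.toTensorAlgebra
    (TensorAlgebra.ι ℂ)).compr₂ (compT (k + 1))

theorem tprod_mul_ι {k : ℕ} (w : Fin k → V) (v : V) :
    TensorAlgebra.tprod ℂ V k w * TensorAlgebra.ι ℂ v =
      TensorAlgebra.tprod ℂ V (k + 1) (Fin.snoc w v) := by
  have : TensorAlgebra.ι ℂ v = TensorAlgebra.tprod ℂ V 1 fun _ => v := by
    simp [TensorAlgebra.tprod_apply]
  rw [this, tprod_mul_tprod, Fin.append_right_eq_snoc]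

theorem snoc_tprod {k : ℕ} (w : Fin k → V) (v : V) :
    snoc k (PiTensorProduct.tprod ℂ w) v = PiTensorProduct.tprod ℂ (Fin.snoc w v) := by
  change compT (k + 1) (TensorPower.toTensorAlgebra (PiTensorProduct.tprod ℂ w) *
    TensorAlgebra.ι ℂ v) = _
  rw [TensorPower.toTensorAlgebra_tprod, tprod_mul_ι, compT_tprod]

theorem map_snoc {k : ℕ} (f : Fin (k + 1) → V →ₗ[ℂ] W) (t : ⨂[ℂ]^k V) (v : V) :
    PiTensorProduct.map f (snoc k t v) =
      snoc k (PiTensorProduct.map (fun i => f i.castSucc) t) (f (Fin.last k) v) := by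
  have : PiTensorProduct.map f ∘ₗ (snoc k).flip v =
      (snoc k).flip (f (Fin.last k) v) ∘ₗ PiTensorProduct.map (fun i => f (Fin.castSucc i)) := by
    refine PiTensorProduct.ext (MultilinearMap.ext fun w => ?_)
    simp only [LinearMap.compMultilinearMap_apply, LinearMap.comp_apply, LinearMap.flip_apply,
      PiTensorProduct.map_tprod, snoc_tprod]
    congr 1
    funext i
    induction i using Fin.lastCases with
    | last => simp
    | cast i => simp
  exact LinearMap.congr_fun this t

theorem dualDistrib_snoc {k : ℕ} (t : ⨂[ℂ]^k (Module.Dual ℂ V)) (f : Module.Dual ℂ V)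
    (x : Fin (k + 1) → V) :
    PiTensorProduct.dualDistrib (snoc k t f) (PiTensorProduct.tprod ℂ x) =
      PiTensorProduct.dualDistrib t (PiTensorProduct.tprod ℂ (Fin.init x)) * f (x (Fin.last k)) := by
  have : (PiTensorProduct.dualDistrib.flip (PiTensorProduct.tprod ℂ x)) ∘ₗ (snoc k).flip f =
      f (x (Fin.last k)) • PiTensorProduct.dualDistrib.flip (PiTensorProduct.tprod ℂ (Fin.init x)) := by
    refine PiTensorProduct.ext (MultilinearMap.ext fun w => ?_)
    simp only [LinearMap.compMultilinearMap_apply, LinearMap.comp_apply, LinearMap.flip_apply,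
      snoc_tprod, PiTensorProduct.dualDistrib_apply, LinearMap.smul_apply, Fin.prod_univ_castSucc,
      Fin.snoc_castSucc, Fin.snoc_last, smul_eq_mul]
    rw [mul_comm]
    rfl
  have h := LinearMap.congr_fun this t
  simpa [mul_comm] using h

end Snoc

/-! ### The normal form of 1-forms with the differential in last place. -/

section LastDifferential

variable {V : Type*} [AddCommGroup V] [Module ℂ V] [Superspace V]

/-- The coefficients of the words `v₁ ⋯ vₖ dv`. -/
def lastDiff (k : ℕ) : (⨂[ℂ]^(k + 1) (Letters V)) →ₗ[ℂ] (⨂[ℂ]^(k + 1) V) :=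
  PiTensorProduct.map fun i => if i = Fin.last k then Letters.snd else Letters.fst

/-- The coefficients of a 1-form in the normal form `∑ v₁ ⋯ vₖ dv`. -/
def oneFormCoeff (k : ℕ) : DR V →ₗ[ℂ] (⨂[ℂ]^(k + 1) V) :=
  Submodule.liftQ _ ((lastDiff k ∘ₗ normOp (k + 1)) ∘ₗ compT (k + 1))
    (commutators_le_ker _ fun σ hσ t => by
      rw [LinearMap.comp_apply, LinearMap.comp_apply, normOp_koszul hσ])

theorem oneFormCoeff_mk (k : ℕ) (x : Forms V) :
    oneFormCoeff k (DR.mk x) = lastDiff k (normOp (k + 1) (compT (k + 1) x)) := rfl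

/-- Rotations act freely on places, so in the norm only the identity leaves `dv` last. Every other
rotation puts an undifferentiated letter there, which `Letters.snd` kills. -/
theorem oneFormCoeff_mul_dvar {k : ℕ} (t : ⨂[ℂ]^k V) {a : ZMod 2} {v : V} (hv : v ∈ part V a) :
    oneFormCoeff k (DR.mk (zeroForm t * dvar v)) = snoc k t v := by
  classical
  have : oneFormCoeff k ∘ₗ DR.mk ∘ₗ LinearMap.mulRight ℂ (dvar v) ∘ₗ zeroForm =
      (snoc k).flip v := by
    refine tensor_ext fun p w hw => ?_
    change oneFormCoeff k (DR.mk (TensorPower.toTensorAlgebra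
      (PiTensorProduct.map (fun _ => Letters.fn) (PiTensorProduct.tprod ℂ w)) *
        TensorAlgebra.ι ℂ (Letters.df v))) = snoc k (PiTensorProduct.tprod ℂ w) v
    have hfn : ∀ i, Letters.fn (w i) ∈ part (Letters V) (p i) := fun i => by
      rw [mem_part, Letters.γ_def, Letters.fst_fn, Letters.snd_fn, mem_part.mp (hw i)]
      simp
    have hdf : Letters.df v ∈ part (Letters V) (a + 1) := by
      rw [mem_part, Letters.γ_def, Letters.fst_df, Letters.snd_df, mem_part.mp hv]
      simp [sg_add]
    have hu : ∀ i, (Fin.snoc (fun i => Letters.fn (w i)) (Letters.df v) : Fin (k + 1) → Letters V) i ∈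
        part (Letters V) ((Fin.snoc p (a + 1) : Fin (k + 1) → ZMod 2) i) := fun i => by
      induction i using Fin.lastCases with
      | last => simpa using hdf
      | cast i => simpa using hfn i
    rw [PiTensorProduct.map_tprod, TensorPower.toTensorAlgebra_tprod, tprod_mul_ι, oneFormCoeff_mk,
      compT_tprod, snoc_tprod]
    simp only [normOp, LinearMap.sum_apply, map_sum]
    rw [Finset.sum_eq_single 1]
    · have : koszul (1 : Equiv.Perm (Fin (k + 1))) = (LinearMap.id : (⨂[ℂ]^(k + 1) (Letters V)) →ₗ[ℂ] _) :=
        koszul_refl (k + 1)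
      rw [this, LinearMap.id_apply, lastDiff, PiTensorProduct.map_tprod]
      congr 1
      funext i
      induction i using Fin.lastCases with
      | last => simp
      | cast i => simp
    · intro σ hσ hσ1
      have hne : σ.symm (Fin.last k) ≠ Fin.last k := fun h => hσ1
        (eq_one_of_mem_zpowers_finRotate (Finset.mem_filter.mp hσ).2 ((Equiv.symm_apply_eq σ).mp h).symm)
      rw [koszul_tprod _ hu, map_smul, lastDiff, PiTensorProduct.map_tprod,
        (PiTensorProduct.tprod ℂ).map_coord_zero (Fin.last k), smul_zero]
      obtain ⟨i, hi⟩ := Fin.exists_castSucc_eq.mpr hne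
      rw [if_pos rfl, ← hi, Fin.snoc_castSucc, Letters.snd_fn]
    · intro h
      exact absurd (Finset.mem_filter.mpr ⟨Finset.mem_univ _, one_mem _⟩) h
  exact LinearMap.congr_fun this t

theorem dvar_mem_part {a : ZMod 2} {v : V} (hv : v ∈ part V a) :
    dvar v ∈ part (Forms V) (a + 1) := by
  rw [mem_part, γ_dvar, mem_part.mp hv, sg_add]
  simp

/-- Modulo supercommutators `dv`, of parity `a + 1`, moves past a tensor of parity `b` at the cost
of the displayed sign, which reduces to `oneFormCoeff_mul_dvar`. -/
theorem oneFormCoeff_dvar_mul {k : ℕ} {t : ⨂[ℂ]^k V} {a b : ZMod 2} {v : V} (hv : v ∈ part V a)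
    (ht : t ∈ part (⨂[ℂ]^k V) b) :
    oneFormCoeff k (DR.mk (dvar v * zeroForm t)) = sg ((a + 1) * b) • snoc k t v := by
  have hz : zeroForm t ∈ part (Forms V) b := by
    rw [mem_part, γ_zeroForm, mem_part.mp ht, map_smul]
  have h : DR.mk (dvar v * zeroForm t) = sg ((a + 1) * b) • DR.mk (zeroForm t * dvar v) := by
    rw [← map_smul, ← sub_eq_zero, ← map_sub, Submodule.mkQ_apply, Submodule.Quotient.mk_eq_zero]
    exact Submodule.subset_span ⟨_, _, _, _, dvar_mem_part hv, hz, rfl⟩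
  rw [h, map_smul, oneFormCoeff_mul_dvar t hv]

/-- The map `v₁ ⊗ ⋯ ⊗ vₖ ⊗ v ↦ (-1)^{|v₁| + ⋯ + |vₖ|} v₁ ⊗ ⋯ ⊗ vₖ ⊗ v`. -/
def initγ (k : ℕ) : (⨂[ℂ]^(k + 1) V) →ₗ[ℂ] (⨂[ℂ]^(k + 1) V) :=
  PiTensorProduct.map fun i => if i = Fin.last k then LinearMap.id else γ

theorem initγ_initγ {k : ℕ} (t : ⨂[ℂ]^(k + 1) V) : initγ k (initγ k t) = t := by
  rw [initγ, ← LinearMap.comp_apply, ← PiTensorProduct.map_comp]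
  have hγ : (γ : V →ₗ[ℂ] V) ∘ₗ γ = LinearMap.id := LinearMap.ext γ_γ
  have : (fun i : Fin (k + 1) => (if i = Fin.last k then LinearMap.id else (γ : V →ₗ[ℂ] V)) ∘ₗ
      if i = Fin.last k then LinearMap.id else (γ : V →ₗ[ℂ] V)) = fun _ => LinearMap.id := by
    funext i
    split_ifs <;> simp [hγ]
  rw [this, PiTensorProduct.map_id, LinearMap.id_apply]

theorem initγ_snoc {k : ℕ} (t : ⨂[ℂ]^k V) (v : V) : initγ k (snoc k t v) = snoc k (γ t) v := by
  rw [initγ, map_snoc, if_pos rfl, LinearMap.id_apply]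
  congr 2
  have : (fun i : Fin k => if i.castSucc = Fin.last k then LinearMap.id else (γ : V →ₗ[ℂ] V)) =
      fun _ => γ := funext fun i => if_neg (Fin.castSucc_lt_last i).ne
  rw [this]
  rfl

theorem γ_df_fst (w : Letters V) :
    γ ((Letters.df ∘ₗ Letters.fst) w) = sg 1 • (Letters.df ∘ₗ Letters.fst) (γ w) := by
  simp [Letters.γ_def]

/-- Of the Leibniz sum only the term differentiating the last letter survives; its sign, from moving
`d` past the earlier letters, is the one in `initγ`. -/
theorem lastDiff_leib {k : ℕ} (t : ⨂[ℂ]^(k + 1) V) :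
    lastDiff k (leib 1 (Letters.df ∘ₗ Letters.fst) (PiTensorProduct.map (fun _ => Letters.fn) t)) =
      initγ k t := by
  have : lastDiff k ∘ₗ leib 1 (Letters.df ∘ₗ Letters.fst) ∘ₗ
      PiTensorProduct.map (fun _ => Letters.fn) = (initγ k : (⨂[ℂ]^(k + 1) V) →ₗ[ℂ] _) := by
    refine PiTensorProduct.ext (MultilinearMap.ext fun v => ?_)
    simp only [LinearMap.compMultilinearMap_apply, LinearMap.comp_apply, leib, LinearMap.sum_apply,
      PiTensorProduct.map_tprod, map_sum, lastDiff, initγ]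
    rw [Fin.sum_univ_castSucc, Finset.sum_eq_zero, zero_add]
    · congr 1
      funext i
      rcases eq_or_ne i (Fin.last k) with rfl | h
      · simp
      · simp [h, Fin.lt_last_iff_ne_last.mpr h, ZMod.val_one, Letters.γ_def]
    · intro j _
      refine (PiTensorProduct.tprod ℂ).map_coord_zero (Fin.last k) ?_
      have h := Fin.castSucc_lt_last j
      simp [h.not_gt, h.ne']
  exact LinearMap.congr_fun this t

/-- On words without differentials, `d` is the Leibniz action of `v ↦ dv`. This commutes with
rotations, and hence with the norm, so it remains to differentiate the last letter of `N t`. -/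
theorem oneFormCoeff_d {k : ℕ} (t : ⨂[ℂ]^(k + 1) V) :
    oneFormCoeff k (DR.d (DR.mk (zeroForm t))) = initγ k (normOp (k + 1) t) := by
  change oneFormCoeff k (DR.mk (tensorAct 1 (Letters.df ∘ₗ Letters.fst)
    (TensorPower.toTensorAlgebra (PiTensorProduct.map (fun _ => Letters.fn) t)))) = _
  rw [tensorAct_toTensorAlgebra, oneFormCoeff_mk, compT_toTensorAlgebra,
    ← normOp_comm _ (fun σ => (koszul_leib σ 1 _ γ_df_fst).symm),
    ← normOp_comm _ (fun σ => map_koszul σ Letters.fn fun v => by simp [Letters.γ_def]),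
    lastDiff_leib]

end LastDifferential

end Superspace

namespace Superspace

/-! ### Contraction and `Υ` on a product of two differentials. -/

section Contractions

variable {V : Type*} [AddCommGroup V] [Module ℂ V] [Superspace V]

/-- An odd vector field has only its component `ε = 1`, and contraction with it has parity `1 + 1 =
0`. So it passes `dv` without a sign. -/
theorem contr_dvar_mul_dvar {k : ℕ} {ξ : V →ₗ[ℂ] (⨂[ℂ]^k V)} (hξ : ∀ v, γ (ξ v) = -ξ (γ v))
    (v w : V) : DR.contr ξ (DR.mk (dvar v * dvar w)) =
      DR.mk (zeroForm (ξ v) * dvar w + dvar v * zeroForm (ξ w)) := by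
  have hγξ : γ ∘ₗ ξ ∘ₗ γ = -ξ := LinearMap.ext fun v => by simp [hξ, γ_γ]
  have h0 : homPart 0 ξ = 0 := by simp [homPart, hγξ]
  have h1 : homPart 1 ξ = ξ := by
    rw [homPart, hγξ, sg_one]
    module
  have hgen0 : contrGen 0 ξ = 0 := by simp [contrGen, h0]
  have hgen1 : ∀ v, contrGen 1 ξ (Letters.df v) = zeroForm (ξ v) := fun v => by
    simp [contrGen, h1]
  have hder : ∀ (ε : ZMod 2) (f : Letters V →ₗ[ℂ] Forms V) (hf), Abel.der ε f hf
      (DR.mk (dvar v * dvar w)) = DR.mk (f (Letters.df v) * dvar w +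
        γpow ε (dvar v) * f (Letters.df w)) := fun ε f hf => by
    change DR.mk (superDer ε f (TensorAlgebra.ι ℂ _ * TensorAlgebra.ι ℂ _)) = _
    rw [superDer_mul, superDer_ι, superDer_ι]
    rfl
  have huniv : (Finset.univ : Finset (ZMod 2)) = {0, 1} := by decide
  rw [DR.contr, huniv, Finset.sum_pair (by decide), LinearMap.add_apply, hder, hder, hgen0, hgen1,
    hgen1]
  have h2 : γpow ((1 : ZMod 2) + 1) (dvar v) = dvar v := by
    rw [show (1 : ZMod 2) + 1 = 0 by decide]
    simp [γpow]
  rw [h2]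
  simp

/-- The sign `sg (a + 1)` comes from the normalization of `Υ` on `d(dv · w)`, where `d` moves past
`dv`. -/
theorem upsilon_dvar_mul_dvar {a : ZMod 2} {v w : V} (hv : v ∈ part V a) (hw : w ∈ part V a) :
    DR.upsilon (DR.mk (dvar v * dvar w)) = sg (a + 1) • (PiTensorProduct.tprod ℂ ![v, w] -
      sg a • PiTensorProduct.tprod ℂ ![w, v]) := by
  have hdf : ∀ {u}, u ∈ part V a → Letters.df u ∈ part (Letters V) (a + 1) := fun {u} hu => by
    rw [mem_part, Letters.γ_def, Letters.fst_df, Letters.snd_df, mem_part.mp hu]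
    simp [sg_add]
  have h1 : dvar v * dvar w = TensorAlgebra.tprod ℂ (Letters V) 2 ![Letters.df v, Letters.df w] := by
    simp [TensorAlgebra.tprod_apply, dvar]
  have h2 : ∀ a : ZMod 2, (a + 1 + 1) * (a + 1 + 1) = a := by decide
  have h3 : DR.upsilon (DR.mk (dvar v * dvar w)) = upsilonForms (dvar v * dvar w) :=
    Submodule.liftQ_apply _ _ _
  have h4 := upsilonForms_tprod (u := ![Letters.df v, Letters.df w]) (p := a + 1) (q := a + 1)
    (by simpa using hdf hv) (by simpa using hdf hw)
  rw [h2] at h4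
  simp only [Matrix.cons_val_zero, Matrix.cons_val_one, Letters.snd_df] at h4
  rw [h3, h1, h4]

end Contractions

/-- The sign identity behind `N h_k = A.tensor k`. On the left are the signs of `initγ` and of
moving `dv` to the end, on the right those of `Υ`. -/
theorem smul_combination {E : Type*} [AddCommGroup E] [Module ℂ E] (c : ℂ) (a : ZMod 2) (x y : E) :
    c • (sg (a + 1) • x + sg ((a + 1) * (a + 1)) • sg (a + 1) • y) =
      (c * sg (a + 1)) • (x - sg a • y) := by
  rcases zmod2_cases a with rfl | rfl
  · simp
    module
  · simp [show (1 : ZMod 2) + 1 = 0 by decide]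

/-! ### The norm of the Hamiltonian is the family of structure tensors. -/

namespace MinimalSymplecticAInf

variable {U : Type*} [AddCommGroup U] [Module ℂ U] [Superspace U] [FiniteDimensional ℂ U]

/-- The operation is the transpose of the component of the vector field; finite dimensionality lets
it take values in `U` and not in the bidual. -/
theorem apply_op (A : MinimalSymplecticAInf U) (k : ℕ) (f : PiDual U) (t : ⨂[ℂ]^k U) :
    f (A.op k t) = PiTensorProduct.dualDistrib (A.m k f) t := by
  have h := LinearEquiv.apply_symm_apply (Module.evalEquiv ℂ U)
    ((PiTensorProduct.dualDistrib ∘ₗ A.m k).flip t)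
  exact LinearMap.congr_fun h f

/-- A presentation of a symplectic form as a sum of terms `da db`, with `a` and `b` homogeneous of
the same parity. -/
structure Presentation (A : MinimalSymplecticAInf U) (ι : Type*) [Fintype ι] where
  coeff : ι → ℂ
  left : ι → PiDual U
  right : ι → PiDual U
  parity : ι → ZMod 2
  left_mem : ∀ s, left s ∈ part (PiDual U) (parity s)
  right_mem : ∀ s, right s ∈ part (PiDual U) (parity s)
  eq : A.ω = DR.mk (∑ s, coeff s • (dvar (left s) * dvar (right s)))

namespace Presentation

variable {A : MinimalSymplecticAInf U} {ι : Type*} [Fintype ι] (R : Presentation A ι)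

theorem inner_apply (x y : U) : A.inner x y = ∑ s, R.coeff s * sg (R.parity s + 1) *
    (R.left s x * R.right s y - sg (R.parity s) * (R.right s x * R.left s y)) := by
  change PiTensorProduct.dualDistrib (DR.upsilon A.ω) (PiTensorProduct.tprod ℂ ![x, y]) = _
  rw [R.eq, map_sum, map_sum, map_sum, LinearMap.sum_apply]
  refine Finset.sum_congr rfl fun s _ => ?_
  rw [map_smul, map_smul, upsilon_dvar_mul_dvar (R.left_mem s) (R.right_mem s)]
  simp only [map_smul, map_sub, LinearMap.smul_apply, LinearMap.sub_apply,
    PiTensorProduct.dualDistrib_apply, Fin.prod_univ_two, smul_eq_mul]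
  simp [mul_assoc]

theorem m_mem {k : ℕ} {a : ZMod 2} {v : PiDual U} (hv : v ∈ part (PiDual U) a) :
    A.m k v ∈ part (⨂[ℂ]^k (PiDual U)) (a + 1) := by
  rw [mem_part, A.odd, mem_part.mp hv, map_smul, sg_add]
  simp

/-- Expanding the inner product in the presentation, each functional applied to the operation's
value becomes that functional's image under `A.m k`, and the other functional reads the last
argument. -/
theorem tensor_succ (k : ℕ) : A.tensor (k + 1) = ∑ s, (R.coeff s * sg (R.parity s + 1)) •
    (snoc k (A.m k (R.left s)) (R.right s) -
      sg (R.parity s) • snoc k (A.m k (R.right s)) (R.left s)) := by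
  rw [tensor, LinearEquiv.symm_apply_eq]
  refine PiTensorProduct.ext (MultilinearMap.ext fun x => ?_)
  change PiTensorProduct.lift _ (PiTensorProduct.tprod ℂ x) =
    PiTensorProduct.dualDistrib _ (PiTensorProduct.tprod ℂ x)
  rw [PiTensorProduct.lift.tprod]
  change A.inner (A.op k (PiTensorProduct.tprod ℂ (Fin.init x))) (x (Fin.last k)) = _
  rw [R.inner_apply, map_sum, LinearMap.sum_apply]
  refine Finset.sum_congr rfl fun s _ => ?_
  simp only [map_smul, map_sub, LinearMap.smul_apply, LinearMap.sub_apply, dualDistrib_snoc,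
    apply_op, smul_eq_mul]

include R in
-- Comparing the coefficients of the two sides of `dh = i_m ω`, with the differential last. The left
-- gives `initγ` of the norm, and `initγ` is an involution; the right gives the summands of
-- `tensor_succ` by `smul_combination`.
theorem normOp_hamiltonian {k : ℕ} {t : ⨂[ℂ]^(k + 1) (PiDual U)}
    (ht : DR.d (DR.mk (zeroForm t)) = DR.contr (A.m k) A.ω) :
    normOp (k + 1) t = A.tensor (k + 1) := by
  have h1 := congrArg (fun z => initγ k (oneFormCoeff k z)) ht
  rw [oneFormCoeff_d, initγ_initγ, R.eq] at h1
  rw [h1, R.tensor_succ, map_sum, map_sum, map_sum, map_sum]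
  refine Finset.sum_congr rfl fun s _ => ?_
  rw [map_smul, map_smul, contr_dvar_mul_dvar (A.odd k), map_add, map_smul, map_add,
    oneFormCoeff_mul_dvar _ (R.right_mem s), oneFormCoeff_dvar_mul (R.left_mem s)
      (m_mem (R.right_mem s)), map_smul, map_add, map_smul, initγ_snoc, initγ_snoc,
    mem_part.mp (m_mem (R.left_mem s)), mem_part.mp (m_mem (R.right_mem s))]
  simp only [map_smul, LinearMap.smul_apply]
  exact smul_combination _ _ _ _

include R in
theorem norm_hamiltonian {h : ∀ k, Cyc (PiDual U) k} (hh : A.IsHamiltonian h) (k : ℕ) :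
    Cyc.norm (k + 1) (h (k + 1)) = A.tensor (k + 1) := by
  obtain ⟨t, ht, hd⟩ := hh.eq k
  rw [← ht, Cyc.norm_mk, R.normOp_hamiltonian hd]

include R in
-- Each summand has parity `(a + 1) + a = 1`, as `m` is odd and the paired functionals have equal
-- parity. This oddness is what cancels the signs of the antisymmetrizer.
theorem tensor_mem (k : ℕ) : A.tensor (k + 1) ∈ part (⨂[ℂ]^(k + 1) (PiDual U)) 1 := by
  have hsnoc : ∀ {a : ZMod 2} {v w : PiDual U}, v ∈ part (PiDual U) a → w ∈ part (PiDual U) a →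
      snoc k (A.m k v) w ∈ part (⨂[ℂ]^(k + 1) (PiDual U)) 1 := by
    intro a v w hv hw
    rw [mem_part]
    refine (map_snoc (fun _ => γ) (A.m k v) w).trans ?_
    change snoc k (γ (A.m k v)) (γ w) = _
    rw [mem_part.mp (m_mem hv), mem_part.mp hw]
    simp [sg_add, smul_smul, sg_mul_self]
  rw [R.tensor_succ]
  exact Submodule.sum_mem _ fun s _ => Submodule.smul_mem _ _ (Submodule.sub_mem _
    (hsnoc (R.left_mem s) (R.right_mem s))
    (Submodule.smul_mem _ _ (hsnoc (R.right_mem s) (R.left_mem s))))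

end Presentation

/-! ### Darboux coordinates and the inverse inner product. -/

namespace Darboux

variable {A : MinimalSymplecticAInf U} {n m : ℕ} (D : A.Darboux n m)

/-- The coordinates on `ΠU` corresponding to those of `ℂ^{2n|m}`. -/
def coord (i : Fin n ⊕ Fin n ⊕ Fin m) : PiDual U := D.φ.symm (Can.coord i)

theorem symm_γ (v : Can (Fin n) (Fin m)) : D.φ.symm (γ v) = γ (D.φ.symm v) := by
  rw [LinearEquiv.symm_apply_eq]
  refine Eq.trans ?_ (D.even _).symm
  simp

theorem coord_mem (i : Fin n ⊕ Fin n ⊕ Fin m) {a : ZMod 2} (ha : Can.sign i = sg a) :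
    D.coord i ∈ part (PiDual U) a := by
  rw [mem_part, coord, ← symm_γ, Can.γ_coord, map_smul, ha]

theorem formsMap_dvar {V W : Type*} [AddCommGroup V] [Module ℂ V] [Superspace V]
    [AddCommGroup W] [Module ℂ W] [Superspace W] (f : V →ₗ[ℂ] W) (v : V) :
    formsMap f (dvar v) = dvar (f v) := by
  simp [formsMap, dvar]

/-- The presentation of the symplectic form in Darboux coordinates. -/
def presentation : A.Presentation (Fin n ⊕ Fin m) where
  coeff := Sum.elim (fun _ => 1) fun _ => 1 / 2
  left := Sum.elim (fun i => D.coord (.inl i)) fun i => D.coord (.inr (.inr i))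
  right := Sum.elim (fun i => D.coord (.inr (.inl i))) fun i => D.coord (.inr (.inr i))
  parity := Sum.elim (fun _ => 0) fun _ => 1
  left_mem := by
    rintro (i | i)
    · exact D.coord_mem _ (by simp [Can.sign])
    · exact D.coord_mem _ (by simp [Can.sign])
  right_mem := by
    rintro (i | i)
    · exact D.coord_mem _ (by simp [Can.sign])
    · exact D.coord_mem _ (by simp [Can.sign])
  eq := by
    -- The map on forms induced by `φ` is inverted by that of `φ.symm`, so `ω` is the canonical form
    -- with its coordinates pulled back.
    have hinv : ∀ z, DR.map D.φ.symm.toLinearMap D.symm_γ (DR.map D.φ.toLinearMap D.even z) = z := by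
      intro z
      obtain ⟨w, rfl⟩ := Submodule.mkQ_surjective _ z
      change DR.mk (formsMap _ (formsMap _ w)) = DR.mk w
      congr 1
      have : (formsMap D.φ.symm.toLinearMap).comp (formsMap D.φ.toLinearMap) = AlgHom.id ℂ _ := by
        ext w
        have hw : w = Letters.fn (Letters.fst w) + Letters.df (Letters.snd w) :=
          Prod.ext (add_zero _).symm (zero_add _).symm
        conv_rhs => rw [hw]
        simp [formsMap]
      exact DFunLike.congr_fun this w
    rw [← hinv A.ω, D.symplectic]
    change DR.mk (formsMap _ _) = _
    congr 1
    simp only [map_add, map_smul, map_sum, map_mul, formsMap_dvar, Fintype.sum_sum_type,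
      Sum.elim_inl, Sum.elim_inr, one_smul, Finset.smul_sum]
    rfl

theorem φ_coord (i : Fin n ⊕ Fin n ⊕ Fin m) : D.φ (D.coord i) = Can.coord i :=
  D.φ.apply_symm_apply _

/-- For an even pair `p_i, q_i` the sign in `Υ` is -1, which gives `q_i(u) p_i - p_i(u) q_i`. For an
odd coordinate the two terms of `Υ` are equal, and the factor 1/2 in the canonical form compensates.
-/
theorem φ_inner (u : U) : D.φ (A.inner u) =
    ∑ i, (D.coord (.inr (.inl i)) u • Can.p i - D.coord (.inl i) u • Can.q i) +
      ∑ i, D.coord (.inr (.inr i)) u • Can.x i := by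
  have : A.inner u = ∑ i, (D.coord (.inr (.inl i)) u • D.coord (.inl i) -
      D.coord (.inl i) u • D.coord (.inr (.inl i))) +
      ∑ i, D.coord (.inr (.inr i)) u • D.coord (.inr (.inr i)) := by
    ext y
    rw [D.presentation.inner_apply, Fintype.sum_sum_type]
    simp only [presentation, Sum.elim_inl, Sum.elim_inr, LinearMap.add_apply, LinearMap.sum_apply,
      LinearMap.sub_apply, LinearMap.smul_apply, smul_eq_mul]
    congr 1
    · refine Finset.sum_congr rfl fun i _ => ?_
      simp
    · refine Finset.sum_congr rfl fun i _ => ?_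
      rw [show (1 : ZMod 2) + 1 = 0 by decide]
      simp
      ring
  rw [this]
  simp only [map_add, map_sum, map_sub, map_smul, φ_coord]
  rfl

/-- Checked on coordinates: the canonical form, pulled back by `φ`, has the property that
characterizes the inverse inner product. -/
theorem form_φ_inner (u : U) (g : PiDual U) : Can.form (D.φ (A.inner u)) (D.φ g) = g u := by
  have : Can.form (D.φ (A.inner u)) = Module.Dual.eval ℂ U u ∘ₗ D.φ.symm.toLinearMap := by
    refine Can.ext fun i => ?_
    rw [φ_inner]
    simp only [map_add, map_sum, map_sub, map_smul, LinearMap.add_apply, LinearMap.sum_apply,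
      LinearMap.sub_apply, LinearMap.smul_apply, Can.form, Can.p, Can.q, Can.x, Can.lin_coord]
    rcases i with i | i | i <;> simp [Can.formCoord, coord]
  rw [this]
  simp

theorem inverseInner_eq (f g : PiDual U) : A.inverseInner f g = Can.form (D.φ f) (D.φ g) := by
  -- If `⟨u, -⟩ = 0`, then `form_φ_inner` shows that every functional vanishes on `u`. By equality
  -- of dimensions the inner product is then bijective, so `inverseInner` is not given by its
  -- default value 0.
  have hinj : Function.Injective A.inner := by
    rw [← LinearMap.ker_eq_bot, LinearMap.ker_eq_bot']
    intro u hu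
    rw [← Module.forall_dual_apply_eq_zero_iff ℂ]
    intro g
    rw [← D.form_φ_inner u g, hu]
    simp
  have hbij : Function.Bijective A.inner := ⟨hinj,
    (LinearMap.injective_iff_surjective_of_finrank_eq_finrank Subspace.dual_finrank_eq.symm).mp hinj⟩
  obtain ⟨u, rfl⟩ := hbij.2 f
  rw [form_φ_inner, inverseInner, dif_pos hbij, LinearMap.comp_apply]
  have : (LinearEquiv.ofBijective A.inner hbij).symm (A.inner u) = u :=
    (LinearEquiv.symm_apply_eq _).mpr rfl
  rw [LinearEquiv.coe_coe, this]
  rfl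

end Darboux

end MinimalSymplecticAInf

end Superspace

/-- A rotation of one place has a fixed point and the square of a rotation of two places is trivial,
both excluded for `Γ.rot`. The bound is needed because chains only contain Hamiltonians of order at
least three. -/
theorem RibbonGraph.FullOrder.three_le_val {Γ : RibbonGraph} (ρ : RibbonGraph.FullOrder Γ)
    (j : Fin ρ.r) : 3 ≤ ρ.val j := by
  obtain ⟨h, hh⟩ := Quotient.exists_rep (ρ.vertex j)
  obtain ⟨⟨i, a⟩, rfl⟩ := ρ.half.surjective h
  have hij : i = j := ρ.vertex.injective (by rw [← hh]; exact (ρ.vertexOf_half ⟨i, a⟩).symm)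
  subst hij
  have h1 : finRotate _ a ≠ a := fun h => Γ.rot_ne (ρ.half ⟨i, a⟩) (by rw [ρ.rot_half, h])
  have h2 : finRotate _ (finRotate _ a) ≠ a := fun h =>
    Γ.rot_rot_ne (ρ.half ⟨i, a⟩) (by rw [ρ.rot_half, ρ.rot_half, h])
  have h3 := a.2
  rw [Ne, Fin.ext_iff, Superspace.finRotate_val] at h1
  rw [Ne, Fin.ext_iff, Superspace.finRotate_val, Superspace.finRotate_val] at h2
  split_ifs at h1 h2 <;> omega

namespace Superspace

/-! ### Amplitudes of the exponential of an odd Hamiltonian. -/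

section Exponential

variable {V : Type*} [AddCommGroup V] [Module ℂ V] [Superspace V]
variable {W : Type*} [AddCommGroup W] [Module ℂ W] [Superspace W]

/-- When every factor is odd, all inversions count, and their number modulo 2 is the signature. -/
theorem sg_oddInv_odd {r : ℕ} (σ : Equiv.Perm (Fin r)) :
    sg (oddInv σ fun _ => 1) = ((Equiv.Perm.sign σ : ℤ) : ℂ) := by
  rw [Equiv.Perm.sign_eq_prod_prod_Ioi, oddInv, sg_sum]
  simp only [sg_sum]
  push_cast
  refine Finset.prod_congr rfl fun i _ => ?_
  rw [← Finset.prod_subset (Finset.subset_univ (Finset.Ioi i))]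
  · refine Finset.prod_congr rfl fun j hj => ?_
    rw [Finset.mem_Ioi] at hj
    have hne : σ i ≠ σ j := fun h => hj.ne (σ.injective h)
    rcases lt_or_gt_of_ne hne with h | h <;> simp [hj, h, h.not_gt]
  · intro j _ hj
    rw [Finset.mem_Ioi] at hj
    simp [hj]

/-- The antisymmetrization of a tensor product of odd Hamiltonians. -/
theorem antisymNorm_tprod {r : ℕ} {g : Fin r → Ham V}
    (hg : ∀ j, Ham.norm (g j) ∈ part (TensorAlgebra ℂ V) 1) :
    antisymNorm r (PiTensorProduct.tprod ℂ g) =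
      ∑ σ : Equiv.Perm (Fin r), PiTensorProduct.tprod ℂ fun j => Ham.norm (g (σ.symm j)) := by
  simp only [antisymNorm, LinearMap.comp_apply, LinearMap.sum_apply, LinearMap.smul_apply,
    PiTensorProduct.map_tprod]
  refine Finset.sum_congr rfl fun σ _ => ?_
  rw [koszul_tprod σ (p := fun _ => 1) hg, sg_oddInv_odd, smul_smul]
  have : ((Equiv.Perm.sign σ : ℤ) : ℂ) * ((Equiv.Perm.sign σ : ℤ) : ℂ) = 1 := by
    rcases Int.units_eq_one_or (Equiv.Perm.sign σ) with h | h <;> simp [h]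
  rw [this, one_smul]

theorem comp_toTensorAlgebra_of_ne {n k : ℕ} (h : n ≠ k) (t : ⨂[ℂ]^n V) :
    comp k (TensorPower.toTensorAlgebra t) = 0 := by
  rw [comp, LinearMap.comp_apply, compT_toTensorAlgebra_of_ne h, map_zero]

/-- The Feynman amplitude of the exponential of an odd Hamiltonian with `N h_k = T_k` is obtained by
attaching the tensors `T_k` to the vertices. -/
theorem OrderedGraph.feynman_expChain (B : V →ₗ[ℂ] V →ₗ[ℂ] ℂ) (G : OrderedGraph)
    (hG : ∀ j, 3 ≤ G.val j) {h : ∀ k, Cyc V k} {T : ∀ k, ⨂[ℂ]^k V}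
    (hT : ∀ k, 3 ≤ k → Cyc.norm k (h k) = T k) (hodd : ∀ k, 3 ≤ k → T k ∈ part (⨂[ℂ]^k V) 1) :
    G.feynman B (expChain B h) = kappa B G.n (koszul G.perm (concat G.val
      (PiTensorProduct.tprod ℂ fun j => TensorPower.toTensorAlgebra (T (G.val j))))) := by
  have hnorm : ∀ k, 3 ≤ k → Ham.norm (Ham.component h k) = TensorPower.toTensorAlgebra (T k) :=
    fun k hk => by
      rw [Ham.component, dif_pos hk, Ham.norm, Ham.lift_of, LinearMap.comp_apply, hT k hk]
  have hpart : ∀ k, Ham.norm (Ham.component h k) ∈ part (TensorAlgebra ℂ V) 1 := fun k => by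
    by_cases hk : 3 ≤ k
    · rw [hnorm k hk, mem_part, γ_toTensorAlgebra, mem_part.mp (hodd k hk), map_smul]
    · rw [Ham.component, dif_neg hk, map_zero]
      exact zero_mem _
  -- Each edge has two ends, so the valencies add up to the order of the component of the chain that
  -- the amplitude sees.
  have hsum : ∑ j, G.val j = 2 * G.n := by
    have := Fintype.card_congr G.chord
    simp only [Fintype.card_prod, Fintype.card_fin, Fintype.card_sigma] at this
    omega
  -- After permutation by `σ`, the amplitude vanishes unless the order of every factor matches the
  -- valency of the vertex it lands on. For given `σ` this singles out one tuple of orders, and the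
  -- value is then independent of `σ`.
  have hconcat : ∀ (k : Fin G.r → ℕ) (σ : Equiv.Perm (Fin G.r)),
      G.amplitude B (PiTensorProduct.tprod ℂ fun j =>
        Ham.norm (Ham.component h (k (σ.symm j)))) = if G.val ∘ σ = k then
          G.amplitude B (PiTensorProduct.tprod ℂ fun j =>
            TensorPower.toTensorAlgebra (T (G.val j))) else 0 := by
    intro k σ
    split_ifs with hk
    · subst hk
      congr 2
      funext j
      rw [Function.comp_apply, Equiv.apply_symm_apply, hnorm _ (hG j)]
    · obtain ⟨i, hi⟩ := Function.ne_iff.mp hk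
      rw [amplitude, LinearMap.comp_apply, LinearMap.comp_apply,
        concat_tprod_of_comp_eq_zero (j := σ i), map_zero, map_zero]
      rw [Equiv.symm_apply_apply]
      by_cases h3 : 3 ≤ k i
      · rw [hnorm _ h3]
        exact comp_toTensorAlgebra_of_ne (Ne.symm hi) _
      · rw [Ham.component, dif_neg h3, map_zero, map_zero]
  have hval : G.feynman B (expChain B h) = ((G.r.factorial : ℂ)⁻¹ *
      ∑ k ∈ Finset.finAntidiagonal G.r (2 * G.n),
        G.amplitude B (antisymNorm G.r (PiTensorProduct.tprod ℂ fun s =>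
          Ham.component h (k s)))) := by
    change G.feynmanAt B ((G.r.factorial : ℂ)⁻¹ • ∑ k ∈ Finset.finAntidiagonal G.r (2 * G.n), _) = _
    rw [map_smul, map_sum]
    rfl
  rw [hval]
  simp only [antisymNorm_tprod fun j => hpart _, map_sum, hconcat]
  rw [Finset.sum_comm]
  have hone : ∀ σ : Equiv.Perm (Fin G.r),
      (∑ k ∈ Finset.finAntidiagonal G.r (2 * G.n), if G.val ∘ σ = k then
        G.amplitude B (PiTensorProduct.tprod ℂ fun j =>
          TensorPower.toTensorAlgebra (T (G.val j))) else 0) =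
        G.amplitude B (PiTensorProduct.tprod ℂ fun j =>
          TensorPower.toTensorAlgebra (T (G.val j))) := fun σ => by
    rw [Finset.sum_ite_eq, if_pos]
    rw [Finset.mem_finAntidiagonal, ← hsum]
    exact Equiv.sum_comp σ G.val
  simp only [hone, Finset.sum_const, Finset.card_univ, Fintype.card_perm, Fintype.card_fin,
    nsmul_eq_mul]
  -- The `r!` equal contributions of the permutations cancel against the coefficient `1/r!` of the
  -- exponential.
  rw [inv_mul_cancel_left₀ (Nat.cast_ne_zero.mpr (Nat.factorial_ne_zero _))]
  rfl

theorem concat_map {r : ℕ} (k : Fin r → ℕ) (f : V →ₗ[ℂ] W) (t : ∀ j, ⨂[ℂ]^(k j) V) :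
    concat k (PiTensorProduct.tprod ℂ fun j =>
      TensorPower.toTensorAlgebra (PiTensorProduct.map (fun _ => f) (t j))) =
    PiTensorProduct.map (fun _ => f)
      (concat k (PiTensorProduct.tprod ℂ fun j => TensorPower.toTensorAlgebra (t j))) := by
  let F : TensorAlgebra ℂ V →ₐ[ℂ] TensorAlgebra ℂ W :=
    TensorAlgebra.lift ℂ (TensorAlgebra.ι ℂ ∘ₗ f)
  have hword : ∀ (n : ℕ) (v : Fin n → V), F (TensorAlgebra.tprod ℂ V n v) =
      TensorAlgebra.tprod ℂ W n fun i => f (v i) := fun n v => by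
    simp [F, TensorAlgebra.tprod_apply, map_list_prod, List.map_ofFn, Function.comp_def]
  have h1 : ∀ (n : ℕ) (s : ⨂[ℂ]^n V), TensorPower.toTensorAlgebra
      (PiTensorProduct.map (fun _ => f) s) =
        F (TensorPower.toTensorAlgebra s) := by
    intro n s
    have : TensorPower.toTensorAlgebra ∘ₗ PiTensorProduct.map (fun _ => f) =
        F.toLinearMap ∘ₗ
          (TensorPower.toTensorAlgebra : (⨂[ℂ]^n V) →ₗ[ℂ] _) := by
      refine PiTensorProduct.ext (MultilinearMap.ext fun v => ?_)
      change TensorPower.toTensorAlgebra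
        (PiTensorProduct.map (fun _ => f) (PiTensorProduct.tprod ℂ v)) =
          F (TensorPower.toTensorAlgebra (PiTensorProduct.tprod ℂ v))
      rw [PiTensorProduct.map_tprod, TensorPower.toTensorAlgebra_tprod,
        TensorPower.toTensorAlgebra_tprod, hword]
    exact LinearMap.congr_fun this s
  have h2 : concat k ∘ₗ PiTensorProduct.map (fun _ => F.toLinearMap) =
      PiTensorProduct.map (fun _ => f) ∘ₗ concat k := by
    refine tensor_words_ext fun n p v hv => ?_
    rw [LinearMap.comp_apply, LinearMap.comp_apply, PiTensorProduct.map_tprod]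
    simp only [AlgHom.toLinearMap_apply, hword]
    by_cases hn : ∀ j, n j = k j
    · obtain rfl : n = k := funext hn
      rw [concat_tprod_words, concat_tprod_words, PiTensorProduct.map_tprod]
    · push Not at hn
      obtain ⟨j, hj⟩ := hn
      rw [concat_tprod_of_comp_eq_zero (comp_tprod_of_ne hj _),
        concat_tprod_of_comp_eq_zero (comp_tprod_of_ne hj _), map_zero]
  have h3 := LinearMap.congr_fun h2
    (PiTensorProduct.tprod ℂ fun j => TensorPower.toTensorAlgebra (t j))
  rw [LinearMap.comp_apply, LinearMap.comp_apply, PiTensorProduct.map_tprod] at h3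
  simp only [h1]
  exact h3

theorem kappa_map {B : V →ₗ[ℂ] V →ₗ[ℂ] ℂ} {B' : W →ₗ[ℂ] W →ₗ[ℂ] ℂ} (f : V →ₗ[ℂ] W)
    (hf : ∀ v w, B' (f v) (f w) = B v w) (n : ℕ) (t : ⨂[ℂ]^(n * 2) V) :
    kappa B' n (PiTensorProduct.map (fun _ => f) t) = kappa B n t := by
  have : kappa B' n ∘ₗ PiTensorProduct.map (fun _ => f) = kappa B n := by
    refine PiTensorProduct.ext (MultilinearMap.ext fun v => ?_)
    simp only [LinearMap.compMultilinearMap_apply, LinearMap.comp_apply,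
      PiTensorProduct.map_tprod, kappa_tprod, hf]
  exact LinearMap.congr_fun this t

theorem norm_cycMap {k : ℕ} (f : V →ₗ[ℂ] W) (hf : ∀ v, f (γ v) = γ (f v)) (c : Cyc V k) :
    Cyc.norm k (Cyc.map f hf c) = PiTensorProduct.map (fun _ => f) (Cyc.norm k c) := by
  induction c using Cyc.ind with
  | h t => exact (normOp_comm _ (fun σ => map_koszul σ f hf) t).symm

end Exponential

/-! ### The canonical form and its stabilization. -/

namespace Can

variable {P X : Type}

theorem isSuperskew_form : IsSuperskew (form (P := P) (X := X)) := by
  have : (form (P := P) (X := X)).flip = -(form ∘ₗ γ) := by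
    refine ext fun i => ext fun j => ?_
    rw [LinearMap.flip_apply, LinearMap.neg_apply, LinearMap.comp_apply, γ_coord, map_smul,
      LinearMap.neg_apply, LinearMap.smul_apply]
    simp only [form, lin_coord]
    rcases i with i | i | i <;> rcases j with j | j | j <;>
      first
      | (simp [formCoord, sign]; done)
      | (rcases eq_or_ne i j with rfl | h
         · simp [formCoord, sign]
         · simp [formCoord, sign, h, h.symm])
  exact fun v w => LinearMap.congr_fun (LinearMap.congr_fun this v) w

theorem form_incl (n m : ℕ) (v w : Can (Fin n) (Fin m)) :
    form (incl n m v) (incl n m w) = form v w := by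
  have : form.compl₁₂ (incl n m) (incl n m) = form := by
    refine ext fun i => ext fun j => ?_
    simp only [LinearMap.compl₁₂_apply, incl, form, lin_coord]
    rcases i with i | i | i <;> rcases j with j | j | j <;> simp [formCoord, Fin.val_inj]
  exact LinearMap.congr_fun (LinearMap.congr_fun this v) w

end Can

/-! ### The amplitude of the characteristic class. -/

namespace MinimalSymplecticAInf

variable {U : Type*} [AddCommGroup U] [Module ℂ U] [Superspace U] [FiniteDimensional ℂ U]
variable {A : MinimalSymplecticAInf U}

/-- The contraction of the tensors `h_k` along a fully ordered graph. -/
def contraction (A : MinimalSymplecticAInf U) (G : OrderedGraph) : ℂ :=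
  kappa A.inverseInner G.n (koszul G.perm (concat G.val
    (PiTensorProduct.tprod ℂ fun j => TensorPower.toTensorAlgebra (A.tensor (G.val j)))))

/-- An even isometry `f` commutes with concatenation, Koszul permutation and contraction, so the
amplitude can be computed on `ΠU*` itself. Stating it for arbitrary `f` covers both `φ` and its
composition with the inclusion in the stable limit. -/
theorem Presentation.feynman_expChain {ι : Type*} [Fintype ι] (R : Presentation A ι)
    {h : ∀ k, Cyc (PiDual U) k} (hh : A.IsHamiltonian h)
    {V : Type*} [AddCommGroup V] [Module ℂ V] [Superspace V]
    {B : V →ₗ[ℂ] V →ₗ[ℂ] ℂ} (f : PiDual U →ₗ[ℂ] V) (hf : ∀ v, f (γ v) = γ (f v))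
    (hB : ∀ v w, B (f v) (f w) = A.inverseInner v w) {h' : ∀ k, Cyc V k}
    (hh' : ∀ k, Cyc.norm k (h' k) = PiTensorProduct.map (fun _ => f) (Cyc.norm k (h k)))
    (G : OrderedGraph) (hG : ∀ j, 3 ≤ G.val j) :
    G.feynman B (expChain B h') = A.contraction G := by
  rw [G.feynman_expChain B hG (T := fun k => PiTensorProduct.map (fun _ => f) (A.tensor k)),
    concat_map, ← LinearMap.comp_apply (koszul _), ← map_koszul _ f hf, LinearMap.comp_apply,
    kappa_map f hB]
  · rfl
  · intro k hk
    obtain ⟨k, rfl⟩ := Nat.exists_eq_succ_of_ne_zero (show k ≠ 0 by omega)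
    rw [hh', R.norm_hamiltonian hh]
  · intro k hk
    obtain ⟨k, rfl⟩ := Nat.exists_eq_succ_of_ne_zero (show k ≠ 0 by omega)
    rw [mem_part, γ_map f hf, mem_part.mp (R.tensor_mem k), map_smul]

namespace Darboux

variable {n m : ℕ} (D : A.Darboux n m)

theorem feynman_charClass {h : ∀ k, Cyc (PiDual U) k} (hh : A.IsHamiltonian h) (G : OrderedGraph)
    (hG : ∀ j, 3 ≤ G.val j) : G.feynman Can.form (D.charClass h) = A.contraction G :=
  D.presentation.feynman_expChain hh D.φ.toLinearMap D.even
    (fun v w => (D.inverseInner_eq v w).symm) (fun _ => norm_cycMap _ D.even _) G hG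

theorem feynman_stableCharClass {h : ∀ k, Cyc (PiDual U) k} (hh : A.IsHamiltonian h)
    (G : OrderedGraph) (hG : ∀ j, 3 ≤ G.val j) :
    G.feynman Can.form (D.stableCharClass h) = A.contraction G :=
  D.presentation.feynman_expChain hh (Can.incl n m ∘ₗ D.φ.toLinearMap)
    (fun v => by rw [LinearMap.comp_apply, D.even, Can.incl_γ, LinearMap.comp_apply])
    (fun v w => by
      rw [D.inverseInner_eq, ← Can.form_incl n m]
      rfl)
    (fun _ => by
      rw [norm_cycMap, hamiltonian, norm_cycMap, PiTensorProduct.map_comp, LinearMap.comp_apply])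
    G hG

end Darboux

theorem IsPartitionFunction.ext {Z Z' : GraphComplex →ₗ[ℂ] ℂ} (hZ : A.IsPartitionFunction Z)
    (hZ' : A.IsPartitionFunction Z') : Z = Z' :=
  GraphComplex.hom_ext fun Γ => by rw [hZ Γ Γ.order Γ.order_mem, hZ' Γ Γ.order Γ.order_mem]

end MinimalSymplecticAInf

end Superspace

end

open Superspace in
theorem theorem6p11 {U : Type*} [AddCommGroup U] [Module ℂ U] [Superspace U]
    [FiniteDimensional ℂ U] (A : MinimalSymplecticAInf U) (h : ∀ k, Cyc (PiDual U) k)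
    (hh : A.IsHamiltonian h) (n m : ℕ) (D : A.Darboux n m) :
    -- the partition function and the pairings are well defined on the graph complex
    (∃! Z : GraphComplex →ₗ[ℂ] ℂ, A.IsPartitionFunction Z) ∧
    (∃! P, IsPairing (Can.form (P := Fin n) (X := Fin m)) P) ∧
    (∃! P, IsPairing (Can.form (P := ℕ) (X := ℕ)) P) ∧
    ∀ Z : GraphComplex →ₗ[ℂ] ℂ, A.IsPartitionFunction Z →
      -- `⟪c_A, -⟫ = Z_A`, on the chains of `ℂ^{2n|m}` and in the stable limit
      (∀ P, IsPairing Can.form P → P (D.charClass h) = Z) ∧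
      (∀ P, IsPairing Can.form P → P (D.stableCharClass h) = Z) ∧
      -- `F_Γ(c_A) = |Aut Γ| Z_A(Γ)`
      ∀ (Γ : OrientedRibbonGraph), ∀ ρ ∈ Γ.orientation.carrier,
        ρ.feynman Can.form (D.charClass h) = Nat.card Γ.Aut * Z Γ.cls ∧
        ρ.feynman Can.form (D.stableCharClass h) = Nat.card Γ.Aut * Z Γ.cls := by
  have hfin : ∀ {Γ : RibbonGraph} (ρ : Γ.FullOrder),
      ρ.feynman Can.form (D.charClass h) = A.contraction ρ.toOrderedGraph :=
    fun ρ => D.feynman_charClass hh _ ρ.three_le_val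
  have hstable : ∀ {Γ : RibbonGraph} (ρ : Γ.FullOrder),
      ρ.feynman Can.form (D.stableCharClass h) = A.contraction ρ.toOrderedGraph :=
    fun ρ => D.feynman_stableCharClass hh _ ρ.three_le_val
  have hP : ∀ P, IsPairing Can.form P → A.IsPartitionFunction (P (D.charClass h)) :=
    fun P hP Γ ρ hρ => by rw [hP _ Γ ρ hρ, hfin]; rfl
  have hP' : ∀ P, IsPairing Can.form P → A.IsPartitionFunction (P (D.stableCharClass h)) :=
    fun P hP Γ ρ hρ => by rw [hP _ Γ ρ hρ, hstable]; rfl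
  have hpair := existsUnique_isPairing (Can.isSuperskew_form (P := Fin n) (X := Fin m))
  refine ⟨?_, hpair, existsUnique_isPairing Can.isSuperskew_form, fun Z hZ =>
    ⟨fun P h => (hP P h).ext hZ, fun P h => (hP' P h).ext hZ, fun Γ ρ hρ => ?_⟩⟩
  -- Existence of the partition function: pairing with the characteristic class is a map on the
  -- graph complex with the required values.
  · obtain ⟨P, h, _⟩ := hpair
    exact ⟨_, hP P h, fun Z hZ => hZ.ext (hP P h)⟩
  · have hZΓ : A.contraction ρ.toOrderedGraph = Nat.card Γ.Aut * Z Γ.cls := by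
      -- The identity automorphism makes the number of automorphisms nonzero, so the division can be
      -- undone.
      rw [hZ Γ ρ hρ, mul_div_cancel₀ _ (Nat.cast_ne_zero.mpr Γ.card_aut_ne_zero)]
      rfl
    exact ⟨(hfin ρ).trans hZΓ, (hstable ρ).trans hZΓ⟩
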